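/- **Setting.** A pair $(a,b)$ of phases attached to a node stands for the angles $(\alpha,\beta)$; for $a,b\in\mathbb Z_3$ it abbreviates the angles $(\tfrac{2\pi}{3}a,\tfrac{2\pi}{3}b)$. Put $\omega=e^{2\pi i/3}$ and $|\omega^k\rangle=\sum_{j=0}^{2}\omega^{kj}|j\rangle$ (so $|\omega^0\rangle=|+\rangle$). *Diagrams.* Diagrams $D:n\to m$ of the qutrit ZX-calculus are built by sequential and parallel composition from green spiders $Z^{n,m}(\alpha,\beta)$, red spiders $X^{n,m}(\alpha,\beta)$ ($\alpha,\beta\in\mathbb R/2\pi\mathbb Z$), nodes $H,H^\dagger:1\to1$, the wire, the swap and the empty diagram. The standard interpretation is $[\![Z^{n,m}(\alpha,\beta)]\!]=|0\rangle^{\otimes m}\langle0|^{\otimes n}+e^{i\alpha}|1\rangle^{\otimes m}\langle1|^{\otimes n}+e^{i\beta}|2\rangle^{\otimes m}\langle2|^{\otimes n}$, the same for $X^{n,m}(\alpha,\beta)$ with $|\omega^k\rangle$ in place of $|k\rangle$, and $[\![H]\!]=\sum_k|\omega^k\rangle\langle k|$, $[\![H^\dagger]\!]=\sum_k|k\rangle\langle\omega^k|$.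 *Rules.* Two diagrams are equal in the calculus if one can be rewritten into the other by the laws of a strict symmetric monoidal category and the following rules, applied in either direction to any part of a diagram (written from first to last with "$;$"; zero phases are omitted): (S1) two green spiders joined by at least one wire fuse, and their phase pairs add; (S2) $Z^{1,1}$ and $X^{1,1}$ are the wire; (S3) the inputs, and the outputs, of a green spider may be permuted; (B1) $X^{0,1};Z^{1,2}=X^{0,1}\otimes X^{0,1}$; (B2) $(Z^{1,2}\otimes Z^{1,2});(1\otimes\mathrm{swap}\otimes1);(X^{2,1}\otimes X^{2,1})=X^{2,1};Z^{1,2}$; (K1) $X^{1,1}(a,b);Z^{1,m}=Z^{1,m};X^{1,1}(a,b)^{\otimes m}$ for $(a,b)\in\{(1,2),(2,1)\}$; (K2) $X^{1,1}(1,2);Z^{1,1}(\alpha,\beta)=Z^{1,1}(-\beta,\alpha-\beta);X^{1,1}(1,2)$ and $X^{1,1}(2,1);Z^{1,1}(\alpha,\beta)=Z^{1,1}(\beta-\alpha,-\alpha);X^{1,1}(2,1)$; (H1) $H;H^\dagger=1=H^\dagger;H$; (EU) $H=Z^{1,1}(2,2);X^{1,1}(2,2);Z^{1,1}(2,2)$;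 (H2) $(H^\dagger)^{\otimes n};Z^{n,m}(\alpha,\beta);H^{\otimes m}=X^{n,m}(\alpha,\beta)$; (H2$'$) $H^{\otimes n};Z^{n,m}(\alpha,\beta);(H^\dagger)^{\otimes m}=X^{n,m}(\beta,\alpha)$; (P1) $(X^{0,2}\otimes1);(1\otimes Z^{2,0})=H;H=H^\dagger;H^\dagger$. Non-zero scalars are ignored: a diagram $0\to0$ with non-zero interpretation may be replaced by the empty diagram. *Reduced GS-LC diagrams.* A stabilizer diagram is one all of whose phase angles are integer multiples of $2\pi/3$. For a $\mathbb Z_3$-weighted graph on $n$ vertices (symmetric adjacency matrix $\Gamma$ over $\mathbb Z_3$ with zero diagonal) the graph state diagram $0\to n$ has a green node with one output for each vertex, and an $H$ node (weight $1$) or $H^\dagger$ node (weight $2$) connecting the green nodes of the two ends of each edge. A GS-LC diagram is a graph state diagram with a single-qutrit Clifford operator (the vertex operator) applied to each output. Let $$\mathcal R=\{Z^{1,1}(a,b): a,b\in\mathbb Z_3\}\cup\{Z^{1,1}(p);X^{1,1}(p+m): p\in\{(1,1),(2,2)\},\ m\in\{(0,0),(1,2),(2,1)\}\}.$$ A GS-LC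 diagram is *reduced* if all its vertex operators belong to $\mathcal R$ and no two adjacent vertices $u,v$ (that is, $\Gamma_{uv}\neq0$) both have vertex operators including a red node. **Theorem.** Let $D:0\to n$ be a stabilizer diagram that represents a state, that is, $[\![D]\!]\neq0$. Then $D$ can be rewritten in the qutrit ZX-calculus into some reduced GS-LC diagram. -/

import Mathlib

noncomputable section

namespace QutritZX

/-! ## Diagrams -/

/-- Diagrams of the qutrit ZX-calculus with `n` inputs and `m` outputs, generated under sequential
and parallel composition by the green (`Z`) and red (`X`) spiders carrying a pair of phase angles
`(α, β)` (taken in `ℝ / 2πℤ`), the nodes `H` and `H†`, and bare wires.  `wires e` joins input `i`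
to output `e i`; the identity wire, the swap and the empty diagram are instances of it, and every
`wires e` is a composite of these. -/
inductive Diag : ℕ → ℕ → Type
  | zsp (n m : ℕ) (α β : Real.Angle) : Diag n m
  | xsp (n m : ℕ) (α β : Real.Angle) : Diag n m
  | had : Diag 1 1
  | hadDag : Diag 1 1
  | wires {n m : ℕ} (e : Fin n ≃ Fin m) : Diag n m
  | seq {n m k : ℕ} (A : Diag n m) (B : Diag m k) : Diag n k
  | par {n m n' m' : ℕ} (A : Diag n m) (B : Diag n' m') : Diag (n + n') (m + m')

namespace Diag

/-- `n` parallel identity wires; for `n = 0` this is the empty diagram. -/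
def idn (n : ℕ) : Diag n n := wires (Equiv.refl (Fin n))

/-- The swap `σ`. -/
def swap : Diag 2 2 := wires (Equiv.swap 0 1)

/-- Regrouping of the same wires along an equality of their numbers. -/
def cast {n m : ℕ} (h : n = m) : Diag n m := wires (finCongr h)

/-- The parallel composition of `n` one-wire diagrams. -/
def parAll : (n : ℕ) → (Fin n → Diag 1 1) → Diag n n
  | 0, _ => idn 0
  | n + 1, U => par (parAll n fun i => U i.castSucc) (U (Fin.last n))

/-- `n` parallel copies of a one-wire diagram. -/
def copies (n : ℕ) (A : Diag 1 1) : Diag n n := parAll n fun _ => A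

/-! ## Standard interpretation -/

/-- `ω = exp(2πi/3)`. -/
def omega : ℂ := Complex.exp (2 * Real.pi * Complex.I / 3)

/-- The coefficients `1, e^{iα}, e^{iβ}` of a spider. -/
def weight (α β : Real.Angle) : Fin 3 → ℂ :=
  ![1, (α.toCircle : ℂ), (β.toCircle : ℂ)]

/-- The coefficient of `|y⟩` in the (unnormalised) vector `∑ y, ω ^ (k y) |y⟩`; these are the
vectors `|+⟩, |ω⟩, |ω̄⟩` for `k = 0, 1, 2`. -/
def fourier (k y : Fin 3) : ℂ := omega ^ (k.val * y.val)

/-- The standard interpretation of a diagram, as a matrix with respect to the computational basis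
of `(ℂ³)^{⊗ n}`, whose elements are the functions `Fin n → Fin 3`. -/
def interp : {n m : ℕ} → Diag n m → Matrix (Fin m → Fin 3) (Fin n → Fin 3) ℂ
  | _, _, zsp _ _ α β => fun y x =>
      ∑ k, weight α β k * ((∏ i, if y i = k then 1 else 0) * ∏ i, if x i = k then 1 else 0)
  | _, _, xsp _ _ α β => fun y x =>
      ∑ k, weight α β k *
        ((∏ i, fourier k (y i)) * ∏ i, (starRingEnd ℂ) (fourier k (x i)))
  | _, _, had => fun y x => fourier (x 0) (y 0)
  | _, _, hadDag => fun y x => (starRingEnd ℂ) (fourier (y 0) (x 0))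
  | _, _, wires e => fun y x => if ∀ i, y (e i) = x i then 1 else 0
  | _, _, seq A B => interp B * interp A
  | _, _, @par n m n' m' A B => fun y x =>
      interp A (fun i => y (Fin.castAdd m' i)) (fun i => x (Fin.castAdd n' i)) *
        interp B (fun i => y (Fin.natAdd m i)) (fun i => x (Fin.natAdd n i))

/-! ## Stabilizer diagrams -/

/-- The angle `a · 2π/3` for `a ∈ ℤ/3`. -/
def ang (a : ZMod 3) : Real.Angle := ((a.val * (2 * Real.pi / 3) : ℝ) : Real.Angle)

/-- The angle is an integer multiple of `2π/3`. -/
def IsThird (α : Real.Angle) : Prop := ∃ k : ℤ, α = ((k * (2 * Real.pi / 3) : ℝ) : Real.Angle)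

/-- A stabilizer diagram: all phase angles are integer multiples of `2π/3`. -/
def IsStabilizer : {n m : ℕ} → Diag n m → Prop
  | _, _, zsp _ _ α β => IsThird α ∧ IsThird β
  | _, _, xsp _ _ α β => IsThird α ∧ IsThird β
  | _, _, had => True
  | _, _, hadDag => True
  | _, _, wires _ => True
  | _, _, seq A B => IsStabilizer A ∧ IsStabilizer B
  | _, _, par A B => IsStabilizer A ∧ IsStabilizer B

/-- The green phase gate with angles `(a · 2π/3, b · 2π/3)`. -/
def zph (a b : ZMod 3) : Diag 1 1 := zsp 1 1 (ang a) (ang b)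

/-- The red phase gate with angles `(a · 2π/3, b · 2π/3)`. -/
def xph (a b : ZMod 3) : Diag 1 1 := xsp 1 1 (ang a) (ang b)

/-! ## The equational theory -/

/-- Equality of diagrams in the qutrit ZX-calculus: the congruence generated by the laws of a strict
symmetric monoidal category and the rewriting rules.  As the calculus describes diagrams up to
non-zero scalar factors, a closed diagram of non-zero value may be dropped or added. -/
inductive Equal : {n m : ℕ} → Diag n m → Diag n m → Prop
  -- equivalence relation and congruence
  | refl {n m} (A : Diag n m) : Equal A A
  | symm {n m} {A B : Diag n m} : Equal A B → Equal B A
  | trans {n m} {A B C : Diag n m} : Equal A B → Equal B C → Equal A C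
  | seq_congr {n m k} {A A' : Diag n m} {B B' : Diag m k} :
      Equal A A' → Equal B B' → Equal (seq A B) (seq A' B')
  | par_congr {n m n' m'} {A A' : Diag n m} {B B' : Diag n' m'} :
      Equal A A' → Equal B B' → Equal (par A B) (par A' B')
  -- symmetric monoidal structure
  | seq_assoc {n m k l} (A : Diag n m) (B : Diag m k) (C : Diag k l) :
      Equal (seq (seq A B) C) (seq A (seq B C))
  | id_seq {n m} (A : Diag n m) : Equal (seq (idn n) A) A
  | seq_id {n m} (A : Diag n m) : Equal (seq A (idn m)) A
  | interchange {n m k n' m' k'} (A : Diag n m) (B : Diag m k) (A' : Diag n' m')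
      (B' : Diag m' k') :
      Equal (seq (par A A') (par B B')) (par (seq A B) (seq A' B'))
  | par_assoc {n m n' m' n'' m''} (A : Diag n m) (B : Diag n' m') (C : Diag n'' m'') :
      Equal (seq (par (par A B) C) (cast (Nat.add_assoc m m' m'')))
        (seq (cast (Nat.add_assoc n n' n'')) (par A (par B C)))
  | empty_par {n m} (A : Diag n m) :
      Equal (seq (par (idn 0) A) (cast (Nat.zero_add m))) (seq (cast (Nat.zero_add n)) A)
  | par_empty {n m} (A : Diag n m) : Equal (par A (idn 0)) A
  | wires_seq {n m k} (e : Fin n ≃ Fin m) (f : Fin m ≃ Fin k) :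
      Equal (seq (wires e) (wires f)) (wires (e.trans f))
  | wires_par {n m n' m'} (e : Fin n ≃ Fin m) (f : Fin n' ≃ Fin m') :
      Equal (par (wires e) (wires f))
        (wires (finSumFinEquiv.symm.trans ((e.sumCongr f).trans finSumFinEquiv)))
  | swap_natural {n m n' m'} (A : Diag n m) (B : Diag n' m') :
      Equal (seq (par A B) (wires finAddFlip)) (seq (wires finAddFlip) (par B A))
  -- (S1) two green spiders joined by `k ≥ 1` wires fuse
  | S1 (n m k n' m' : ℕ) (hk : 0 < k) (α β γ δ : Real.Angle) :
      Equal
        (seq (par (zsp n (m + k) α β) (idn n'))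
          (seq (cast (Nat.add_assoc m k n')) (par (idn m) (zsp (k + n') m' γ δ))))
        (zsp (n + n') (m + m') (α + γ) (β + δ))
  -- (S2) a green or red node with zero phases on a wire is the wire
  | S2_green : Equal (zsp 1 1 0 0) (idn 1)
  | S2_red : Equal (xsp 1 1 0 0) (idn 1)
  -- (S3) the legs of a green spider (in particular of the cup and the cap) may be permuted
  | S3_out (n m : ℕ) (α β : Real.Angle) (e : Fin m ≃ Fin m) :
      Equal (seq (zsp n m α β) (wires e)) (zsp n m α β)
  | S3_in (n m : ℕ) (α β : Real.Angle) (e : Fin n ≃ Fin n) :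
      Equal (seq (wires e) (zsp n m α β)) (zsp n m α β)
  -- (B1) copying
  | B1 : Equal (seq (xsp 0 1 0 0) (zsp 1 2 0 0)) (par (xsp 0 1 0 0) (xsp 0 1 0 0))
  -- (B2) bialgebra law
  | B2 :
      Equal
        (seq (par (zsp 1 2 0 0) (zsp 1 2 0 0))
          (seq (par (n := 1) (m := 1) (n' := 3) (m' := 3) (idn 1) (par swap (idn 1)))
            (par (n := 2) (n' := 2) (xsp 2 1 0 0) (xsp 2 1 0 0))))
        (seq (n := 2) (m := 1) (xsp 2 1 0 0) (zsp 1 2 0 0))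
  -- (K1) the red phases (1,2) and (2,1) are copied by green spiders
  | K1_12 (m : ℕ) :
      Equal (seq (xph 1 2) (zsp 1 m 0 0)) (seq (zsp 1 m 0 0) (copies m (xph 1 2)))
  | K1_21 (m : ℕ) :
      Equal (seq (xph 2 1) (zsp 1 m 0 0)) (seq (zsp 1 m 0 0) (copies m (xph 2 1)))
  -- (K2) commutation of these red phases with green phases
  | K2_12 (α β : Real.Angle) :
      Equal (seq (xph 1 2) (zsp 1 1 α β)) (seq (zsp 1 1 (-β) (α - β)) (xph 1 2))
  | K2_21 (α β : Real.Angle) :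
      Equal (seq (xph 2 1) (zsp 1 1 α β)) (seq (zsp 1 1 (β - α) (-α)) (xph 2 1))
  -- (H1) `H` and `H†` are mutually inverse
  | H1_left : Equal (seq had hadDag) (idn 1)
  | H1_right : Equal (seq hadDag had) (idn 1)
  -- (EU) Euler decomposition of `H`
  | EU : Equal had (seq (zph 2 2) (seq (xph 2 2) (zph 2 2)))
  -- (H2), (H2') the two colour changes
  | H2 (n m : ℕ) (α β : Real.Angle) :
      Equal (seq (copies n hadDag) (seq (zsp n m α β) (copies m had))) (xsp n m α β)
  | H2' (n m : ℕ) (α β : Real.Angle) :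
      Equal (seq (copies n had) (seq (zsp n m α β) (copies m hadDag))) (xsp n m β α)
  -- (P1) the dualiser: a red cup followed by a green cap is `H H = H† H†`
  | P1_cup :
      Equal
        (seq (par (n := 0) (n' := 1) (xsp 0 2 0 0) (idn 1))
          (par (n := 1) (n' := 2) (idn 1) (zsp 2 0 0 0)))
        (seq had had)
  | P1_had : Equal (seq had had) (seq hadDag hadDag)
  -- non-zero scalar factors are ignored
  | scalar (s : Diag 0 0) (hs : s.interp ≠ 0) : Equal s (idn 0)

/-! ## Graph states and reduced GS-LC diagrams -/

/-- The node of an edge: an `H` node for weight `1` and an `H†` node for weight `2`. -/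
def edgeNode (w : ZMod 3) : Diag 1 1 := if w = 1 then had else hadDag

/-- An edge of weight `w` between two wires: a green node on each wire, connected through an
`H` or `H†` node.  For weight `0` there is no edge. -/
def edge (w : ZMod 3) : Diag 2 2 :=
  if w = 0 then idn 2
  else
    seq (par (zsp 1 2 0 0) (idn 1))
      (seq (par (n := 1) (n' := 2) (idn 1) (par (edgeNode w) (idn 1)))
        (par (n := 1) (n' := 2) (idn 1) (zsp 2 1 0 0)))

/-- Edges of weights `w 0, …, w (n - 1)` from the last of `n + 1` wires to each of the
first `n`: connect it to its left neighbour, exchange the two, continue, and exchange back. -/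
def starEdges : (n : ℕ) → (Fin n → ZMod 3) → Diag (n + 1) (n + 1)
  | 0, _ => idn 1
  | n + 1, w =>
      seq (par (n := n) (m := n) (n' := 2) (m' := 2) (idn n) (edge (w (Fin.last n))))
        (seq (par (n := n) (m := n) (n' := 2) (m' := 2) (idn n) swap)
          (seq (par (n := n + 1) (n' := 1) (starEdges n fun i => w i.castSucc) (idn 1))
            (par (n := n) (m := n) (n' := 2) (m' := 2) (idn n) swap)))

/-- The graph state diagram of the `ℤ/3`-weighted graph on `Fin n` with adjacency matrix `Γ`: each
vertex is a green node with one output wire, and each edge is an `H` node (weight `1`) or an `H†`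
node (weight `2`) connected to the green nodes of its two ends.  Vertices are added one by one,
each with its edges to the earlier vertices; the green nodes on the wire of a vertex are all
directly connected, so that together they are one green spider.  Only the entries `Γ u v` with
`v < u` are read. -/
def graphState : (n : ℕ) → Matrix (Fin n) (Fin n) (ZMod 3) → Diag 0 n
  | 0, _ => idn 0
  | n + 1, Γ =>
      seq (par (graphState n (Γ.submatrix Fin.castSucc Fin.castSucc)) (zsp 0 1 0 0))
        (starEdges n fun i => Γ (Fin.last n) i.castSucc)

/-- The adjacency matrices of `ℤ/3`-weighted graphs: symmetric with zero diagonal. -/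
def IsAdjacency {n : ℕ} (Γ : Matrix (Fin n) (Fin n) (ZMod 3)) : Prop :=
  Γ.IsSymm ∧ ∀ v, Γ v v = 0

/-- Single-qutrit Clifford operator diagrams: composites of `H`, `H†`, green and red stabilizer
phase gates. -/
inductive IsLocalClifford : Diag 1 1 → Prop
  | id : IsLocalClifford (idn 1)
  | had : IsLocalClifford had
  | hadDag : IsLocalClifford hadDag
  | zph (a b : ZMod 3) : IsLocalClifford (zph a b)
  | xph (a b : ZMod 3) : IsLocalClifford (xph a b)
  | seq {A B : Diag 1 1} : IsLocalClifford A → IsLocalClifford B → IsLocalClifford (seq A B)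

/-- The diagram with vertex operators `U v` applied to the outputs of the graph state of `Γ`. -/
def gslc {n : ℕ} (Γ : Matrix (Fin n) (Fin n) (ZMod 3)) (U : Fin n → Diag 1 1) : Diag 0 n :=
  seq (graphState n Γ) (parAll n U)

/-- The phase pairs `𝓟 = {(1,1), (2,2)}`. -/
def phaseP : Set (ZMod 3 × ZMod 3) := {(1, 1), (2, 2)}

/-- The phase pairs `𝓜 = {(0,0), (1,2), (2,1)}`. -/
def phaseM : Set (ZMod 3 × ZMod 3) := {(0, 0), (1, 2), (2, 1)}

/-- The set `𝓡` of vertex operators of reduced diagrams: a green phase gate with an arbitrary pair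
of phases, or a green phase gate `p ∈ 𝓟` followed by a red phase gate `p + m` with `m ∈ 𝓜`. -/
def setR : Set (Diag 1 1) :=
  {A | (∃ a b : ZMod 3, A = zph a b) ∨
    ∃ p ∈ phaseP, ∃ m ∈ phaseM, A = seq (zph p.1 p.2) (xph (p + m).1 (p + m).2)}

/-- The diagram includes a red node. -/
def HasRed : {n m : ℕ} → Diag n m → Prop
  | _, _, zsp _ _ _ _ => False
  | _, _, xsp _ _ _ _ => True
  | _, _, had => False
  | _, _, hadDag => False
  | _, _, wires _ => False
  | _, _, seq A B => HasRed A ∨ HasRed B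
  | _, _, par A B => HasRed A ∨ HasRed B

/-- Reduced GS-LC diagrams: GS-LC diagrams all of whose vertex operators lie in `𝓡` and in which
the vertex operators of two adjacent vertices never both include red nodes. -/
def IsReducedGSLC {n : ℕ} (D : Diag 0 n) : Prop :=
  ∃ (Γ : Matrix (Fin n) (Fin n) (ZMod 3)) (U : Fin n → Diag 1 1),
    IsAdjacency Γ ∧ (∀ v, IsLocalClifford (U v)) ∧ D = gslc Γ U ∧
      (∀ v, U v ∈ setR) ∧ ∀ u v, Γ u v ≠ 0 → ¬ (HasRed (U u) ∧ HasRed (U v))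

end Diag

end QutritZX

end

noncomputable section

namespace QutritZX

namespace Diag

/-! ## Soundness of the calculus -/

/-! Up to a scalar, a qutrit stabilizer state is a uniform superposition over an affine subspace of
ℤ₃ⁿ, with amplitudes ω^q for a quadratic function q. The proof produces this form inside the
calculus. On basis states `S` is the phase ω^(x²), `Zp` is ω^x, `CZ` is ω^(xy), `X` is the shift by
-1 and `CX` sends (x, y) to (x, x + y), always up to scalars; `f * g` means f first. In the normal
form `NF D` the wires in D start in |0⟩ and the others in |+⟩. They then pass through pairwise
commuting gates: diagonal gates off D (the quadratic function), `CX` from outside D into D (the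
linear map) and `X` on D (the translation). The rules have to yield the behaviour of quadratic
phases under linear substitutions. The bialgebra law and the Euler decomposition give `cx_phase` and
`cx_cz`, and from these come `cz_three`, `CX_S` and `CX_CZ_same`. Hence normal forms are stable
under diagonal gates, shifts and suitable controlled sums: `NF.diag`, `NF.X`, `NF.CX`. The heart is
stability under the effect ⟨+| on one wire, `IsNF.drop`. A wire in D absorbs the effect. A wire that
controls a sum can be pivoted into D (`base_pivot`). Otherwise a change of variables merges its
links into a single one, and summing it out is a Fourier transform of a quadratic phase, which is a
quadratic phase or a basis state (`plus_ph_H`). With no link a scalar splits off, possibly zero.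
Since H and all spiders are built from |+⟩, ⟨+|, `cz`, phases and wires, every stabilizer state is
in normal form or equal to a diagram of value zero; soundness (`Equal.sound`) excludes the latter
here. Finally, in `NF.exists_graph`, the Hadamard nodes preparing D turn each `CX` into an edge
between a vertex outside D and a vertex in D, so D is an independent set. Vertices outside D carry
green phases. A vertex in D carries H† and a power of `X`. A green (2,2) can be inserted after H† at
the cost of changing the diagonal gates (`absorb_phases`), and by the Euler decomposition H†
followed by green (2,2) is green (1,1) followed by red (1,1) (`H'_ph`). That is the shape required
by 𝓡. -/

theorem omega_pow_three : omega ^ 3 = 1 := by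
  rw [omega, ← Complex.exp_nat_mul, ← Complex.exp_two_pi_mul_I]
  congr 1
  push_cast
  ring

theorem omega_ne_one : omega ≠ 1 := by
  rw [omega, Ne, Complex.exp_eq_one_iff]
  rintro ⟨n, hn⟩
  have h : (2 * Real.pi * Complex.I : ℂ) ≠ 0 := Complex.two_pi_I_ne_zero
  have h1 : (2 * Real.pi * Complex.I : ℂ) * (1 - 3 * n) = 0 := by linear_combination 3 * hn
  have h2 : (1 - 3 * n : ℂ) = 0 := (mul_eq_zero.1 h1).resolve_left h
  have h3 : (1 - 3 * n : ℤ) = 0 := by exact_mod_cast h2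
  omega

theorem omega_sum : 1 + omega + omega ^ 2 = 0 := by
  have h : (omega - 1) * (1 + omega + omega ^ 2) = 0 := by linear_combination omega_pow_three
  exact (mul_eq_zero.1 h).resolve_left (sub_ne_zero.2 omega_ne_one)

theorem conj_omega : (starRingEnd ℂ) omega = omega ^ 2 := by
  have h : (starRingEnd ℂ) omega = omega⁻¹ := by
    rw [omega, ← Complex.exp_conj, ← Complex.exp_neg]
    congr 1
    simp only [map_div₀, map_mul, Complex.conj_I, Complex.conj_ofReal, map_ofNat]
    ring
  have h0 : omega ≠ 0 := Complex.exp_ne_zero _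
  rw [h]
  field_simp
  linear_combination -omega_pow_three

theorem omega_pow_four : omega ^ 4 = omega := by linear_combination omega * omega_pow_three

theorem fourier_eq_matrix (k y : Fin 3) :
    Diag.fourier k y = !![1, 1, 1; 1, omega, omega ^ 2; 1, omega ^ 2, omega] k y := by
  fin_cases k <;> fin_cases y <;> simp [Diag.fourier, omega_pow_four]

theorem conj_fourier (k y : Fin 3) : (starRingEnd ℂ) (Diag.fourier k y) = Diag.fourier (-k) y := by
  have h : (omega ^ 2) ^ 2 = omega := by linear_combination omega_pow_four
  fin_cases k <;> fin_cases y <;> simp [fourier_eq_matrix, conj_omega, h]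

theorem fourier_comm (k y : Fin 3) : Diag.fourier k y = Diag.fourier y k := by
  rw [Diag.fourier, Diag.fourier, mul_comm]

theorem fourier_add (k y y' : Fin 3) :
    Diag.fourier k (y + y') = Diag.fourier k y * Diag.fourier k y' := by
  have h3 := omega_pow_three
  have h4 := omega_pow_four
  fin_cases k <;> fin_cases y <;> fin_cases y' <;> simp [fourier_eq_matrix, Fin.add_def] <;>
    first
    | linear_combination h3
    | linear_combination -h3
    | linear_combination h4
    | linear_combination -h4
    | ring

/-- Orthogonality of the characters of ℤ₃. It is what turns red spiders into shifts and additions of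
basis states. -/
theorem sum_fourier (y : Fin 3) : ∑ k, Diag.fourier k y = if y = 0 then 3 else 0 := by
  fin_cases y <;> simp [fourier_eq_matrix, Fin.sum_univ_three]
  · norm_num
  · exact omega_sum
  · linear_combination omega_sum

theorem interp_seq {n m k : ℕ} (A : Diag n m) (B : Diag m k) (y : Fin k → Fin 3)
    (x : Fin n → Fin 3) : interp (seq A B) y x = ∑ z, interp B y z * interp A z x :=
  Matrix.mul_apply

theorem interp_wires {n m : ℕ} (e : Fin n ≃ Fin m) (y : Fin m → Fin 3) (x : Fin n → Fin 3) :
    interp (wires e) y x = if y = x ∘ e.symm then 1 else 0 := by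
  show (if ∀ i, y (e i) = x i then (1 : ℂ) else 0) = _
  congr 1
  rw [eq_iff_iff, funext_iff]
  exact ⟨fun h i => by simp [← h], fun h i => by simp [h]⟩

theorem interp_zsp (n m : ℕ) (α β : Real.Angle) (y : Fin m → Fin 3) (x : Fin n → Fin 3) :
    interp (zsp n m α β) y x =
      ∑ k, weight α β k * ((∏ i, if y i = k then 1 else 0) * ∏ i, if x i = k then 1 else 0) := rfl

theorem interp_xsp (n m : ℕ) (α β : Real.Angle) (y : Fin m → Fin 3) (x : Fin n → Fin 3) :
    interp (xsp n m α β) y x =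
      ∑ k, weight α β k * ((∏ i, Diag.fourier k (y i)) * ∏ i, Diag.fourier (-k) (x i)) := by
  simp only [← conj_fourier]
  rfl

theorem interp_had (y x : Fin 1 → Fin 3) : interp had y x = Diag.fourier (x 0) (y 0) := rfl

theorem interp_hadDag (y x : Fin 1 → Fin 3) : interp hadDag y x = Diag.fourier (-(y 0)) (x 0) := by
  rw [← conj_fourier]; rfl

theorem interp_wires_seq {n m k : ℕ} (e : Fin n ≃ Fin m) (B : Diag m k) (y : Fin k → Fin 3)
    (x : Fin n → Fin 3) : interp (seq (wires e) B) y x = interp B y (x ∘ e.symm) := by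
  simp only [interp_seq, interp_wires, mul_ite, mul_one, mul_zero, Finset.sum_ite_eq',
    Finset.mem_univ, if_true]

theorem interp_seq_wires {n m k : ℕ} (A : Diag n m) (e : Fin m ≃ Fin k) (y : Fin k → Fin 3)
    (x : Fin n → Fin 3) : interp (seq A (wires e)) y x = interp A (y ∘ e) x := by
  have h : ∀ z : Fin m → Fin 3, y = z ∘ e.symm ↔ z = y ∘ e := fun z =>
    ⟨fun h => by ext i; simp [h], fun h => by ext i; simp [h]⟩
  simp only [interp_seq, interp_wires, h, ite_mul, one_mul, zero_mul, Finset.sum_ite_eq',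
    Finset.mem_univ, if_true]

theorem interp_idn (n : ℕ) (y x : Fin n → Fin 3) :
    interp (idn n) y x = if y = x then 1 else 0 := interp_wires _ _ _

theorem interp_par {n m n' m' : ℕ} (A : Diag n m) (B : Diag n' m') (y : Fin (m + m') → Fin 3)
    (x : Fin (n + n') → Fin 3) : interp (par A B) y x =
      interp A (fun i => y (Fin.castAdd m' i)) (fun i => x (Fin.castAdd n' i)) *
        interp B (fun i => y (Fin.natAdd m i)) (fun i => x (Fin.natAdd n i)) := rfl

theorem sum_append (n m : ℕ) (f : (Fin (n + m) → Fin 3) → ℂ) :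
    ∑ z, f z = ∑ u : Fin n → Fin 3, ∑ v : Fin m → Fin 3, f (Fin.append u v) := by
  rw [← Fintype.sum_prod_type', ← (Fin.appendEquiv n m).sum_comp]
  rfl

theorem sum_fin_one (f : (Fin 1 → Fin 3) → ℂ) : ∑ z, f z = ∑ j : Fin 3, f (fun _ => j) :=
  ((Equiv.funUnique (Fin 1) (Fin 3)).symm.sum_comp f).symm

theorem weight_add (α β γ δ : Real.Angle) (k : Fin 3) :
    weight (α + γ) (β + δ) k = weight α β k * weight γ δ k := by
  fin_cases k <;> simp [weight]

theorem weight_zero (k : Fin 3) : weight 0 0 k = 1 := by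
  fin_cases k <;> simp [weight]

/-- Two diagrams have the same interpretation up to a non-zero factor. -/
def Same {n m : ℕ} (A B : Diag n m) : Prop := ∃ c : ℂ, c ≠ 0 ∧ ∀ y x, interp A y x = c * interp B y x

theorem Same.of_eq {n m : ℕ} {A B : Diag n m} (h : ∀ y x, interp A y x = interp B y x) :
    Same A B := ⟨1, one_ne_zero, fun y x => by rw [h, one_mul]⟩

theorem same_interchange {n m k n' m' k'} (A : Diag n m) (B : Diag m k) (A' : Diag n' m')
      (B' : Diag m' k') :
      Same (seq (par A A') (par B B')) (par (seq A B) (seq A' B')) := by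
  refine Same.of_eq fun y x => ?_
  simp only [interp_par, interp_seq]
  rw [sum_append, Finset.sum_mul_sum]
  simp only [Fin.append_left, Fin.append_right]
  refine Finset.sum_congr rfl fun u _ => Finset.sum_congr rfl fun v _ => by ring

theorem same_par_assoc {n m n' m' n'' m''} (A : Diag n m) (B : Diag n' m') (C : Diag n'' m'') :
      Same (seq (par (par A B) C) (cast (Nat.add_assoc m m' m'')))
        (seq (cast (Nat.add_assoc n n' n'')) (par A (par B C))) := by
  refine Same.of_eq fun y x => ?_
  rw [Diag.cast, Diag.cast, interp_seq_wires, interp_wires_seq]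
  simp only [interp_par, mul_assoc]
  congr 1
  congr 1
  congr 1 <;> ext i <;> simp only [Function.comp_apply] <;> congr 2 <;> ext <;> simp <;> omega

theorem prod_indicator_append {n m : ℕ} (k : Fin 3) (u : Fin n → Fin 3) (v : Fin m → Fin 3) :
    (∏ i, if Fin.append u v i = k then (1 : ℂ) else 0) =
      (∏ i, if u i = k then (1 : ℂ) else 0) * ∏ i, if v i = k then (1 : ℂ) else 0 := by
  rw [Fin.prod_univ_add]
  simp

theorem prod_indicator {n : ℕ} (k : Fin 3) (u : Fin n → Fin 3) :
    (∏ i, if u i = k then (1 : ℂ) else 0) = if u = fun _ => k then 1 else 0 := by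
  split_ifs with h
  · simp [h]
  · obtain ⟨i, hi⟩ := Function.ne_iff.1 h
    exact Finset.prod_eq_zero (Finset.mem_univ i) (if_neg hi)

theorem same_S1 (n m k n' m' : ℕ) (hk : 0 < k) (α β γ δ : Real.Angle) :
      Same
        (seq (par (zsp n (m + k) α β) (idn n'))
          (seq (cast (Nat.add_assoc m k n')) (par (idn m) (zsp (k + n') m' γ δ))))
        (zsp (n + n') (m + m') (α + γ) (β + δ)) := by
  refine Same.of_eq fun y x => ?_
  obtain ⟨⟨y1, y2⟩, rfl⟩ := (Fin.appendEquiv m m').surjective y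
  obtain ⟨⟨x1, x2⟩, rfl⟩ := (Fin.appendEquiv n n').surjective x
  simp only [Fin.appendEquiv, Equiv.coe_fn_mk]
  have hcast : ∀ (u : Fin m → Fin 3) (v : Fin k → Fin 3) (w : Fin n' → Fin 3),
      Fin.append (Fin.append u v) w ∘ (finCongr (Nat.add_assoc m k n')).symm =
        Fin.append u (Fin.append v w) := by
    intro u v w
    rw [Fin.append_assoc]
    ext i
    simp
  rw [interp_seq, sum_append]
  simp only [Diag.cast, interp_wires_seq, interp_par, interp_idn, Fin.append_left, Fin.append_right,
    mul_ite, ite_mul, zero_mul, mul_zero, mul_one, one_mul]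
  rw [sum_append]
  simp only [hcast, Fin.append_left, Fin.append_right, Finset.sum_ite_eq', Finset.mem_univ, if_true]
  simp only [interp_zsp, prod_indicator_append]
  simp only [prod_indicator]
  rw [Finset.sum_comm]
  have heta : ∀ u : Fin m → Fin 3, ((fun i => y1 i) = fun i => u i) ↔ u = y1 :=
    fun u => ⟨fun h => h.symm, fun h => h.symm⟩
  simp only [heta, Finset.sum_ite_eq', Finset.mem_univ, if_true, Finset.mul_sum, Finset.sum_mul]
  refine ((Finset.sum_congr rfl fun v _ => Finset.sum_comm).trans Finset.sum_comm).trans ?_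
  refine Finset.sum_congr rfl fun p _ => ?_
  rw [Finset.sum_comm, Finset.sum_eq_single p, Finset.sum_eq_single (fun _ => p)]
  · rw [weight_add]; simp only [if_true]; ring
  · intro v _ hv
    simp [hv]
  · simp
  -- Terms with different values on the two spiders vanish: both values would have to occur on a
  -- shared wire, and 0 < k supplies one.
  · intro q _ hq
    refine Finset.sum_eq_zero fun v _ => ?_
    by_cases hv : v = fun _ => p
    · have : ¬ (v = fun _ => q) := by
        rw [hv]
        intro h
        exact hq (congrFun h ⟨0, hk⟩).symm
      simp [this]
    · simp [hv]
  · simp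

theorem same_S3_out (n m : ℕ) (α β : Real.Angle) (e : Fin m ≃ Fin m) :
    Same (seq (zsp n m α β) (wires e)) (zsp n m α β) := by
  refine Same.of_eq fun y x => ?_
  simp only [interp_seq_wires, interp_zsp, Function.comp_apply]
  refine Finset.sum_congr rfl fun k _ => ?_
  rw [e.prod_comp (fun i => if y i = k then (1 : ℂ) else 0)]

theorem same_S3_in (n m : ℕ) (α β : Real.Angle) (e : Fin n ≃ Fin n) :
    Same (seq (wires e) (zsp n m α β)) (zsp n m α β) := by
  refine Same.of_eq fun y x => ?_
  simp only [interp_wires_seq, interp_zsp, Function.comp_apply]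
  refine Finset.sum_congr rfl fun k _ => ?_
  rw [e.symm.prod_comp (fun i => if x i = k then (1 : ℂ) else 0)]

theorem interp_parAll (n : ℕ) (U : Fin n → Diag 1 1) (y x : Fin n → Fin 3) :
    interp (parAll n U) y x = ∏ i, interp (U i) (fun _ => y i) (fun _ => x i) := by
  induction n with
  | zero => simp [parAll, interp_idn, Subsingleton.elim y x]
  | succ n ih =>
    have h : ∀ i : Fin 1, Fin.natAdd n i = Fin.last n := fun i => by ext; simp
    rw [parAll, interp_par, ih, Fin.prod_univ_castSucc]
    simp only [h]
    rfl

/-- A green spider forces all its legs to one value, so both outer sums collapse; the two colour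
changes are instances. -/
theorem sandwich {n m : ℕ} (F : (Fin m → Fin 3) → ℂ) (G : (Fin n → Fin 3) → ℂ) (w : Fin 3 → ℂ) :
    ∑ u, (∑ z, F z * ∑ k, w k * ((∏ i, if z i = k then 1 else 0) *
      ∏ i, if u i = k then 1 else 0)) * G u = ∑ k, w k * (F (fun _ => k) * G (fun _ => k)) := by
  simp only [prod_indicator, Finset.mul_sum, Finset.sum_mul]
  refine ((Finset.sum_congr rfl fun v _ => Finset.sum_comm).trans Finset.sum_comm).trans ?_
  refine Finset.sum_congr rfl fun k _ => ?_
  rw [Finset.sum_eq_single (fun _ => k), Finset.sum_eq_single (fun _ => k)]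
  · simp only [if_true]; ring
  · intro v _ hv; simp [hv]
  · simp
  · intro v _ hv; simp [hv]
  · simp

theorem same_H2 (n m : ℕ) (α β : Real.Angle) :
    Same (seq (copies n hadDag) (seq (zsp n m α β) (copies m had))) (xsp n m α β) := by
  refine Same.of_eq fun y x => ?_
  simp only [interp_seq, copies, interp_parAll, interp_zsp, interp_had, interp_hadDag, interp_xsp]
  rw [sandwich (fun z => ∏ i, Diag.fourier (z i) (y i)) (fun z => ∏ i, Diag.fourier (-z i) (x i))]

theorem same_H2' (n m : ℕ) (α β : Real.Angle) :
    Same (seq (copies n had) (seq (zsp n m α β) (copies m hadDag))) (xsp n m β α) := by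
  refine Same.of_eq fun y x => ?_
  simp only [interp_seq, copies, interp_parAll, interp_zsp, interp_had, interp_hadDag, interp_xsp]
  rw [sandwich (fun z => ∏ i, Diag.fourier (-y i) (z i)) (fun z => ∏ i, Diag.fourier (x i) (z i))]
  have h : ∀ y k : Fin 3, Diag.fourier (-y) k = Diag.fourier (-k) y := fun y k => by
    rw [← conj_fourier, fourier_comm, conj_fourier]
  -- Reversing the roles of H and H† replaces k by -k, which exchanges the indices 1 and 2 and hence
  -- the two phases.
  have hw : ∀ k, weight β α (-k) = weight α β k := fun k => by fin_cases k <;> rfl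
  refine Fintype.sum_equiv (Equiv.neg (Fin 3)) _ _ fun k => ?_
  have hk : -(-k) = k := by fin_cases k <;> rfl
  simp only [Equiv.neg_apply, hw, hk, h _ k, fourier_comm _ k]

/-- The interpretation is a weighted function graph. -/
def IsGraph {n m : ℕ} (A : Diag n m) (f : (Fin n → Fin 3) → Fin m → Fin 3)
    (c : (Fin n → Fin 3) → ℂ) : Prop :=
  ∀ y x, interp A y x = if y = f x then c x else 0

theorem IsGraph.seq {n m k : ℕ} {A : Diag n m} {B : Diag m k} {f g c d} (hA : IsGraph A f c)
    (hB : IsGraph B g d) : IsGraph (seq A B) (fun x => g (f x)) (fun x => c x * d (f x)) := by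
  intro y x
  rw [interp_seq, Finset.sum_eq_single (f x)]
  · rw [hA, hB, if_pos rfl]; split_ifs <;> ring
  · intro z _ hz
    rw [hA, if_neg hz, mul_zero]
  · simp

theorem IsGraph.par {n m n' m' : ℕ} {A : Diag n m} {B : Diag n' m'} {f g c d} (hA : IsGraph A f c)
    (hB : IsGraph B g d) : IsGraph (par A B)
      (fun x => Fin.append (f fun i => x (Fin.castAdd n' i)) (g fun i => x (Fin.natAdd n i)))
      (fun x => c (fun i => x (Fin.castAdd n' i)) * d (fun i => x (Fin.natAdd n i))) := by
  intro y x
  obtain ⟨⟨y1, y2⟩, rfl⟩ := (Fin.appendEquiv m m').surjective y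
  simp only [Fin.appendEquiv, Equiv.coe_fn_mk]
  rw [interp_par, hA, hB]
  have : ∀ (u : Fin m → Fin 3) (v : Fin m' → Fin 3),
      Fin.append y1 y2 = Fin.append u v ↔ y1 = u ∧ y2 = v := fun u v => by
    constructor
    · intro h
      have h2 := (Fin.appendEquiv m m').injective (a₁ := (y1, y2)) (a₂ := (u, v)) h
      exact Prod.mk.inj h2
    · rintro ⟨rfl, rfl⟩; rfl
  simp only [this, Fin.append_left, Fin.append_right]
  by_cases h1 : y1 = f fun i => x (Fin.castAdd n' i) <;>
    by_cases h2 : y2 = g fun i => x (Fin.natAdd n i) <;> simp [h1, h2]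

theorem IsGraph.same {n m : ℕ} {A B : Diag n m} {f g c d} (hA : IsGraph A f c) (hB : IsGraph B g d)
    (h : f = g) (r : ℂ) (hr : r ≠ 0) (hc : ∀ x, c x = r * d x) : Same A B := by
  subst h
  refine ⟨r, hr, fun y x => ?_⟩
  rw [hA, hB, hc]
  split_ifs <;> ring

theorem isGraph_wires {n m : ℕ} (e : Fin n ≃ Fin m) :
    IsGraph (wires e) (fun x => x ∘ e.symm) (fun _ => 1) := interp_wires e

theorem isGraph_idn (n : ℕ) : IsGraph (idn n) (fun x => x) (fun _ => 1) := interp_wires _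

theorem isGraph_zsp (m : ℕ) (α β : Real.Angle) :
    IsGraph (zsp 1 m α β) (fun x _ => x 0) (fun x => weight α β (x 0)) := by
  intro y x
  simp only [interp_zsp, prod_indicator]
  rw [Finset.sum_eq_single (x 0)]
  · have : x = fun _ => x 0 := by ext i; rw [Subsingleton.elim i 0]
    rw [← this]; simp
  · intro k _ hk
    have : ¬ x = fun _ => k := fun h => hk (congrFun h 0).symm
    simp [this]
  · simp

theorem isGraph_xsp_zero : IsGraph (xsp 0 1 0 0) (fun _ _ => 0) (fun _ => 3) := by
  intro y x
  simp only [interp_xsp, weight_zero, Finset.univ_unique, Fin.default_eq_zero,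
    Finset.prod_singleton, Finset.univ_eq_empty, Finset.prod_empty, mul_one, one_mul, sum_fourier]
  congr 1
  rw [eq_iff_iff]
  exact ⟨fun h => by ext i; rw [Subsingleton.elim i 0, h], fun h => by rw [h]⟩

/-- With the signs moved onto the inputs, the summand is a single character evaluated at the output
minus both inputs, so orthogonality leaves addition modulo 3. -/
theorem isGraph_xsp_add : IsGraph (xsp 2 1 0 0) (fun x _ => x 0 + x 1) (fun _ => 3) := by
  intro y x
  have h : ∀ k y : Fin 3, Diag.fourier (-k) y = Diag.fourier k (-y) := fun k y => by
    rw [← conj_fourier, fourier_comm, conj_fourier, fourier_comm]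
  simp only [interp_xsp, weight_zero, Finset.univ_unique, Fin.default_eq_zero,
    Finset.prod_singleton, Fin.prod_univ_two, one_mul, h, ← fourier_add, sum_fourier]
  congr 1
  rw [eq_iff_iff]
  have key : ∀ a b c : Fin 3, a + (-b + -c) = 0 ↔ a = b + c := by decide
  rw [key]
  exact ⟨fun h => by ext i; rw [Subsingleton.elim i 0, h], fun h => by rw [h]⟩

theorem coe_ang (a : ZMod 3) : ((ang a).toCircle : ℂ) = omega ^ a.val := by
  rw [ang, Real.Angle.toCircle_coe, Circle.coe_exp, omega, ← Complex.exp_nat_mul]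
  congr 1
  push_cast
  ring

theorem weight_ang (a b : ZMod 3) (k : Fin 3) :
    weight (ang a) (ang b) k = ![1, omega ^ a.val, omega ^ b.val] k := by
  simp only [weight, coe_ang]

/-- The phases 1, ω, ω² are themselves a character in k, so they only displace the argument of the
orthogonality relation. -/
theorem isGraph_xph_one_two : IsGraph (xph 1 2) (fun x _ => x 0 - 1) (fun _ => 3) := by
  intro y x
  have h : ∀ k y : Fin 3, Diag.fourier (-k) y = Diag.fourier k (-y) := fun k y => by
    rw [← conj_fourier, fourier_comm, conj_fourier, fourier_comm]
  have hw : ∀ k, weight (ang 1) (ang 2) k = Diag.fourier k 1 := fun k => by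
    rw [weight_ang]
    fin_cases k <;> simp [fourier_eq_matrix, ZMod.val_one]
    rfl
  rw [xph, interp_xsp]
  simp only [hw, Finset.univ_unique, Fin.default_eq_zero,
    Finset.prod_singleton, h, ← fourier_add, sum_fourier]
  congr 1
  rw [eq_iff_iff]
  have key : ∀ a b : Fin 3, 1 + (a + -b) = 0 ↔ a = b - 1 := by decide
  rw [key]
  exact ⟨fun h => by ext i; rw [Subsingleton.elim i 0, h], fun h => by rw [h]⟩

theorem isGraph_xph_two_one : IsGraph (xph 2 1) (fun x _ => x 0 + 1) (fun _ => 3) := by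
  intro y x
  have h : ∀ k y : Fin 3, Diag.fourier (-k) y = Diag.fourier k (-y) := fun k y => by
    rw [← conj_fourier, fourier_comm, conj_fourier, fourier_comm]
  have hw : ∀ k, weight (ang 2) (ang 1) k = Diag.fourier k 2 := fun k => by
    rw [weight_ang]
    fin_cases k <;> simp [fourier_eq_matrix, ZMod.val_one]
    rfl
  rw [xph, interp_xsp]
  simp only [hw, Finset.univ_unique, Fin.default_eq_zero,
    Finset.prod_singleton, h, ← fourier_add, sum_fourier]
  congr 1
  rw [eq_iff_iff]
  have key : ∀ a b : Fin 3, 2 + (a + -b) = 0 ↔ a = b + 1 := by decide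
  rw [key]
  exact ⟨fun h => by ext i; rw [Subsingleton.elim i 0, h], fun h => by rw [h]⟩

theorem isGraph_copies (m : ℕ) {A : Diag 1 1} {f c} (h : IsGraph A f (fun _ => c)) :
    IsGraph (copies m A) (fun x i => f (fun _ => x i) 0) (fun _ => c ^ m) := by
  intro y x
  rw [copies, interp_parAll]
  simp only [h _ _]
  split_ifs with hy
  · subst hy
    rw [Finset.prod_congr rfl (fun i _ => if_pos (by ext j; rw [Subsingleton.elim j 0]))]
    simp
  · obtain ⟨i, hi⟩ := Function.ne_iff.1 hy
    exact Finset.prod_eq_zero (Finset.mem_univ i) (if_neg fun h => hi (congrFun h 0))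

theorem Same.symm {n m : ℕ} {A B : Diag n m} (h : Same A B) : Same B A := by
  obtain ⟨c, hc, h⟩ := h
  refine ⟨c⁻¹, inv_ne_zero hc, fun y x => ?_⟩
  rw [h, inv_mul_cancel_left₀ hc]

theorem Same.trans {n m : ℕ} {A B C : Diag n m} (h : Same A B) (h' : Same B C) : Same A C := by
  obtain ⟨c, hc, h⟩ := h
  obtain ⟨d, hd, h'⟩ := h'
  exact ⟨c * d, mul_ne_zero hc hd, fun y x => by rw [h, h', mul_assoc]⟩

theorem Same.seq_congr {n m k : ℕ} {A A' : Diag n m} {B B' : Diag m k} (h : Same A A')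
    (h' : Same B B') : Same (seq A B) (seq A' B') := by
  obtain ⟨c, hc, h⟩ := h
  obtain ⟨d, hd, h'⟩ := h'
  refine ⟨c * d, mul_ne_zero hc hd, fun y x => ?_⟩
  simp only [interp_seq, h, h', Finset.mul_sum]
  exact Finset.sum_congr rfl fun z _ => by ring

theorem Same.par_congr {n m n' m' : ℕ} {A A' : Diag n m} {B B' : Diag n' m'} (h : Same A A')
    (h' : Same B B') : Same (par A B) (par A' B') := by
  obtain ⟨c, hc, h⟩ := h
  obtain ⟨d, hd, h'⟩ := h'
  refine ⟨c * d, mul_ne_zero hc hd, fun y x => ?_⟩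
  simp only [interp_par, h, h']
  ring

theorem same_K1 (m : ℕ) {A : Diag 1 1} {f} (h : IsGraph A f (fun _ => 3)) :
    Same (seq A (zsp 1 m 0 0)) (seq (zsp 1 m 0 0) (copies m A)) := by
  refine (h.seq (isGraph_zsp m 0 0)).same ((isGraph_zsp m 0 0).seq (isGraph_copies m h)) ?_
    (3 / 3 ^ m) (div_ne_zero (by norm_num) (pow_ne_zero _ (by norm_num))) fun x => ?_
  · funext x i
    congr 1
    ext j
    rw [Subsingleton.elim j 0]
  · simp only [weight_zero]
    field_simp

theorem same_K2_12 (α β : Real.Angle) :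
    Same (seq (xph 1 2) (zsp 1 1 α β)) (seq (zsp 1 1 (-β) (α - β)) (xph 1 2)) := by
  -- The factor e^{iβ} is the phase met by input 0, which the shift sends to 2; the right-hand
  -- spider gives that input phase 1.
  refine (isGraph_xph_one_two.seq (isGraph_zsp 1 α β)).same
    ((isGraph_zsp 1 _ _).seq isGraph_xph_one_two) rfl (β.toCircle : ℂ) (by simp) fun x => ?_
  generalize x 0 = t
  have := Circle.coe_ne_zero β.toCircle
  have e : (2 + -1 : Fin 3) = 1 := rfl
  fin_cases t <;>
    simp [weight, e, Real.Angle.toCircle_add, Real.Angle.toCircle_neg, sub_eq_add_neg] <;> field_simp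

theorem same_K2_21 (α β : Real.Angle) :
    Same (seq (xph 2 1) (zsp 1 1 α β)) (seq (zsp 1 1 (β - α) (-α)) (xph 2 1)) := by
  refine (isGraph_xph_two_one.seq (isGraph_zsp 1 α β)).same
    ((isGraph_zsp 1 _ _).seq isGraph_xph_two_one) rfl (α.toCircle : ℂ) (by simp) fun x => ?_
  generalize x 0 = t
  have := Circle.coe_ne_zero α.toCircle
  fin_cases t <;>
    simp [weight, Real.Angle.toCircle_add, Real.Angle.toCircle_neg, sub_eq_add_neg] <;> field_simp

theorem same_H1_left : Same (seq had hadDag) (idn 1) := by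
  refine ⟨3, by norm_num, fun y x => ?_⟩
  rw [interp_seq, sum_fin_one, interp_idn]
  simp only [interp_had, interp_hadDag, fourier_comm (x 0), fourier_comm (-(y 0)), ← fourier_add,
    sum_fourier]
  have key : ∀ a b : Fin 3, -a + b = 0 ↔ a = b := by decide
  rw [mul_ite, mul_one, mul_zero]
  congr 1
  rw [key, eq_iff_iff]
  exact ⟨fun h => by ext i; rw [Subsingleton.elim i 0, h], fun h => by rw [h]⟩

theorem same_H1_right : Same (seq hadDag had) (idn 1) := by
  refine ⟨3, by norm_num, fun y x => ?_⟩
  have h : ∀ k y : Fin 3, Diag.fourier (-k) y = Diag.fourier k (-y) := fun k y => by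
    rw [← conj_fourier, fourier_comm, conj_fourier, fourier_comm]
  rw [interp_seq, sum_fin_one, interp_idn]
  simp only [interp_had, interp_hadDag, h, ← fourier_add, sum_fourier]
  have key : ∀ a b : Fin 3, a + -b = 0 ↔ a = b := by decide
  rw [mul_ite, mul_one, mul_zero]
  congr 1
  rw [key, eq_iff_iff]
  exact ⟨fun h => by ext i; rw [Subsingleton.elim i 0, h], fun h => by rw [h]⟩

theorem same_S2_red : Same (xsp 1 1 0 0) (idn 1) := by
  refine ⟨3, by norm_num, fun y x => ?_⟩
  have h : ∀ k y : Fin 3, Diag.fourier (-k) y = Diag.fourier k (-y) := fun k y => by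
    rw [← conj_fourier, fourier_comm, conj_fourier, fourier_comm]
  simp only [interp_xsp, interp_idn, weight_zero, Finset.univ_unique, Fin.default_eq_zero,
    Finset.prod_singleton, h, one_mul, ← fourier_add, sum_fourier]
  have key : ∀ a b : Fin 3, a + -b = 0 ↔ a = b := by decide
  rw [mul_ite, mul_one, mul_zero]
  congr 1
  rw [key, eq_iff_iff]
  exact ⟨fun h => by ext i; rw [Subsingleton.elim i 0, h], fun h => by rw [h]⟩

theorem same_S2_green : Same (zsp 1 1 0 0) (idn 1) := by
  refine (isGraph_zsp 1 0 0).same (isGraph_idn 1) ?_ 1 one_ne_zero fun x => ?_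
  · funext x i; rw [Subsingleton.elim i 0]
  · rw [weight_zero, one_mul]

theorem same_B1 : Same (seq (xsp 0 1 0 0) (zsp 1 2 0 0)) (par (xsp 0 1 0 0) (xsp 0 1 0 0)) := by
  refine (isGraph_xsp_zero.seq (isGraph_zsp 2 0 0)).same (isGraph_xsp_zero.par isGraph_xsp_zero)
    ?_ (1 / 3) (by norm_num) fun x => ?_
  · funext x i; fin_cases i <;> rfl
  · rw [weight_zero]; norm_num

theorem same_B2 : Same
        (seq (par (zsp 1 2 0 0) (zsp 1 2 0 0))
          (seq (par (n := 1) (m := 1) (n' := 3) (m' := 3) (idn 1) (par swap (idn 1)))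
            (par (n := 2) (n' := 2) (xsp 2 1 0 0) (xsp 2 1 0 0))))
        (seq (n := 2) (m := 1) (xsp 2 1 0 0) (zsp 1 2 0 0)) := by
  refine (((isGraph_zsp 2 0 0).par (isGraph_zsp 2 0 0)).seq
    (((isGraph_idn 1).par ((isGraph_wires _).par (isGraph_idn 1))).seq
      (isGraph_xsp_add.par isGraph_xsp_add))).same (isGraph_xsp_add.seq (isGraph_zsp 2 0 0))
    ?_ 3 (by norm_num) fun x => ?_
  · funext x i
    fin_cases i <;> rfl
  · simp only [weight_zero]; norm_num

theorem sum_fin_three (f : (Fin 3 → Fin 3) → ℂ) : ∑ z, f z = ∑ a, ∑ b, ∑ c, f ![a, b, c] := by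
  rw [sum_append 1 2, sum_fin_one]
  refine Finset.sum_congr rfl fun a _ => ?_
  rw [sum_append 1 1, sum_fin_one]
  refine Finset.sum_congr rfl fun b _ => ?_
  rw [sum_fin_one]
  refine Finset.sum_congr rfl fun c _ => ?_
  congr 1
  ext i
  fin_cases i <;> rfl

theorem same_P1_cup : Same
        (seq (par (n := 0) (n' := 1) (xsp 0 2 0 0) (idn 1))
          (par (n := 1) (n' := 2) (idn 1) (zsp 2 0 0 0)))
        (seq had had) := by
  refine Same.of_eq fun y x => ?_
  have key : ∀ a b c : Fin 3,
      interp (par (n := 1) (n' := 2) (idn 1) (zsp 2 0 0 0)) y ![a, b, c] *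
      interp (par (n := 0) (n' := 1) (xsp 0 2 0 0) (idn 1)) ![a, b, c] x =
      if a = y 0 then (if b = x 0 then (if c = x 0 then ∑ k, Diag.fourier k a * Diag.fourier k b
        else 0) else 0) else 0 := by
    intro a b c
    rw [interp_par, interp_par, interp_idn, interp_idn, interp_zsp, interp_xsp]
    have f1 : ((fun i : Fin 1 => y (Fin.castAdd 0 i)) =
        fun i : Fin 1 => (![a, b, c] : Fin 3 → Fin 3) (Fin.castAdd 2 i)) ↔ a = y 0 :=
      ⟨fun h => (congrFun h 0).symm, fun h => by ext i; rw [Subsingleton.elim i 0, h]; rfl⟩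
    have f2 : ((fun i : Fin 1 => (![a, b, c] : Fin 3 → Fin 3) (Fin.natAdd 2 i)) =
        fun i => x (Fin.natAdd 0 i)) ↔ c = x 0 :=
      ⟨fun h => congrFun h 0, fun h => by ext i; rw [Subsingleton.elim i 0, h]; rfl⟩
    have e2 : ∀ k : Fin 3, (∏ i : Fin 2, if (![a, b, c] : Fin 3 → Fin 3) (Fin.natAdd 1 i) = k
        then (1 : ℂ) else 0) = if b = k then if c = k then 1 else 0 else 0 := fun k => by
      rw [Fin.prod_univ_two]
      show (if b = k then (1 : ℂ) else 0) * (if c = k then 1 else 0) = _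
      split_ifs <;> simp
    have e3 : ∀ k : Fin 3, (∏ i : Fin 2, Diag.fourier k
        ((![a, b, c] : Fin 3 → Fin 3) (Fin.castAdd 1 i))) = Diag.fourier k a * Diag.fourier k b :=
      fun k => Fin.prod_univ_two _
    simp only [f1, f2, e2, e3, weight_zero, Finset.univ_eq_empty, Finset.prod_empty, one_mul,
      mul_one, Finset.sum_ite_eq, Finset.mem_univ, if_true]
    by_cases h : c = x 0
    · subst h
      by_cases h2 : b = x 0 <;> by_cases h3 : a = y 0 <;> simp [h2, h3, eq_comm]
    · simp [h]
  rw [interp_seq, interp_seq, sum_fin_three]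
  simp only [key, Finset.sum_ite_eq', Finset.mem_univ, if_true, sum_fin_one, Finset.sum_ite_irrel,
    Finset.sum_const_zero]
  refine Finset.sum_congr rfl fun k _ => ?_
  rw [interp_had, interp_had, fourier_comm (x 0)]

theorem same_P1_had : Same (seq had had) (seq hadDag hadDag) := by
  refine Same.of_eq fun y x => ?_
  rw [interp_seq, interp_seq, sum_fin_one, sum_fin_one]
  simp only [interp_had, interp_hadDag]
  refine Fintype.sum_equiv (Equiv.neg (Fin 3)) _ _ fun k => ?_
  have hk : -(-k) = k := by fin_cases k <;> rfl
  have h : ∀ k y : Fin 3, Diag.fourier (-k) y = Diag.fourier y (-k) := fun k y => fourier_comm _ _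
  have h2 : Diag.fourier (-(y 0)) (-k) = Diag.fourier k (y 0) := by
    rw [← conj_fourier, fourier_comm, conj_fourier, hk]
  simp only [Equiv.neg_apply, hk, h2, fourier_comm (x 0)]

theorem interp_zsp_seq {m : ℕ} (α β : Real.Angle) (B : Diag 1 m) (y : Fin m → Fin 3)
    (x : Fin 1 → Fin 3) : interp (seq (zsp 1 1 α β) B) y x = interp B y x * weight α β (x 0) := by
  have h : ∀ z : Fin 1 → Fin 3, z = (fun _ => x 0) ↔ z = x := fun z => by
    have : (fun _ => x 0) = x := by ext i; rw [Subsingleton.elim i 0]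
    rw [this]
  simp only [interp_seq, isGraph_zsp 1 α β _ _, h, mul_ite, mul_zero, Finset.sum_ite_eq',
    Finset.mem_univ, if_true]

theorem interp_seq_zsp {n : ℕ} (α β : Real.Angle) (A : Diag n 1) (y : Fin 1 → Fin 3)
    (x : Fin n → Fin 3) : interp (seq A (zsp 1 1 α β)) y x = weight α β (y 0) * interp A y x := by
  have h : ∀ z : Fin 1 → Fin 3, y = (fun _ => z 0) ↔ z = y := fun z => by
    have : (fun _ => z 0) = z := by ext i; rw [Subsingleton.elim i 0]
    rw [this]
    exact eq_comm
  simp only [interp_seq, isGraph_zsp 1 α β _ _, h, ite_mul, zero_mul, Finset.sum_ite_eq',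
    Finset.mem_univ, if_true]

theorem same_EU : Same had (seq (zph 2 2) (seq (xph 2 2) (zph 2 2))) := by
  -- The constant is the Gauss sum 1 + 2ω², read off at the entry where both indices are 0.
  refine Same.symm ⟨omega ^ 2 - omega, ?_, fun y x => ?_⟩
  · have h : omega ^ 2 - omega = omega * (omega - 1) := by ring
    rw [h]
    exact mul_ne_zero (Complex.exp_ne_zero _) (sub_ne_zero.2 omega_ne_one)
  · rw [zph, interp_zsp_seq, interp_seq_zsp, xph, interp_xsp, interp_had]
    simp only [weight_ang, Finset.univ_unique, Fin.default_eq_zero, Finset.prod_singleton,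
      Fin.sum_univ_three, fourier_eq_matrix]
    have h3 := omega_pow_three
    have hs := omega_sum
    have hv : (2 : ZMod 3).val = 2 := rfl
    simp only [hv]
    generalize y 0 = a
    generalize x 0 = b
    have e1 : -(1 : Fin 3) = 2 := rfl
    have e2 : -(2 : Fin 3) = 1 := rfl
    fin_cases a <;> fin_cases b <;> simp [e1, e2]
    all_goals clear e1 e2 hv
    all_goals try left
    all_goals grind

theorem same_swap_natural {n m n' m'} (A : Diag n m) (B : Diag n' m') :
    Same (seq (par A B) (wires finAddFlip)) (seq (wires finAddFlip) (par B A)) := by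
  refine Same.of_eq fun y x => ?_
  rw [interp_seq_wires, interp_wires_seq, interp_par, interp_par, mul_comm]
  have h1 : ∀ i : Fin n', (finAddFlip : Fin (n + n') ≃ Fin (n' + n)).symm (Fin.castAdd n i) =
    Fin.natAdd n i := fun i => by rw [Equiv.symm_apply_eq]; simp
  have h2 : ∀ i : Fin n, (finAddFlip : Fin (n + n') ≃ Fin (n' + n)).symm (Fin.natAdd n' i) =
    Fin.castAdd n' i := fun i => by rw [Equiv.symm_apply_eq]; simp
  congr 2 <;> ext i <;> simp [h1, h2]

theorem same_empty_par {n m} (A : Diag n m) :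
    Same (seq (par (idn 0) A) (cast (Nat.zero_add m))) (seq (cast (Nat.zero_add n)) A) := by
  refine Same.of_eq fun y x => ?_
  rw [Diag.cast, Diag.cast, interp_seq_wires, interp_wires_seq, interp_par, interp_idn,
    if_pos (Subsingleton.elim _ _), one_mul]
  congr 1 <;> ext i <;> simp

theorem same_par_empty {n m} (A : Diag n m) : Same (par A (idn 0)) A := by
  refine Same.of_eq fun y x => ?_
  rw [interp_par, interp_idn, if_pos (Subsingleton.elim _ _), mul_one]
  rfl

theorem same_wires_par {n m n' m'} (e : Fin n ≃ Fin m) (f : Fin n' ≃ Fin m') :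
      Same (par (wires e) (wires f))
        (wires (finSumFinEquiv.symm.trans ((e.sumCongr f).trans finSumFinEquiv))) := by
  refine ((isGraph_wires e).par (isGraph_wires f)).same (isGraph_wires _) ?_ 1 one_ne_zero
    fun x => by simp
  funext x i
  refine Fin.addCases (fun i => ?_) (fun i => ?_) i <;> simp

/-- Provably equal diagrams have the same interpretation up to a non-zero factor. -/
theorem Equal.sound {n m : ℕ} {A B : Diag n m} (h : Equal A B) : Same A B := by
  induction h with
  | refl A => exact Same.of_eq fun _ _ => rfl
  | symm _ ih => exact ih.symm
  | trans _ _ ih ih' => exact ih.trans ih'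
  | seq_congr _ _ ih ih' => exact ih.seq_congr ih'
  | par_congr _ _ ih ih' => exact ih.par_congr ih'
  | seq_assoc A B C =>
    exact Same.of_eq fun y x => by
      show (interp C * (interp B * interp A)) y x = (interp C * interp B * interp A) y x
      rw [Matrix.mul_assoc]
  | id_seq A => exact Same.of_eq fun y x => interp_wires_seq _ _ _ _
  | seq_id A => exact Same.of_eq fun y x => interp_seq_wires _ _ _ _
  | interchange A B A' B' => exact same_interchange _ _ _ _
  | par_assoc A B C => exact same_par_assoc _ _ _
  | empty_par A => exact same_empty_par A
  | par_empty A => exact same_par_empty A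
  | wires_seq e f =>
    exact Same.of_eq fun y x => by rw [interp_wires_seq, interp_wires, interp_wires]; rfl
  | wires_par e f => exact same_wires_par e f
  | swap_natural A B => exact same_swap_natural A B
  | S1 n m k n' m' hk α β γ δ => exact same_S1 n m k n' m' hk α β γ δ
  | S2_green => exact same_S2_green
  | S2_red => exact same_S2_red
  | S3_out n m α β e => exact same_S3_out n m α β e
  | S3_in n m α β e => exact same_S3_in n m α β e
  | B1 => exact same_B1
  | B2 => exact same_B2
  | K1_12 m => exact same_K1 m isGraph_xph_one_two
  | K1_21 m => exact same_K1 m isGraph_xph_two_one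
  | K2_12 α β => exact same_K2_12 α β
  | K2_21 α β => exact same_K2_21 α β
  | H1_left => exact same_H1_left
  | H1_right => exact same_H1_right
  | EU => exact same_EU
  | H2 n m α β => exact same_H2 n m α β
  | H2' n m α β => exact same_H2' n m α β
  | P1_cup => exact same_P1_cup
  | P1_had => exact same_P1_had
  | scalar s hs =>
    -- A closed diagram has a single matrix entry, and this entry is the factor.
    refine ⟨interp s default default, fun h => hs ?_, fun y x => ?_⟩
    · ext y x
      rw [Subsingleton.elim y default, Subsingleton.elim x default, h]; rfl
    · rw [interp_idn, if_pos (Subsingleton.elim _ _), mul_one, Subsingleton.elim y default,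
        Subsingleton.elim x default]

end Diag
end QutritZX
end

/-! ### The symmetric monoidal category of diagrams modulo the rules, and gates placed on chosen
wires -/

noncomputable section

namespace QutritZX

open Diag

/-- Provable equality of diagrams as a setoid. -/
instance equalSetoid (n m : ℕ) : Setoid (Diag n m) where
  r := Equal
  iseqv := ⟨Equal.refl, Equal.symm, Equal.trans⟩

/-- Diagrams modulo provable equality. -/
def Mor (n m : ℕ) : Type := Quotient (equalSetoid n m)

namespace Mor

/-- The class of a diagram. -/
def mk {n m : ℕ} (A : Diag n m) : Mor n m := Quotient.mk _ A

theorem mk_eq_iff {n m : ℕ} {A B : Diag n m} : mk A = mk B ↔ Equal A B := Quotient.eq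

theorem mk_eq {n m : ℕ} {A B : Diag n m} (h : Equal A B) : mk A = mk B := Quotient.sound h

theorem exists_rep {n m : ℕ} (f : Mor n m) : ∃ A, mk A = f := Quotient.exists_rep f

/-- Sequential composition. -/
def comp {n m k : ℕ} (f : Mor n m) (g : Mor m k) : Mor n k :=
  Quotient.map₂ Diag.seq (fun _ _ h _ _ h' => Equal.seq_congr h h') f g

/-- Parallel composition. -/
def tens {n m n' m' : ℕ} (f : Mor n m) (g : Mor n' m') : Mor (n + n') (m + m') :=
  Quotient.map₂ Diag.par (fun _ _ h _ _ h' => Equal.par_congr h h') f g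

/-- The class of a rearrangement of wires. -/
def perm {n m : ℕ} (e : Fin n ≃ Fin m) : Mor n m := mk (wires e)

/-- Identity wires. -/
def one (n : ℕ) : Mor n n := mk (idn n)

scoped infixl:70 " ▷ " => Mor.comp
scoped notation:75 f:75 " ⊠ " g:76 => (Mor.tens f g :)

theorem perm_refl (n : ℕ) : perm (Equiv.refl (Fin n)) = one n := rfl

theorem comp_assoc {n m k l : ℕ} (f : Mor n m) (g : Mor m k) (h : Mor k l) :
    f ▷ g ▷ h = f ▷ (g ▷ h) := by
  induction f using Quotient.inductionOn
  induction g using Quotient.inductionOn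
  induction h using Quotient.inductionOn
  exact mk_eq (Equal.seq_assoc _ _ _)

@[simp] theorem one_comp {n m : ℕ} (f : Mor n m) : one n ▷ f = f := by
  induction f using Quotient.inductionOn
  exact mk_eq (Equal.id_seq _)

@[simp] theorem comp_one {n m : ℕ} (f : Mor n m) : f ▷ one m = f := by
  induction f using Quotient.inductionOn
  exact mk_eq (Equal.seq_id _)

theorem interchange {n m k n' m' k' : ℕ} (f : Mor n m) (g : Mor m k) (f' : Mor n' m')
    (g' : Mor m' k') : (f ⊠ f') ▷ (g ⊠ g') = (f ▷ g) ⊠ (f' ▷ g') := by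
  induction f using Quotient.inductionOn
  induction g using Quotient.inductionOn
  induction f' using Quotient.inductionOn
  induction g' using Quotient.inductionOn
  exact mk_eq (Equal.interchange _ _ _ _)

theorem perm_comp {n m k : ℕ} (e : Fin n ≃ Fin m) (f : Fin m ≃ Fin k) :
    perm e ▷ perm f = perm (e.trans f) := mk_eq (Equal.wires_seq _ _)

theorem perm_tens {n m n' m' : ℕ} (e : Fin n ≃ Fin m) (f : Fin n' ≃ Fin m') :
    perm e ⊠ perm f = perm (finSumFinEquiv.symm.trans ((e.sumCongr f).trans finSumFinEquiv)) :=
  mk_eq (Equal.wires_par _ _)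

theorem one_tens_one (n m : ℕ) : one n ⊠ one m = one (n + m) := by
  rw [← perm_refl, ← perm_refl, perm_tens, ← perm_refl]
  congr 1
  ext i
  simp

theorem tens_assoc {n m n' m' n'' m'' : ℕ} (f : Mor n m) (g : Mor n' m') (h : Mor n'' m'') :
    (f ⊠ g) ⊠ h ▷ perm (finCongr (Nat.add_assoc m m' m'')) =
      perm (finCongr (Nat.add_assoc n n' n'')) ▷ (f ⊠ (g ⊠ h)) := by
  induction f using Quotient.inductionOn
  induction g using Quotient.inductionOn
  induction h using Quotient.inductionOn
  exact mk_eq (Equal.par_assoc _ _ _)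

theorem one_zero_tens {n m : ℕ} (f : Mor n m) :
    (one 0 ⊠ f) ▷ perm (finCongr (Nat.zero_add m)) = perm (finCongr (Nat.zero_add n)) ▷ f := by
  induction f using Quotient.inductionOn
  exact mk_eq (Equal.empty_par _)

@[simp] theorem tens_one_zero {n m : ℕ} (f : Mor n m) : f ⊠ one 0 = f := by
  induction f using Quotient.inductionOn
  exact mk_eq (Equal.par_empty _)

theorem swap_natural {n m n' m' : ℕ} (f : Mor n m) (g : Mor n' m') :
    (f ⊠ g) ▷ perm finAddFlip = perm finAddFlip ▷ (g ⊠ f) := by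
  induction f using Quotient.inductionOn
  induction g using Quotient.inductionOn
  exact mk_eq (Equal.swap_natural _ _)

theorem tens_comp_one {n m k : ℕ} (l : ℕ) (f : Mor n m) (g : Mor m k) :
    (f ▷ g) ⊠ one l = (f ⊠ one l) ▷ (g ⊠ one l) := by
  rw [interchange, one_comp]

theorem one_tens_comp {n m k : ℕ} (l : ℕ) (f : Mor n m) (g : Mor m k) :
    one l ⊠ (f ▷ g) = (one l ⊠ f) ▷ (one l ⊠ g) := by
  rw [interchange, one_comp]

theorem tens_eq {n m n' m' : ℕ} (f : Mor n m) (g : Mor n' m') :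
    f ⊠ g = (f ⊠ one n') ▷ (one m ⊠ g) := by
  rw [interchange, one_comp, comp_one]

theorem tens_eq' {n m n' m' : ℕ} (f : Mor n m) (g : Mor n' m') :
    f ⊠ g = (one n ⊠ g) ▷ (f ⊠ one m') := by
  rw [interchange, one_comp, comp_one]

instance (n : ℕ) : Monoid (Mor n n) where
  mul := comp
  one := one n
  mul_assoc := comp_assoc
  one_mul := one_comp
  mul_one := comp_one

theorem mul_def {n : ℕ} (f g : Mor n n) : f * g = f ▷ g := rfl

theorem one_def (n : ℕ) : (1 : Mor n n) = one n := rfl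

/-- Permutations of wires compose in diagrammatic order. -/
theorem perm_comp_symm {n m : ℕ} (e : Fin n ≃ Fin m) : perm e ▷ perm e.symm = one n := by
  rw [perm_comp, Equiv.self_trans_symm, perm_refl]

theorem perm_symm_comp {n m : ℕ} (e : Fin n ≃ Fin m) : perm e.symm ▷ perm e = one m := by
  rw [perm_comp, Equiv.symm_trans_self, perm_refl]

/-! ## Gates on chosen wires -/

/-- A gate applied to the last wires after a rearrangement `e`. -/
def lift {n k a : ℕ} (e : Fin n ≃ Fin (k + a)) (A : Mor a a) : Mor n n :=
  perm e ▷ (one k ⊠ A) ▷ perm e.symm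

theorem lift_comp {n k a : ℕ} (e : Fin n ≃ Fin (k + a)) (A B : Mor a a) :
    lift e (A ▷ B) = lift e A ▷ lift e B := by
  simp only [lift, one_tens_comp, comp_assoc]
  rw [← comp_assoc (perm e.symm), perm_symm_comp, one_comp]

theorem lift_one {n k a : ℕ} (e : Fin n ≃ Fin (k + a)) : lift e (one a) = one n := by
  simp only [lift, one_tens_one, comp_one, perm_comp_symm]

/-- Two ways of bringing the same wires to the end differ by a permutation of the idle wires alone;
this is what makes the placement of a gate well defined. -/
theorem perm_eq_tens {k a : ℕ} (e : Fin (k + a) ≃ Fin (k + a))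
    (h : ∀ j : Fin a, e (Fin.natAdd k j) = Fin.natAdd k j) :
    ∃ σ : Fin k ≃ Fin k, perm e = perm σ ⊠ one a := by
  have h' : ∀ j : Fin a, e.symm (Fin.natAdd k j) = Fin.natAdd k j := fun j => by
    rw [Equiv.symm_apply_eq, h]
  have aux : ∀ f : Fin (k + a) ≃ Fin (k + a), (∀ j : Fin a, f.symm (Fin.natAdd k j) = Fin.natAdd k j) →
      ∀ i : Fin k, (f (Fin.castAdd a i) : ℕ) < k := by
    intro f hf i
    by_contra hlt
    have := hf (⟨f (Fin.castAdd a i) - k, by omega⟩)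
    rw [Equiv.symm_apply_eq] at this
    have h2 : (Fin.natAdd k ⟨f (Fin.castAdd a i) - k, by omega⟩ : Fin (k + a)) = f (Fin.castAdd a i) := by
      ext; simp; omega
    rw [h2] at this
    have h3 := f.injective this
    have := congrArg Fin.val h3
    simp at this
    omega
  refine ⟨⟨fun i => ⟨e (Fin.castAdd a i), aux e h' i⟩, fun i => ⟨e.symm (Fin.castAdd a i), aux e.symm h i⟩,
    fun i => ?_, fun i => ?_⟩, ?_⟩
  · ext
    have : Fin.castAdd a (⟨e (Fin.castAdd a i), aux e h' i⟩ : Fin k) = e (Fin.castAdd a i) := by ext; simp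
    simp [this]
  · ext
    have : Fin.castAdd a (⟨e.symm (Fin.castAdd a i), aux e.symm h i⟩ : Fin k) = e.symm (Fin.castAdd a i) := by
      ext; simp
    simp [this]
  · rw [← perm_refl, perm_tens]
    congr 1
    ext i
    refine Fin.addCases (fun i => ?_) (fun j => ?_) i
    · simp
    · simp [h]

/-- A lifted gate depends only on the wires it acts on. -/
theorem lift_congr {n k a : ℕ} (e e' : Fin n ≃ Fin (k + a)) (A : Mor a a)
    (h : ∀ j : Fin a, e.symm (Fin.natAdd k j) = e'.symm (Fin.natAdd k j)) :
    lift e A = lift e' A := by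
  obtain ⟨σ, hσ⟩ := perm_eq_tens (e.symm.trans e') (fun j => by
    rw [Equiv.trans_apply, h, Equiv.apply_symm_apply])
  have h1 : perm e' = perm e ▷ (perm σ ⊠ one a) := by
    rw [← hσ, perm_comp, ← Equiv.trans_assoc, Equiv.self_trans_symm, Equiv.refl_trans]
  have h2 : perm e.symm = (perm σ ⊠ one a) ▷ perm e'.symm := by
    rw [← hσ, perm_comp, Equiv.trans_assoc, Equiv.self_trans_symm, Equiv.trans_refl]
  rw [lift, lift, h1, h2]
  simp only [← comp_assoc]
  congr 1
  simp only [comp_assoc, interchange, one_comp, comp_one]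

/-- The wires outside the range of `p` are listed first in arbitrary order, followed by those of `p`
in their given order. -/
theorem exists_frame {n a : ℕ} (p : Fin a → Fin n) (hp : Function.Injective p) :
    ∃ (k : ℕ) (e : Fin n ≃ Fin (k + a)), ∀ j, e (p j) = Fin.natAdd k j := by
  classical
  have hle : a ≤ n := by simpa using Fintype.card_le_of_injective p hp
  have hc : Fintype.card ((Set.range p)ᶜ : Set (Fin n)) = n - a := by
    rw [Fintype.card_compl_set, Fintype.card_fin, Set.card_range_of_injective hp, Fintype.card_fin]
  let e1 : Fin n ≃ (Set.range p) ⊕ ((Set.range p)ᶜ : Set (Fin n)) := (Equiv.Set.sumCompl _).symm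
  let e2 := (Equiv.ofInjective p hp).symm.sumCongr (Fintype.equivFinOfCardEq hc)
  refine ⟨n - a, (e1.trans (e2.trans (Equiv.sumComm _ _))).trans finSumFinEquiv, fun j => ?_⟩
  have : e1 (p j) = Sum.inl ⟨p j, j, rfl⟩ :=
    Equiv.Set.sumCompl_symm_apply_of_mem (Set.mem_range_self j)
  simp only [Equiv.trans_apply, this, e2, Equiv.sumCongr_apply, Sum.map_inl, Equiv.sumComm_apply,
    Sum.swap_inl, finSumFinEquiv_apply_right]
  congr 1
  rw [Equiv.symm_apply_eq]
  rfl

/-- Counting wires forces the number of idle ones, and `lift_congr` removes the dependence on their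
order, so one gate serves all frames at once. -/
theorem exists_gate {n a : ℕ} (A : Mor a a) (p : Fin a → Fin n) (hp : Function.Injective p) :
    ∃ B : Mor n n, ∀ (k : ℕ) (e : Fin n ≃ Fin (k + a)), (∀ j, e (p j) = Fin.natAdd k j) →
      B = lift e A := by
  obtain ⟨k, e, he⟩ := exists_frame p hp
  refine ⟨lift e A, fun k' e' he' => ?_⟩
  obtain rfl : k' = k := by
    have h1 := Fintype.card_congr e
    have h2 := Fintype.card_congr e'
    simp only [Fintype.card_fin] at h1 h2
    omega
  refine lift_congr _ _ _ fun j => ?_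
  rw [← he j, Equiv.symm_apply_apply, Eq.comm, Equiv.symm_apply_eq, he' j, he j]

open Classical in
/-- The gate `A` applied to the wires `p 0, p 1, …` (the identity if these are not distinct). -/
def gate {n a : ℕ} (A : Mor a a) (p : Fin a → Fin n) : Mor n n :=
  if hp : Function.Injective p then (exists_gate A p hp).choose else one n

theorem gate_eq_lift {n k a : ℕ} (A : Mor a a) (p : Fin a → Fin n) (e : Fin n ≃ Fin (k + a))
    (h : ∀ j, e (p j) = Fin.natAdd k j) : gate A p = lift e A := by
  have hp : Function.Injective p := fun i j hij => by
    have := h i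
    rw [hij, h j] at this
    simpa using this.symm
  rw [gate, dif_pos hp]
  exact (exists_gate A p hp).choose_spec k e h

/-! ### Rules for gates -/

theorem gate_comp {n a : ℕ} (A B : Mor a a) (p : Fin a → Fin n) :
    gate (A ▷ B) p = gate A p ▷ gate B p := by
  by_cases hp : Function.Injective p
  · obtain ⟨k, e, he⟩ := exists_frame p hp
    simp only [gate_eq_lift _ p e he, lift_comp]
  · simp only [gate, dif_neg hp, one_comp]

theorem gate_one {n a : ℕ} (p : Fin a → Fin n) : gate (one a) p = one n := by
  by_cases hp : Function.Injective p
  · obtain ⟨k, e, he⟩ := exists_frame p hp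
    simp only [gate_eq_lift _ p e he, lift_one]
  · simp only [gate, dif_neg hp]

/-- Placing gates on the wires `p` as a homomorphism. -/
def gateHom {n a : ℕ} (p : Fin a → Fin n) : Mor a a →* Mor n n where
  toFun A := gate A p
  map_one' := gate_one p
  map_mul' A B := gate_comp A B p

theorem gateHom_apply {n a : ℕ} (p : Fin a → Fin n) (A : Mor a a) : gateHom p A = gate A p := rfl

theorem gate_perm {n m a : ℕ} (A : Mor a a) (p : Fin a → Fin n) (σ : Fin n ≃ Fin m) :
    gate A p ▷ perm σ = perm σ ▷ gate A (σ ∘ p) := by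
  by_cases hp : Function.Injective p
  · obtain ⟨k, e, he⟩ := exists_frame p hp
    rw [gate_eq_lift _ p e he, gate_eq_lift _ (σ ∘ p) (σ.symm.trans e) (fun j => by simp [he])]
    simp only [lift, ← comp_assoc, perm_comp]
    simp only [comp_assoc, perm_comp]
    congr 1
    · congr 1; ext; simp
  · have hp' : ¬ Function.Injective (σ ∘ p) := fun h => hp h.of_comp
    simp only [gate, dif_neg hp, dif_neg hp', one_comp, comp_one]

theorem lift_lift {n k a k' b : ℕ} (e : Fin n ≃ Fin (k + b)) (f : Fin b ≃ Fin (k' + a))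
    (A : Mor a a) : lift e (lift f A) =
      lift ((e.trans (finSumFinEquiv.symm.trans (((Equiv.refl (Fin k)).sumCongr f).trans
        finSumFinEquiv))).trans (finCongr (Nat.add_assoc k k' a).symm)) A := by
  have h := tens_assoc (one k) (one k') A
  rw [one_tens_one] at h
  have h2 : one k ⊠ (one k' ⊠ A) = perm (finCongr (Nat.add_assoc k k' a).symm) ▷
      (one (k + k') ⊠ A) ▷ perm (finCongr (Nat.add_assoc k k' a)) := by
    rw [comp_assoc, h, ← comp_assoc, perm_comp]
    have : (finCongr (Nat.add_assoc k k' a).symm).trans (finCongr (Nat.add_assoc k k' a)) =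
      Equiv.refl _ := by ext; simp
    rw [this, perm_refl, one_comp]
  simp only [lift, one_tens_comp]
  rw [h2, ← perm_refl k, perm_tens, perm_tens]
  simp only [← comp_assoc, perm_comp]
  simp only [comp_assoc, perm_comp]
  congr 1

/-- Injectivity of `p` matters: otherwise the outer gate is the identity by default, although `p ∘
q` may still be injective. -/
theorem gate_gate {n a b : ℕ} (A : Mor a a) (q : Fin a → Fin b) (p : Fin b → Fin n)
    (hp : Function.Injective p) : gate (gate A q) p = gate A (p ∘ q) := by
  by_cases hq : Function.Injective q
  · obtain ⟨k, e, he⟩ := exists_frame p hp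
    obtain ⟨k', f, hf⟩ := exists_frame q hq
    rw [gate_eq_lift _ p e he, gate_eq_lift _ q f hf, lift_lift]
    rw [gate_eq_lift _ (p ∘ q)]
    intro j
    ext
    simp [he, hf]
    omega
  · have hq' : ¬ Function.Injective (p ∘ q) := fun h => hq h.of_comp
    rw [gate.eq_def A q, dif_neg hq, gate_one, gate, dif_neg hq']

theorem gate_natAdd {a : ℕ} (k : ℕ) (A : Mor a a) : gate A (Fin.natAdd k) = one k ⊠ A := by
  rw [gate_eq_lift A (Fin.natAdd k) (Equiv.refl (Fin (k + a))) (fun _ => rfl), lift, Equiv.refl_symm, perm_refl,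
    one_comp, comp_one]

theorem gate_castAdd {a : ℕ} (k : ℕ) (A : Mor a a) : gate A (Fin.castAdd k) = A ⊠ one k := by
  have h : gate A (Fin.castAdd k) = lift (finAddFlip : Fin (a + k) ≃ Fin (k + a)) A :=
    gate_eq_lift _ _ _ (fun j => by simp)
  rw [h, lift, ← swap_natural, comp_assoc, perm_comp_symm, comp_one]

theorem gate_id {a : ℕ} (A : Mor a a) : gate A (id : Fin a → Fin a) = A := by
  have := gate_castAdd 0 A
  rw [tens_one_zero] at this
  exact this

/-- Gates on disjoint sets of wires commute. -/
theorem gate_commute {n a b : ℕ} (A : Mor a a) (B : Mor b b) (p : Fin a → Fin n)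
    (q : Fin b → Fin n) (h : ∀ i j, p i ≠ q j) : Commute (gate A p) (gate B q) := by
  by_cases hp : Function.Injective p
  · by_cases hq : Function.Injective q
    · have hr : Function.Injective (Fin.append p q) := Fin.append_injective_iff.2 ⟨hp, hq, h⟩
      have h1 : gate A p = gate (A ⊠ one b) (Fin.append p q) := by
        rw [← gate_castAdd, gate_gate _ _ _ hr]
        congr 1; ext; simp
      have h2 : gate B q = gate (one a ⊠ B) (Fin.append p q) := by
        rw [← gate_natAdd, gate_gate _ _ _ hr]
        congr 1; ext; simp
      rw [commute_iff_eq, mul_def, mul_def, h1, h2, ← gate_comp, ← gate_comp, interchange,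
        interchange]
      simp
    · rw [gate, gate, dif_neg hq]; exact Commute.one_right _
  · rw [gate, dif_neg hp]; exact Commute.one_left _

end Mor
end QutritZX

end

/-! ### The generators in the quotient -/

noncomputable section

namespace QutritZX

open Diag

namespace Mor

/-! ## Generators -/

/-- Green spiders. -/
def Z (n m : ℕ) (α β : Real.Angle) : Mor n m := mk (zsp n m α β)

/-- Red spiders. -/
def R (n m : ℕ) (α β : Real.Angle) : Mor n m := mk (xsp n m α β)

/-- The Hadamard node. -/
def H : Mor 1 1 := mk had

/-- The inverse Hadamard node. -/
def H' : Mor 1 1 := mk hadDag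

/-- The swap. -/
def sw : Mor 2 2 := mk swap

/-- The associativity and unit laws hold up to a relabelling of wires. Where the two wire counts
agree by computation, the heterogeneous equality becomes an honest equation that can be used for
rewriting. -/
theorem heq_of_perm_finCongr {n m n' m' : ℕ} (f : Mor n m) (g : Mor n' m') (hn : n = n')
    (hm : m = m') (h : f ▷ perm (finCongr hm) = perm (finCongr hn) ▷ g) : HEq f g := by
  subst hn hm
  have h1 : perm (finCongr (rfl : n = n)) = one n := rfl
  have h2 : perm (finCongr (rfl : m = m)) = one m := rfl
  rw [h1, h2, one_comp, comp_one] at h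
  rw [h]

theorem tens_assoc_heq {n m n' m' n'' m'' : ℕ} (f : Mor n m) (g : Mor n' m') (h : Mor n'' m'') :
    HEq ((f ⊠ g) ⊠ h) (f ⊠ (g ⊠ h)) :=
  heq_of_perm_finCongr _ _ _ _ (tens_assoc f g h)

theorem one_zero_tens_heq {n m : ℕ} (f : Mor n m) : HEq (one 0 ⊠ f) f :=
  heq_of_perm_finCongr _ _ _ _ (one_zero_tens f)

theorem Z_perm (n : ℕ) {m m' : ℕ} (α β : Real.Angle) (e : Fin m ≃ Fin m') :
    Z n m α β ▷ perm e = Z n m' α β := by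
  obtain rfl : m = m' := by simpa using Fintype.card_congr e
  exact mk_eq (Equal.S3_out _ _ _ _ _)

theorem perm_Z {n n' : ℕ} (m : ℕ) (α β : Real.Angle) (e : Fin n ≃ Fin n') :
    perm e ▷ Z n' m α β = Z n m α β := by
  obtain rfl : n = n' := by simpa using Fintype.card_congr e
  exact mk_eq (Equal.S3_in _ _ _ _ _)

theorem Z_fuse (n m k n' m' : ℕ) (hk : 0 < k) (α β γ δ : Real.Angle) :
    (Z n (m + k) α β ⊠ one n') ▷ (perm (finCongr (Nat.add_assoc m k n')) ▷
      (one m ⊠ Z (k + n') m' γ δ)) = Z (n + n') (m + m') (α + γ) (β + δ) :=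
  mk_eq (Equal.S1 n m k n' m' hk α β γ δ)

theorem tens_one_eq_flip {n m : ℕ} (k : ℕ) (f : Mor n m) :
    f ⊠ one k = perm finAddFlip ▷ (one k ⊠ f) ▷ perm finAddFlip := by
  rw [← swap_natural, comp_assoc, perm_comp]
  have : (finAddFlip : Fin (m + k) ≃ Fin (k + m)).trans finAddFlip = Equiv.refl _ := by
    ext i; refine Fin.addCases (fun i => ?_) (fun i => ?_) i <;> simp
  rw [this, perm_refl, comp_one]

theorem one_tens_eq_flip {n m : ℕ} (k : ℕ) (f : Mor n m) :
    one k ⊠ f = perm finAddFlip ▷ (f ⊠ one k) ▷ perm finAddFlip := by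
  rw [← swap_natural, comp_assoc, perm_comp]
  have : (finAddFlip : Fin (k + m) ≃ Fin (m + k)).trans finAddFlip = Equiv.refl _ := by
    ext i; refine Fin.addCases (fun i => ?_) (fun i => ?_) i <;> simp
  rw [this, perm_refl, comp_one]

theorem flip_tens_flip (k m n' : ℕ) :
    (perm (finAddFlip : Fin (k + m) ≃ Fin (m + k)) ⊠ one n') ▷
      (perm (finCongr (Nat.add_assoc m k n')) ▷ (one m ⊠ perm finAddFlip)) =
    perm finAddFlip ▷ (perm (finCongr (Nat.add_assoc n' k m).symm) ▷ perm finAddFlip) := by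
  rw [← perm_refl, ← perm_refl, perm_tens, perm_tens, perm_comp, perm_comp, perm_comp, perm_comp]
  congr 1
  ext i
  refine Fin.addCases (fun i => ?_) (fun i => ?_) i
  · refine Fin.addCases (fun i => ?_) (fun i => ?_) i
    · have h1 : Fin.cast (Nat.add_assoc m k n') (Fin.castAdd n' (Fin.natAdd m i)) =
        Fin.natAdd m (Fin.castAdd n' i) := by ext; simp
      have h2 : Fin.cast (Nat.add_assoc n' k m).symm (Fin.natAdd n' (Fin.castAdd m i)) =
        Fin.castAdd m (Fin.natAdd n' i) := by ext; simp
      simp [h1, h2]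
    · have h1 : Fin.cast (Nat.add_assoc m k n') (Fin.castAdd n' (Fin.castAdd k i)) =
        Fin.castAdd (k + n') i := by ext; simp
      have h2 : Fin.cast (Nat.add_assoc n' k m).symm (Fin.natAdd n' (Fin.natAdd k i)) =
        Fin.natAdd (n' + k) i := by ext; simp; omega
      simp [h1, h2]
  · have h1 : Fin.cast (Nat.add_assoc m k n') (Fin.natAdd (m + k) i) =
        Fin.natAdd m (Fin.natAdd k i) := by ext; simp; omega
    have h2 : Fin.cast (Nat.add_assoc n' k m).symm (Fin.castAdd (k + m) i) =
        Fin.castAdd m (Fin.castAdd k i) := by ext; simp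
    simp [h1, h2]

/-- The mirror image of the fusion rule. -/
theorem Z_fuse' (n m k n' m' : ℕ) (hk : 0 < k) (α β γ δ : Real.Angle) :
    (one n' ⊠ Z n (k + m) γ δ) ▷ (perm (finCongr (Nat.add_assoc n' k m).symm) ▷
      (Z (n' + k) m' α β ⊠ one m)) = Z (n' + n) (m' + m) (α + γ) (β + δ) := by
  have h := Z_fuse n m k n' m' hk γ δ α β
  -- Legs of green spiders may be permuted freely, so flips can be inserted on both sides of the
  -- fused bundle, which mirrors the picture.
  rw [← Z_perm n γ δ (finAddFlip : Fin (k + m) ≃ Fin (m + k)),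
    ← perm_Z m' α β (finAddFlip : Fin (k + n') ≃ Fin (n' + k)), tens_comp_one, one_tens_comp] at h
  rw [one_tens_eq_flip n' (Z n (k + m) γ δ), tens_one_eq_flip m (Z (n' + k) m' α β)]
  have h' := congrArg (fun f => perm finAddFlip ▷ (f ▷ perm finAddFlip)) h
  simp only [Z_perm, perm_Z] at h'
  rw [add_comm α, add_comm β, ← h']
  have h3 : ∀ {a b} (f : Mor a (k + m + n')) (g : Mor (m + (n' + k)) b),
      f ▷ (perm finAddFlip ▷ (perm (finCongr (Nat.add_assoc n' k m).symm) ▷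
        (perm finAddFlip ▷ g))) =
      f ▷ ((perm finAddFlip ⊠ one n') ▷ (perm (finCongr (Nat.add_assoc m k n')) ▷
        ((one m ⊠ perm finAddFlip) ▷ g))) := by
    intro a b f g
    have := congrArg (fun t => f ▷ (t ▷ g)) (flip_tens_flip k m n')
    simp only [comp_assoc] at this
    exact this.symm
  simp only [comp_assoc, h3]

theorem Z_one : Z 1 1 0 0 = one 1 := mk_eq Equal.S2_green

theorem R_one : R 1 1 0 0 = one 1 := mk_eq Equal.S2_red

theorem H_H' : H ▷ H' = one 1 := mk_eq Equal.H1_left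

theorem H'_H : H' ▷ H = one 1 := mk_eq Equal.H1_right

theorem H'_H' : H' ▷ H' = H ▷ H := (mk_eq Equal.P1_had).symm

theorem copies_one (A : Diag 1 1) : (mk (copies 1 A) : Mor 1 1) = mk A :=
  eq_of_heq (one_zero_tens_heq (mk A))

theorem copies_two (A : Diag 1 1) : (mk (copies 2 A) : Mor 2 2) = mk A ⊠ mk A := by
  have h := copies_one A
  exact congrArg (fun f : Mor 1 1 => (f ⊠ mk A : Mor 2 2)) h

theorem R_eq (n m : ℕ) (α β : Real.Angle) :
    mk (copies n hadDag) ▷ (Z n m α β ▷ mk (copies m had)) = R n m α β := mk_eq (Equal.H2 n m α β)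

theorem R_eq' (n m : ℕ) (α β : Real.Angle) :
    mk (copies n had) ▷ (Z n m α β ▷ mk (copies m hadDag)) = R n m β α := mk_eq (Equal.H2' n m α β)

theorem R01 (α β : Real.Angle) : R 0 1 α β = Z 0 1 α β ▷ H := by
  rw [← R_eq, copies_one]; exact one_comp _

theorem R01' (α β : Real.Angle) : R 0 1 α β = Z 0 1 β α ▷ H' := by
  rw [← R_eq', copies_one]; exact one_comp _

theorem R10 (α β : Real.Angle) : R 1 0 α β = H' ▷ Z 1 0 α β := by
  rw [← R_eq, copies_one]; exact congrArg _ (comp_one _)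

theorem R10' (α β : Real.Angle) : R 1 0 α β = H ▷ Z 1 0 β α := by
  rw [← R_eq', copies_one]; exact congrArg _ (comp_one _)

theorem R11 (α β : Real.Angle) : R 1 1 α β = H' ▷ (Z 1 1 α β ▷ H) := by
  rw [← R_eq, copies_one, copies_one]; rfl

theorem R11' (α β : Real.Angle) : R 1 1 α β = H ▷ (Z 1 1 β α ▷ H') := by
  rw [← R_eq', copies_one, copies_one]; rfl

theorem R21 : R 2 1 0 0 = (H' ⊠ H') ▷ (Z 2 1 0 0 ▷ H) := by
  rw [← R_eq, copies_one, copies_two]; rfl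

theorem R21' : R 2 1 0 0 = (H ⊠ H) ▷ (Z 2 1 0 0 ▷ H') := by
  rw [← R_eq', copies_one, copies_two]; rfl

theorem R02 : R 0 2 0 0 = Z 0 2 0 0 ▷ (H ⊠ H) := by
  rw [← R_eq, copies_two]; exact one_comp _

/-- A non-zero scalar may be dropped. -/
theorem scalar_eq_one (s : Diag 0 0) (hs : s.interp ≠ 0) : mk s = one 0 := mk_eq (Equal.scalar s hs)

end Mor
end QutritZX

end

/-! ### Derived rules: fusion, snakes, sliding along cups, copying, Euler and Gauss identities -/

noncomputable section
namespace QutritZX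
open Diag
namespace Mor

section Spiders

local notation "𝐈" => one 1
local notation "𝐂" => Z 1 2 0 0
local notation "𝐌" => Z 2 1 0 0

/-! ## Fusion of small spiders -/

theorem Z_comp_one_tens {n k m' : ℕ} (m : ℕ) (hk : 0 < k) (α β γ δ : Real.Angle) :
    Z n (m + k) α β ▷ (one m ⊠ Z k m' γ δ) = Z n (m + m') (α + γ) (β + δ) := by
  have h := Z_fuse n m k 0 m' hk α β γ δ
  rw [tens_one_zero] at h
  exact (congrArg _ (one_comp _).symm).trans h

theorem Z_tens_one_comp {n k m' : ℕ} (n' : ℕ) (hk : 0 < k) (α β γ δ : Real.Angle) :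
    (one n' ⊠ Z n k γ δ) ▷ Z (n' + k) m' α β = Z (n' + n) m' (α + γ) (β + δ) := by
  have h := Z_fuse' n 0 k n' m' hk α β γ δ
  rw [tens_one_zero] at h
  exact (congrArg _ (one_comp _).symm).trans h

theorem Z_comp {n k m : ℕ} (hk : 0 < k) (α β γ δ : Real.Angle) :
    Z n k α β ▷ Z k m γ δ = Z n m (α + γ) (β + δ) := by
  have h := congrArg (fun f => f ▷ perm (finCongr (Nat.zero_add m)))
    (Z_comp_one_tens (n := n) (m' := m) 0 hk α β γ δ)
  simp only [comp_assoc, one_zero_tens, Z_perm] at h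
  rw [← comp_assoc, Z_perm] at h
  exact h

theorem Z_comp_tens_one {n k m : ℕ} (m' : ℕ) (hk : 0 < k) (α β γ δ : Real.Angle) :
    Z n (k + m') α β ▷ (Z k m γ δ ⊠ one m') = Z n (m + m') (α + γ) (β + δ) := by
  rw [tens_one_eq_flip, ← comp_assoc, ← comp_assoc, Z_perm, Z_comp_one_tens _ hk, Z_perm]

theorem Z_one_tens_comp {n k m : ℕ} (n' : ℕ) (hk : 0 < k) (α β γ δ : Real.Angle) :
    (Z n k γ δ ⊠ one n') ▷ Z (k + n') m α β = Z (n + n') m (α + γ) (β + δ) := by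
  rw [tens_one_eq_flip, comp_assoc, comp_assoc, perm_Z, Z_tens_one_comp _ hk, perm_Z]

theorem fuse_CL : 𝐂 ▷ (𝐂 ⊠ 𝐈) = Z 1 3 0 0 := by
  have := Z_comp_tens_one (n := 1) (k := 1) (m := 2) 1 one_pos 0 0 0 0
  simpa only [add_zero] using this

theorem fuse_CR : 𝐂 ▷ (𝐈 ⊠ 𝐂) = Z 1 3 0 0 := by
  have := Z_comp_one_tens (n := 1) (k := 1) (m' := 2) 1 one_pos 0 0 0 0
  simpa only [add_zero] using this

theorem fuse_ML : (𝐌 ⊠ 𝐈) ▷ 𝐌 = Z 3 1 0 0 := by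
  have := Z_one_tens_comp (n := 2) (k := 1) (m := 1) 1 one_pos 0 0 0 0
  simpa only [add_zero] using this

theorem fuse_MR : (𝐈 ⊠ 𝐌) ▷ 𝐌 = Z 3 1 0 0 := by
  have := Z_tens_one_comp (n := 2) (k := 1) (m' := 1) 1 one_pos 0 0 0 0
  simpa only [add_zero] using this

theorem frob' : (𝐈 ⊠ 𝐂) ▷ (𝐌 ⊠ 𝐈) = Z 2 2 0 0 := by
  have h := Z_fuse' 1 1 1 1 1 one_pos 0 0 0 0
  simp only [add_zero] at h
  exact (congrArg _ (one_comp _).symm).trans h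

theorem snake : (Z 0 2 0 0 ⊠ 𝐈) ▷ (𝐈 ⊠ Z 2 0 0 0) = 𝐈 := by
  have h := Z_fuse 0 1 1 1 0 one_pos 0 0 0 0
  simp only [add_zero] at h
  exact ((congrArg _ (one_comp _).symm).trans h).trans Z_one

theorem snake' : (𝐈 ⊠ Z 0 2 0 0) ▷ (Z 2 0 0 0 ⊠ 𝐈) = 𝐈 := by
  have h := Z_fuse' 0 1 1 1 0 one_pos 0 0 0 0
  simp only [add_zero] at h
  exact ((congrArg _ (one_comp _).symm).trans h).trans Z_one

theorem M_eq_cap : (𝐂 ⊠ 𝐈) ▷ (𝐈 ⊠ Z 2 0 0 0) = 𝐌 := by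
  have h := Z_fuse 1 1 1 1 0 one_pos 0 0 0 0
  simp only [add_zero] at h
  exact (congrArg _ (one_comp _).symm).trans h

theorem M_eq_cap' : (𝐈 ⊠ 𝐂) ▷ (Z 2 0 0 0 ⊠ 𝐈) = 𝐌 := by
  have h := Z_fuse' 1 1 1 1 0 one_pos 0 0 0 0
  simp only [add_zero] at h
  exact (congrArg _ (one_comp _).symm).trans h

theorem C_phase_right (α β : Real.Angle) : 𝐂 ▷ (𝐈 ⊠ Z 1 1 α β) = Z 1 1 α β ▷ 𝐂 := by
  have := Z_comp_one_tens (n := 1) (k := 1) (m' := 1) 1 one_pos 0 0 α β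
  rw [Z_comp one_pos, add_comm α, add_comm β]
  exact this

theorem C_phase_left (α β : Real.Angle) : 𝐂 ▷ (Z 1 1 α β ⊠ 𝐈) = Z 1 1 α β ▷ 𝐂 := by
  have := Z_comp_tens_one (n := 1) (k := 1) (m := 1) 1 one_pos 0 0 α β
  rw [Z_comp one_pos, add_comm α, add_comm β]
  exact this

theorem phase_left_M (α β : Real.Angle) : (Z 1 1 α β ⊠ 𝐈) ▷ 𝐌 = 𝐌 ▷ Z 1 1 α β := by
  have := Z_one_tens_comp (n := 1) (k := 1) (m := 1) 1 one_pos 0 0 α β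
  rw [Z_comp one_pos]
  exact this

theorem phase_right_M (α β : Real.Angle) : (𝐈 ⊠ Z 1 1 α β) ▷ 𝐌 = 𝐌 ▷ Z 1 1 α β := by
  have := Z_tens_one_comp (n := 1) (k := 1) (m' := 1) 1 one_pos 0 0 α β
  rw [Z_comp one_pos]
  exact this

theorem C_effect_right (α β : Real.Angle) : 𝐂 ▷ (𝐈 ⊠ Z 1 0 α β) = Z 1 1 α β := by
  have := Z_comp_one_tens (n := 1) (k := 1) (m' := 0) 1 one_pos 0 0 α β
  simpa only [zero_add] using this

theorem C_effect_left (α β : Real.Angle) : 𝐂 ▷ (Z 1 0 α β ⊠ 𝐈) = Z 1 1 α β := by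
  have := Z_comp_tens_one (n := 1) (k := 1) (m := 0) 1 one_pos 0 0 α β
  simpa only [zero_add] using this

theorem state_right_M (α β : Real.Angle) : (𝐈 ⊠ Z 0 1 α β) ▷ 𝐌 = Z 1 1 α β := by
  have := Z_tens_one_comp (n := 0) (k := 1) (m' := 1) 1 one_pos 0 0 α β
  simpa only [zero_add] using this

/-! ## Hadamard nodes -/

theorem H_H_H : H ▷ (H ▷ H) = H' := by
  rw [← H'_H', ← comp_assoc, H_H', one_comp]

theorem H'_eq : H' = H ▷ H ▷ H := by rw [comp_assoc, H_H_H]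

theorem H_four : H ▷ H ▷ H ▷ H = 𝐈 := by rw [← H'_eq, H'_H]

/-- The red cup is the green cup with a dualiser. -/
theorem R02_eq_cup : R 0 2 0 0 = Z 0 2 0 0 ▷ ((H ▷ H) ⊠ 𝐈) := by
  have h : (R 0 2 0 0 ⊠ 𝐈) ▷ (𝐈 ⊠ Z 2 0 0 0) = H ▷ H := mk_eq Equal.P1_cup
  -- A snake is inserted on the second leg, so that the red cup followed by a green cap of the
  -- dualiser rule appears.
  have h1 : R 0 2 0 0 = R 0 2 0 0 ▷ (𝐈 ⊠ ((𝐈 ⊠ Z 0 2 0 0) ▷ (Z 2 0 0 0 ⊠ 𝐈))) := by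
    rw [snake', one_tens_one]; exact (comp_one _).symm
  have h2 : (𝐈 ⊠ (𝐈 ⊠ Z 0 2 0 0)) = (one 2 ⊠ Z 0 2 0 0) := by
    rw [← eq_of_heq (tens_assoc_heq 𝐈 𝐈 (Z 0 2 0 0)), one_tens_one]
  have h3 : (𝐈 ⊠ (Z 2 0 0 0 ⊠ 𝐈)) = ((𝐈 ⊠ Z 2 0 0 0) ⊠ 𝐈) :=
    (eq_of_heq (tens_assoc_heq 𝐈 (Z 2 0 0 0) 𝐈)).symm
  have h4 : R 0 2 0 0 ▷ (one 2 ⊠ Z 0 2 0 0) = Z 0 2 0 0 ▷ ((R 0 2 0 0 ⊠ 𝐈) ⊠ 𝐈) := by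
    have e1 := tens_eq (R 0 2 0 0) (Z 0 2 0 0)
    have e2 := tens_eq' (R 0 2 0 0) (Z 0 2 0 0)
    rw [tens_one_zero] at e1
    rw [e1] at e2
    rw [eq_of_heq (one_zero_tens_heq (Z 0 2 0 0))] at e2
    rw [eq_of_heq (tens_assoc_heq (R 0 2 0 0) 𝐈 𝐈), one_tens_one]
    exact e2
  rw [h1, one_tens_comp, h2, h3, ← comp_assoc, h4, comp_assoc, ← tens_comp_one, h]

/-- The two colour changes describe the same red node with its phases exchanged. Comparing them
shows that HH acts like x ↦ -x. -/
theorem phase_N (α β : Real.Angle) : H ▷ H ▷ Z 1 1 α β = Z 1 1 β α ▷ (H ▷ H) := by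
  have h := (R11 β α).symm.trans (R11' β α)
  have h2 := congrArg (fun f => H ▷ (f ▷ H)) h
  simp only [comp_assoc, H'_H, comp_one] at h2
  rw [← comp_assoc H H', H_H', one_comp] at h2
  rw [comp_assoc, ← h2]

theorem state_N (α β : Real.Angle) : Z 0 1 α β ▷ (H ▷ H) = Z 0 1 β α := by
  have h := (R01 α β).symm.trans (R01' α β)
  rw [← comp_assoc, h, comp_assoc, H'_H, comp_one]

theorem state_H' (α β : Real.Angle) : Z 0 1 α β ▷ H' = Z 0 1 β α ▷ H := by
  rw [← R01, ← R01']

theorem H'_effect (α β : Real.Angle) : H' ▷ Z 1 0 α β = H ▷ Z 1 0 β α := by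
  rw [← R10, ← R10']

theorem cup_NN : Z 0 2 0 0 ▷ ((H ▷ H) ⊠ (H ▷ H)) = Z 0 2 0 0 := by
  have h : Z 0 2 0 0 ▷ (H ⊠ H) = Z 0 2 0 0 ▷ (H' ⊠ H') := by
    rw [← R02]
    have := R_eq' 0 2 0 0
    rw [copies_two] at this
    rw [← this]
    exact one_comp _
  have h2 := congrArg (fun f => f ▷ (H ⊠ H)) h
  simp only [comp_assoc, interchange, H'_H, one_tens_one] at h2
  rw [h2]
  exact comp_one _

/-- A Hadamard node slides along the green cup. -/
theorem cup_H : Z 0 2 0 0 ▷ (H ⊠ 𝐈) = Z 0 2 0 0 ▷ (𝐈 ⊠ H) := by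
  -- The red cup is a green cup with H on both legs and also one with HH on the first leg;
  -- cancelling an H on the second leg leaves the sliding law up to `cup_NN`.
  have h := R02.symm.trans R02_eq_cup
  have h2 := congrArg (fun f => f ▷ (𝐈 ⊠ H')) h
  simp only [comp_assoc, interchange, H_H', comp_one, one_comp] at h2
  rw [h2, ← H_H_H]
  have h3 := congrArg (fun f => f ▷ (𝐈 ⊠ H)) cup_NN
  simp only [comp_assoc, interchange, comp_one] at h3
  exact h3

/-- An effect on two wires is recovered from the gate obtained by bending one of its legs. This
carries identities for cups over to caps. -/
theorem bend_effect (f : Mor 2 0) :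
    (((𝐈 ⊠ Z 0 2 0 0) ▷ (f ⊠ 𝐈)) ⊠ 𝐈) ▷ Z 2 0 0 0 = f := by
  have h1 : ((f ⊠ 𝐈) ⊠ 𝐈) ▷ Z 2 0 0 0 = (one 2 ⊠ Z 2 0 0 0) ▷ f := by
    have e1 := tens_eq f (Z 2 0 0 0)
    have e2 := tens_eq' f (Z 2 0 0 0)
    rw [tens_one_zero] at e2
    rw [e2, eq_of_heq (one_zero_tens_heq (Z 2 0 0 0))] at e1
    rw [eq_of_heq (tens_assoc_heq f 𝐈 𝐈), one_tens_one]
    exact e1.symm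
  have h2 : (𝐈 ⊠ Z 0 2 0 0) ⊠ 𝐈 = 𝐈 ⊠ (Z 0 2 0 0 ⊠ 𝐈) :=
    eq_of_heq (tens_assoc_heq 𝐈 (Z 0 2 0 0) 𝐈)
  have h3 : one 2 ⊠ Z 2 0 0 0 = 𝐈 ⊠ (𝐈 ⊠ Z 2 0 0 0) := by
    rw [← eq_of_heq (tens_assoc_heq 𝐈 𝐈 (Z 2 0 0 0)), one_tens_one]
  rw [tens_comp_one, comp_assoc, h1, h2, h3, ← comp_assoc, ← one_tens_comp, snake, one_tens_one]
  exact one_comp _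

/-- Whatever slides along the cup slides along the cap. -/
theorem cap_of_cup {A B : Mor 1 1} (h : Z 0 2 0 0 ▷ (A ⊠ 𝐈) = Z 0 2 0 0 ▷ (𝐈 ⊠ B)) :
    (B ⊠ 𝐈) ▷ Z 2 0 0 0 = (𝐈 ⊠ A) ▷ Z 2 0 0 0 := by
  have h1 : (𝐈 ⊠ Z 0 2 0 0) ▷ (((𝐈 ⊠ A) ▷ Z 2 0 0 0) ⊠ 𝐈) = B := by
    have h2 : (one 2 ⊠ B) ▷ (Z 2 0 0 0 ⊠ 𝐈) = (Z 2 0 0 0 ⊠ 𝐈) ▷ B := by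
      rw [interchange, one_comp, comp_one]
      have := interchange (Z 2 0 0 0) (one 0) 𝐈 B
      rw [comp_one, one_comp] at this
      rw [← this, eq_of_heq (one_zero_tens_heq B)]
    rw [tens_comp_one, eq_of_heq (tens_assoc_heq 𝐈 A 𝐈), ← comp_assoc, ← one_tens_comp, h,
      one_tens_comp, ← eq_of_heq (tens_assoc_heq 𝐈 𝐈 B), one_tens_one, comp_assoc, h2,
      ← comp_assoc, snake', one_comp]
  rw [← bend_effect ((𝐈 ⊠ A) ▷ Z 2 0 0 0), h1]

theorem cap_H : (H ⊠ 𝐈) ▷ Z 2 0 0 0 = (𝐈 ⊠ H) ▷ Z 2 0 0 0 := cap_of_cup cup_H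

/-! ## Red phases, copying -/

theorem R11_R11 (α β γ δ : Real.Angle) : R 1 1 α β ▷ R 1 1 γ δ = R 1 1 (α + γ) (β + δ) := by
  rw [R11, R11, R11, ← Z_comp one_pos]
  simp only [comp_assoc]
  rw [← comp_assoc H H', H_H', one_comp]

theorem copy_zero : R 0 1 0 0 ▷ 𝐂 = R 0 1 0 0 ⊠ R 0 1 0 0 := mk_eq Equal.B1

theorem tens_scalar {n m : ℕ} (f : Mor n m) (s : Diag 0 0) (hs : s.interp ≠ 0) :
    f ⊠ mk s = f := by
  rw [scalar_eq_one s hs, tens_one_zero]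

/-- The basis state `|0⟩` absorbs green phases. -/
theorem zero_phase (α β : Real.Angle) : R 0 1 0 0 ▷ Z 1 1 α β = R 0 1 0 0 := by
  -- A green phase is a copy with an effect on one branch. Since |0⟩ is copied, the phase becomes a
  -- closed diagram, non-zero because the phase at 0 is 1.
  rw [← C_effect_right, ← comp_assoc, copy_zero, interchange, comp_one]
  refine tens_scalar _ (seq (xsp 0 1 0 0) (zsp 1 0 α β)) fun h => ?_
  have h1 := congrFun (congrFun h default) default
  rw [isGraph_xsp_zero.seq (isGraph_zsp 0 α β), if_pos (Subsingleton.elim _ _)] at h1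
  simp [weight] at h1

/-- The colour-changed form of `zero_phase`: the Hadamard node exchanges |0⟩ and |+⟩ as well as red
and green phases. -/
theorem plus_R (α β : Real.Angle) : Z 0 1 0 0 ▷ R 1 1 α β = Z 0 1 0 0 := by
  rw [R11, ← comp_assoc, ← R01', ← comp_assoc, zero_phase, R01, comp_assoc, state_N]

theorem effect_eq_cap (α β : Real.Angle) : (𝐈 ⊠ Z 0 1 α β) ▷ Z 2 0 0 0 = Z 1 0 α β := by
  have := Z_tens_one_comp (n := 0) (k := 1) (m' := 0) 1 one_pos 0 0 α β
  simpa only [zero_add] using this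

theorem state_H_cap (α β : Real.Angle) :
    (𝐈 ⊠ (Z 0 1 α β ▷ H)) ▷ Z 2 0 0 0 = H ▷ Z 1 0 α β := by
  rw [one_tens_comp, comp_assoc, ← cap_H, ← comp_assoc, interchange, one_comp, comp_one,
    ← effect_eq_cap, ← comp_assoc]
  congr 1
  have := tens_eq H (Z 0 1 α β)
  rw [tens_one_zero] at this
  exact this

theorem R10_eq_cap : (𝐈 ⊠ R 0 1 0 0) ▷ Z 2 0 0 0 = R 1 0 0 0 := by
  rw [R01, state_H_cap, R10']

/-- The effect `⟨0|` is copied by the green spider. -/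
theorem M_zero_effect : 𝐌 ▷ R 1 0 0 0 = R 1 0 0 0 ⊠ R 1 0 0 0 := by
  have e1 : 𝐌 ▷ (𝐈 ⊠ R 0 1 0 0) = (one 2 ⊠ R 0 1 0 0) ▷ (𝐌 ⊠ 𝐈) := by
    rw [interchange, one_comp, comp_one]
    have := tens_eq 𝐌 (R 0 1 0 0)
    rw [tens_one_zero] at this
    exact this.symm
  have e2 : (𝐌 ⊠ 𝐈) ▷ Z 2 0 0 0 = (𝐈 ⊠ 𝐌) ▷ Z 2 0 0 0 := by
    have h1 := Z_one_tens_comp (n := 2) (k := 1) (m := 0) 1 one_pos 0 0 0 0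
    have h2 := Z_tens_one_comp (n := 2) (k := 1) (m' := 0) 1 one_pos 0 0 0 0
    exact h1.trans h2.symm
  have e3 : one 2 ⊠ R 0 1 0 0 = 𝐈 ⊠ (𝐈 ⊠ R 0 1 0 0) := by
    rw [← eq_of_heq (tens_assoc_heq 𝐈 𝐈 (R 0 1 0 0)), one_tens_one]
  have e4 : (𝐈 ⊠ R 0 1 0 0) ▷ (𝐈 ⊠ 𝐂) = (𝐈 ⊠ R 0 1 0 0) ⊠ R 0 1 0 0 := by
    rw [← one_tens_comp, copy_zero, eq_of_heq (tens_assoc_heq 𝐈 (R 0 1 0 0) (R 0 1 0 0))]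
  have e5 : (𝐈 ⊠ R 0 1 0 0) ▷ 𝐌 = R 1 0 0 0 ⊠ R 0 1 0 0 := by
    rw [← M_eq_cap', ← comp_assoc, e4, interchange, R10_eq_cap, comp_one]
  have e6 : 𝐌 ▷ R 1 0 0 0 = 𝐌 ▷ ((𝐈 ⊠ R 0 1 0 0) ▷ Z 2 0 0 0) := by rw [R10_eq_cap]
  rw [e6, ← comp_assoc, e1, comp_assoc, e2, e3, ← comp_assoc, ← one_tens_comp, e5]
  have h1 := tens_eq (𝐈 ⊠ R 1 0 0 0) (R 0 1 0 0)
  rw [tens_one_zero] at h1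
  have h2 := tens_eq' (R 1 0 0 0) (R 1 0 0 0)
  rw [tens_one_zero] at h2
  rw [← eq_of_heq (tens_assoc_heq 𝐈 (R 1 0 0 0) (R 0 1 0 0)), h1, comp_assoc, h2]
  exact congrArg _ R10_eq_cap

/-! ## Stabilizer gates on one wire -/

/-- The green phase gate. -/
def ph (a b : ZMod 3) : Mor 1 1 := mk (zph a b)

/-- The red phase gate. -/
def rph (a b : ZMod 3) : Mor 1 1 := mk (xph a b)

theorem ang_add (a b : ZMod 3) : ang a + ang b = ang (a + b) := by
  have h3 : ((3 * (2 * Real.pi / 3) : ℝ) : Real.Angle) = 0 := by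
    rw [mul_div_cancel₀ _ (by norm_num : (3 : ℝ) ≠ 0), Real.Angle.coe_two_pi]
  have h : a.val + b.val = (a + b).val ∨ a.val + b.val = (a + b).val + 3 := by
    revert a b; decide
  rw [ang, ang, ang, ← Real.Angle.coe_add, ← add_mul, ← Nat.cast_add]
  rcases h with h | h
  · rw [h]
  · rw [h, Nat.cast_add, add_mul, Real.Angle.coe_add, Nat.cast_ofNat, h3, add_zero]

theorem ang_zero : ang 0 = 0 := by simp [ang]

theorem ph_comp (a b c d : ZMod 3) : ph a b ▷ ph c d = ph (a + c) (b + d) := by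
  have := Z_comp (n := 1) (m := 1) one_pos (ang a) (ang b) (ang c) (ang d)
  rwa [ang_add, ang_add] at this

theorem rph_comp (a b c d : ZMod 3) : rph a b ▷ rph c d = rph (a + c) (b + d) := by
  have := R11_R11 (ang a) (ang b) (ang c) (ang d)
  rwa [ang_add, ang_add] at this

theorem ph_zero : ph 0 0 = 𝐈 := by
  have := Z_one
  rwa [← ang_zero] at this

theorem rph_zero : rph 0 0 = 𝐈 := by
  have := R_one
  rwa [← ang_zero] at this

theorem euler : H = ph 2 2 ▷ (rph 2 2 ▷ ph 2 2) := mk_eq Equal.EU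

theorem rph_eq (a b : ZMod 3) : rph a b = H' ▷ (ph a b ▷ H) := R11 _ _

theorem rph_eq' (a b : ZMod 3) : rph a b = H ▷ (ph b a ▷ H') := R11' _ _

theorem ph_N (a b : ZMod 3) : H ▷ H ▷ ph a b = ph b a ▷ (H ▷ H) := phase_N _ _

theorem H_H_comp {n : ℕ} (f : Mor 1 n) : H ▷ (H' ▷ f) = f := by rw [← comp_assoc, H_H', one_comp]

theorem H'_H_comp {n : ℕ} (f : Mor 1 n) : H' ▷ (H ▷ f) = f := by rw [← comp_assoc, H'_H, one_comp]

theorem ph_three (f : Mor 1 1) : ph 1 1 ▷ (ph 2 2 ▷ f) = f := by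
  rw [← comp_assoc, ph_comp, show (1 + 2 : ZMod 3) = 0 from rfl, ph_zero, one_comp]

theorem ph_three' (f : Mor 1 1) : ph 2 2 ▷ (ph 1 1 ▷ f) = f := by
  rw [← comp_assoc, ph_comp, show (2 + 1 : ZMod 3) = 0 from rfl, ph_zero, one_comp]

/-- The Euler decomposition without red nodes. -/
theorem H_ph_H : H ▷ (ph 1 1 ▷ H) = ph 2 2 ▷ (H ▷ ph 2 2) := by
  have h := euler
  rw [rph_eq] at h
  have h2 := congrArg (fun f => H ▷ (ph 1 1 ▷ f)) h
  simp only [comp_assoc, ph_three, H_H_comp] at h2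
  exact h2

/-- The Euler decomposition solved for the green phase inside its red (2,2) node. Here H† appears on
the right, whereas `H_ph_H` has H; the difference is what later produces links of weight 2 and 1. -/
theorem H_ph_two_H : H ▷ (ph 2 2 ▷ H) = ph 1 1 ▷ (H' ▷ ph 1 1) := by
  have h := congrArg (fun f => ph 1 1 ▷ (f ▷ ph 1 1)) euler
  rw [rph_eq] at h
  simp only [comp_assoc, ph_comp, ph_three, show (2 + 1 : ZMod 3) = 0 from rfl, ph_zero,
    comp_one] at h
  have h2 := congrArg (fun f => H ▷ H ▷ f) h
  simp only [← comp_assoc, ph_N] at h2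
  simp only [comp_assoc, H_H_comp] at h2
  rw [← h2, ← comp_assoc H H (H ▷ _), ← comp_assoc (H ▷ H), comp_assoc H H H, H_H_H]

theorem R21_plus_effect : R 2 1 0 0 ▷ Z 1 0 0 0 = Z 1 0 0 0 ⊠ Z 1 0 0 0 := by
  rw [R21', comp_assoc, comp_assoc, ← R10, M_zero_effect, interchange, R10, H_H_comp]

/-- The Gaussian identity. -/
theorem gauss_one : Z 0 1 0 0 ▷ ph 1 1 ▷ H = Z 0 1 0 0 ▷ ph 2 2 := by
  -- The red (2,2) node fixes |+⟩. Writing it with green phases and H by the Euler decomposition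
  -- leaves an identity about |+⟩ alone.
  have h : Z 0 1 0 0 ▷ rph 2 2 = Z 0 1 0 0 := plus_R _ _
  rw [rph_eq, H'_eq] at h
  simp only [comp_assoc, H_ph_two_H] at h
  rw [← comp_assoc H H, ← comp_assoc (Z 0 1 0 0), state_N] at h
  have h2 := congrArg (fun f => f ▷ (ph 2 2 ▷ (H ▷ H))) h
  simp only [comp_assoc, ph_three, H'_H_comp] at h2
  rw [comp_assoc, h2, ← ph_N, ← comp_assoc, state_N]

theorem gauss_two : Z 0 1 0 0 ▷ ph 2 2 ▷ H = Z 0 1 0 0 ▷ ph 1 1 := by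
  have h : Z 0 1 0 0 ▷ rph 1 1 = Z 0 1 0 0 := plus_R _ _
  rw [rph_eq, H'_eq] at h
  simp only [comp_assoc, H_ph_H] at h
  rw [← comp_assoc H H, ← comp_assoc (Z 0 1 0 0), state_N] at h
  have h2 := congrArg (fun f => f ▷ ph 1 1) h
  simp only [comp_assoc, ph_comp, show (2 + 1 : ZMod 3) = 0 from rfl, ph_zero, comp_one] at h2
  rw [comp_assoc, h2]

end Spiders
end Mor
end QutritZX
end

/-! ### Links between two wires, the controlled phase and the controlled sum -/

noncomputable section
namespace QutritZX
open Diag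
namespace Mor

section Links

local notation "𝐈" => one 1
local notation "𝐂" => Z 1 2 0 0
local notation "𝐌" => Z 2 1 0 0
local notation "asc" f:max g:max h:max => eq_of_heq (tens_assoc_heq f g h)

theorem slide {n m n' m' : ℕ} (f : Mor n m) (g : Mor n' m') :
    (f ⊠ one n') ▷ (one m ⊠ g) = (one n ⊠ g) ▷ (f ⊠ one m') :=
  (tens_eq f g).symm.trans (tens_eq' f g)

/-! ## Links between two wires -/

/-- Merging a wire into another one through the gate `A`. -/
def merge (A : Mor 1 1) : Mor 2 1 := (A ⊠ 𝐈) ▷ 𝐌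

/-- Two wires connected by green nodes and a wire carrying the gate `A`. -/
def link (A : Mor 1 1) : Mor 2 2 := (𝐂 ⊠ 𝐈) ▷ (𝐈 ⊠ merge A)

theorem link_eq (A : Mor 1 1) :
    link A = (𝐂 ⊠ 𝐈) ▷ ((𝐈 ⊠ (A ⊠ 𝐈)) ▷ (𝐈 ⊠ 𝐌)) := by
  rw [link, merge, one_tens_comp]

theorem merge_comp_phase (A : Mor 1 1) (a b : ZMod 3) :
    merge (A ▷ ph a b) = merge A ▷ ph a b := by
  rw [merge, merge, tens_comp_one, comp_assoc, comp_assoc]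
  congr 1
  exact phase_left_M _ _

theorem phase_merge (A : Mor 1 1) (a b : ZMod 3) :
    (𝐈 ⊠ ph a b) ▷ merge A = merge A ▷ ph a b := by
  have h : (𝐈 ⊠ ph a b) ▷ 𝐌 = 𝐌 ▷ ph a b := phase_right_M _ _
  rw [merge, ← comp_assoc, ← slide, comp_assoc, h, comp_assoc]

theorem phase_C (a b : ZMod 3) : 𝐂 ▷ (𝐈 ⊠ ph a b) = ph a b ▷ 𝐂 := C_phase_right _ _

theorem phase_C' (a b : ZMod 3) : 𝐂 ▷ (ph a b ⊠ 𝐈) = ph a b ▷ 𝐂 := C_phase_left _ _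

theorem link_phase_comp (A : Mor 1 1) (a b : ZMod 3) :
    link (ph a b ▷ A) = (ph a b ⊠ 𝐈) ▷ link A := by
  have h : merge (ph a b ▷ A) = (ph a b ⊠ 𝐈) ▷ merge A := by
    rw [merge, tens_comp_one, comp_assoc]; rfl
  rw [link, h, one_tens_comp, ← asc 𝐈 (ph a b) 𝐈, ← comp_assoc, ← tens_comp_one, phase_C,
    tens_comp_one, comp_assoc]; rfl

theorem link_comp_phase (A : Mor 1 1) (a b : ZMod 3) :
    link (A ▷ ph a b) = link A ▷ (𝐈 ⊠ ph a b) := by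
  rw [link, merge_comp_phase, one_tens_comp, ← comp_assoc]; rfl

theorem phase_left_link (A : Mor 1 1) (a b : ZMod 3) :
    (ph a b ⊠ 𝐈) ▷ link A = link A ▷ (ph a b ⊠ 𝐈) := by
  rw [link, comp_assoc, ← slide, ← one_tens_one 1 1, ← asc (ph a b) 𝐈 𝐈, ← comp_assoc,
    ← comp_assoc, ← tens_comp_one, ← tens_comp_one, phase_C']

theorem phase_right_link (A : Mor 1 1) (a b : ZMod 3) :
    (𝐈 ⊠ ph a b) ▷ link A = link A ▷ (𝐈 ⊠ ph a b) := by
  rw [link, ← comp_assoc, ← slide, comp_assoc, comp_assoc, ← one_tens_comp, ← phase_merge,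
    one_tens_comp, asc 𝐈 𝐈 (ph a b) |>.symm, one_tens_one]

theorem merge_C (A : Mor 1 1) : merge A ▷ 𝐂 = (𝐈 ⊠ 𝐂) ▷ (merge A ⊠ 𝐈) := by
  have h : 𝐌 ▷ 𝐂 = (𝐈 ⊠ 𝐂) ▷ (𝐌 ⊠ 𝐈) := by
    rw [frob', Z_comp one_pos, add_zero]
  rw [merge, comp_assoc, h, ← comp_assoc, slide, tens_comp_one, asc A 𝐈 𝐈, one_tens_one,
    comp_assoc]

/-- Links sharing a wire commute. -/
theorem link_comm (A B : Mor 1 1) :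
    (link A ⊠ 𝐈) ▷ (𝐈 ⊠ link B) = (𝐈 ⊠ link B) ▷ (link A ⊠ 𝐈) := by
  have e1 : ((𝐈 ⊠ merge A) ⊠ 𝐈) ▷ (𝐈 ⊠ (𝐂 ⊠ 𝐈)) =
      (𝐈 ⊠ ((𝐈 ⊠ 𝐂) ⊠ 𝐈)) ▷ (𝐈 ⊠ (merge A ⊠ one 2)) := by
    rw [asc 𝐈 (merge A) 𝐈, ← one_tens_comp, ← tens_comp_one, merge_C, tens_comp_one, one_tens_comp,
      asc (merge A) 𝐈 𝐈, one_tens_one]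
  have e2 : (𝐈 ⊠ (merge A ⊠ one 2)) ▷ (𝐈 ⊠ (𝐈 ⊠ merge B)) =
      (𝐈 ⊠ (one 2 ⊠ merge B)) ▷ (𝐈 ⊠ (merge A ⊠ 𝐈)) := by
    rw [← one_tens_comp, ← one_tens_comp, slide]
  have e3 : ((𝐂 ⊠ 𝐈) ⊠ 𝐈) ▷ (𝐈 ⊠ ((𝐈 ⊠ 𝐂) ⊠ 𝐈)) = (𝐈 ⊠ (𝐂 ⊠ 𝐈)) ▷ (𝐂 ⊠ one 3) := by
    rw [asc 𝐂 𝐈 𝐈, asc 𝐈 𝐂 𝐈, ← asc 𝐈 𝐈 (𝐂 ⊠ 𝐈), one_tens_one]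
    exact slide 𝐂 (𝐂 ⊠ 𝐈)
  have e4 : (𝐈 ⊠ (𝐈 ⊠ merge B)) ▷ ((𝐂 ⊠ 𝐈) ⊠ 𝐈) = (𝐂 ⊠ one 3) ▷ (𝐈 ⊠ (one 2 ⊠ merge B)) := by
    have : (𝐂 ⊠ one 3) = (𝐂 ⊠ 𝐈) ⊠ one 2 := by rw [← one_tens_one 1 2, asc 𝐂 𝐈 (one 2)]
    rw [this, ← asc 𝐈 𝐈 (merge B), one_tens_one, ← asc 𝐈 (one 2) (merge B), one_tens_one]
    exact (slide (𝐂 ⊠ 𝐈) (merge B)).symm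
  simp only [link, tens_comp_one, one_tens_comp, comp_assoc]
  rw [← comp_assoc ((𝐈 ⊠ merge A) ⊠ 𝐈), e1, comp_assoc, e2, ← comp_assoc, e3, comp_assoc,
    ← comp_assoc (𝐈 ⊠ (𝐈 ⊠ merge B)), e4, asc 𝐈 (merge A) 𝐈, comp_assoc]

/-- Expresses that a link is diagonal on its second wire; `eq_one_of_comp_cx` needs exactly this. -/
theorem link_C (A : Mor 1 1) : link A ▷ (𝐈 ⊠ 𝐂) = (𝐈 ⊠ 𝐂) ▷ (link A ⊠ 𝐈) := by
  rw [link, tens_comp_one, comp_assoc, ← one_tens_comp, merge_C, one_tens_comp, ← comp_assoc,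
    ← comp_assoc, asc 𝐂 𝐈 𝐈, asc 𝐈 (merge A) 𝐈, one_tens_one, ← slide, ← asc 𝐈 𝐈 𝐂, one_tens_one]

/-! ### Plugging states and effects -/

theorem plus_link (A : Mor 1 1) : (𝐈 ⊠ Z 0 1 0 0) ▷ link A = 𝐂 ▷ (𝐈 ⊠ A) := by
  have h : (𝐈 ⊠ Z 0 1 0 0) ▷ merge A = A := by
    have h1 : (𝐈 ⊠ Z 0 1 0 0) ▷ (A ⊠ 𝐈) = A ▷ (𝐈 ⊠ Z 0 1 0 0) := by
      rw [← slide, tens_one_zero]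
    rw [merge, ← comp_assoc, h1, comp_assoc, state_right_M, Z_one, comp_one]
  have h2 : (𝐈 ⊠ Z 0 1 0 0) ▷ (𝐂 ⊠ 𝐈) = 𝐂 ▷ (𝐈 ⊠ (𝐈 ⊠ Z 0 1 0 0)) := by
    rw [← slide, tens_one_zero, ← asc 𝐈 𝐈 (Z 0 1 0 0), one_tens_one]
  rw [link, ← comp_assoc, h2, comp_assoc, ← one_tens_comp, h]

theorem link_effect (A : Mor 1 1) (a b : ZMod 3) :
    link A ▷ (Z 1 0 (ang a) (ang b) ⊠ 𝐈) = merge (ph a b ▷ A) := by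
  have h : (𝐈 ⊠ merge A) ▷ (Z 1 0 (ang a) (ang b) ⊠ 𝐈) =
      (Z 1 0 (ang a) (ang b) ⊠ one 2) ▷ merge A := by
    rw [← slide, eq_of_heq (one_zero_tens_heq (merge A))]
  have h2 : (𝐂 ⊠ 𝐈) ▷ (Z 1 0 (ang a) (ang b) ⊠ one 2) = ph a b ⊠ 𝐈 := by
    rw [← one_tens_one 1 1, ← asc (Z 1 0 (ang a) (ang b)) 𝐈 𝐈, ← tens_comp_one, C_effect_left]
    rfl
  rw [link, comp_assoc, h, ← comp_assoc, h2, merge, merge, tens_comp_one, comp_assoc]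

/-! ### Symmetry -/

/-- A presentation symmetric in the two wires: both are copied and the inner copies meet in an
effect. Symmetry of the link then reduces to symmetry of that effect. -/
theorem link_caps (A : Mor 1 1) :
    link A = (𝐂 ⊠ 𝐂) ▷ ((𝐈 ⊠ ((A ⊠ 𝐈) ▷ Z 2 0 0 0)) ⊠ 𝐈) := by
  have h : merge A = (𝐈 ⊠ 𝐂) ▷ (((A ⊠ 𝐈) ▷ Z 2 0 0 0) ⊠ 𝐈) := by
    rw [merge, ← M_eq_cap', ← comp_assoc, slide, comp_assoc, tens_comp_one, asc A 𝐈 𝐈, one_tens_one]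
  rw [link, h, one_tens_comp, ← comp_assoc, ← asc 𝐈 𝐈 𝐂, one_tens_one, ← tens_eq,
    asc 𝐈 ((A ⊠ 𝐈) ▷ Z 2 0 0 0) 𝐈]

theorem sw_eq : sw = perm (finAddFlip : Fin (1 + 1) ≃ Fin (1 + 1)) := by
  rw [sw, perm, swap]
  congr 2
  ext i
  fin_cases i <;> rfl

theorem sw_sw : sw ▷ sw = one 2 := by
  rw [sw_eq, perm_comp, ← perm_refl]
  congr 1
  ext i
  fin_cases i <;> rfl

theorem C_sw : 𝐂 ▷ sw = 𝐂 := Z_perm _ _ _ _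

theorem sw_M : sw ▷ 𝐌 = 𝐌 := perm_Z _ _ _ _

theorem sw_tens (f g : Mor 1 1) : sw ▷ (f ⊠ g) = (g ⊠ f) ▷ sw := by
  rw [sw_eq]; exact (swap_natural g f).symm

theorem flip_one_two : (perm (finAddFlip : Fin (1 + 2) ≃ Fin (2 + 1)) : Mor 3 3) =
    (sw ⊠ 𝐈) ▷ (𝐈 ⊠ sw) := by
  rw [← perm_refl, show sw = perm (Equiv.swap 0 1) from rfl, perm_tens, perm_tens]
  refine Eq.trans ?_ (perm_comp _ _).symm
  congr 1
  ext i
  fin_cases i <;> rfl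

theorem flip_two_one : (perm (finAddFlip : Fin (2 + 1) ≃ Fin (1 + 2)) : Mor 3 3) =
    (𝐈 ⊠ sw) ▷ (sw ⊠ 𝐈) := by
  rw [← perm_refl, show sw = perm (Equiv.swap 0 1) from rfl, perm_tens, perm_tens]
  refine Eq.trans ?_ (perm_comp _ _).symm
  congr 1
  ext i
  fin_cases i <;> rfl

theorem sw_C_tens : sw ▷ (𝐂 ⊠ 𝐈) = (𝐈 ⊠ 𝐂) ▷ ((sw ⊠ 𝐈) ▷ (𝐈 ⊠ sw)) := by
  rw [← flip_one_two, sw_eq]; exact (swap_natural 𝐈 𝐂).symm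

theorem sw_tens_C : sw ▷ (𝐈 ⊠ 𝐂) = (𝐂 ⊠ 𝐈) ▷ ((𝐈 ⊠ sw) ▷ (sw ⊠ 𝐈)) := by
  rw [← flip_two_one, sw_eq]; exact (swap_natural 𝐂 𝐈).symm

theorem tens_sw {f : Mor 2 1} : (𝐈 ⊠ f) ▷ sw = (sw ⊠ 𝐈) ▷ ((𝐈 ⊠ sw) ▷ (f ⊠ 𝐈)) := by
  rw [← comp_assoc, ← flip_one_two, sw_eq]; exact swap_natural 𝐈 f

theorem tens_cap (κ : Mor 2 0) : (𝐈 ⊠ sw) ▷ ((sw ⊠ 𝐈) ▷ (𝐈 ⊠ κ)) = κ ⊠ 𝐈 := by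
  rw [← comp_assoc, ← flip_two_one]
  refine (swap_natural κ 𝐈).symm.trans ?_
  have : (perm (finAddFlip : Fin (0 + 1) ≃ Fin (1 + 0)) : Mor 1 1) = 𝐈 := by
    rw [← perm_refl]; congr 1; ext i; fin_cases i; rfl
  exact (congrArg _ this).trans (comp_one _)

/-- Links through self-transpose gates are symmetric. -/
theorem sw_link_sw {A : Mor 1 1} (h : (A ⊠ 𝐈) ▷ Z 2 0 0 0 = (𝐈 ⊠ A) ▷ Z 2 0 0 0) :
    sw ▷ link A ▷ sw = link A := by
  have e1 : (𝐈 ⊠ sw) ▷ (𝐈 ⊠ sw) = one 3 := by rw [← one_tens_comp, sw_sw, one_tens_one]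
  have e2 : (sw ⊠ 𝐈) ▷ (sw ⊠ 𝐈) = one 3 := by rw [← tens_comp_one, sw_sw, one_tens_one]
  have e3 : (sw ⊠ 𝐈) ▷ ((𝐈 ⊠ sw) ▷ ((sw ⊠ 𝐈) ▷ (𝐈 ⊠ sw))) = (𝐈 ⊠ sw) ▷ (sw ⊠ 𝐈) := by
    rw [← flip_one_two, ← comp_assoc, ← flip_one_two, ← flip_two_one]
    refine (perm_comp (finAddFlip : Fin (1 + 2) ≃ Fin (2 + 1)) (finAddFlip : Fin (1 + 2) ≃ Fin (2 + 1))).trans ?_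
    congr 1
    ext i
    fin_cases i <;> rfl
  have e4 : sw ▷ merge A = (𝐈 ⊠ A) ▷ 𝐌 := by
    rw [merge, ← comp_assoc, sw_tens, comp_assoc, sw_M]
  have e5 : sw ▷ link A ▷ sw = (𝐈 ⊠ 𝐂) ▷ (((𝐈 ⊠ A) ▷ 𝐌) ⊠ 𝐈) := by
    rw [link, comp_assoc, comp_assoc, tens_sw, ← comp_assoc, sw_C_tens, comp_assoc, comp_assoc,
      ← comp_assoc (𝐈 ⊠ sw) (sw ⊠ 𝐈), ← comp_assoc (𝐈 ⊠ sw ▷ (sw ⊠ 𝐈)), comp_assoc (𝐈 ⊠ sw),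
      ← comp_assoc (sw ⊠ 𝐈), e3, comp_assoc, ← comp_assoc (𝐈 ⊠ 𝐂), ← one_tens_comp, C_sw,
      ← tens_comp_one, e4]
  rw [e5, link_caps, h, ← M_eq_cap, ← comp_assoc, ← slide, comp_assoc, ← one_tens_one 1 1,
    asc 𝐈 𝐈 A, ← one_tens_comp, tens_comp_one, ← comp_assoc, tens_eq' 𝐂 𝐂, asc 𝐂 𝐈 𝐈, one_tens_one]

/-- The controlled phase gate. -/
def cz : Mor 2 2 := link H

theorem sw_cz_sw : sw ▷ cz ▷ sw = cz := sw_link_sw cap_H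

/-! ## The controlled sum gate -/

/-- The controlled sum gate, with control on the first wire. -/
def cx : Mor 2 2 := (𝐂 ⊠ 𝐈) ▷ (𝐈 ⊠ R 2 1 0 0)

theorem R21_eq_merge : R 2 1 0 0 = (𝐈 ⊠ H) ▷ (merge H ▷ H') := by
  rw [R21', tens_eq', merge, comp_assoc, comp_assoc]

/-- The Fourier transform of the target turns addition into the phase ω^(xy): the colour change of
the red 2-to-1 spider supplies the H nodes. -/
theorem cx_eq : cx = (𝐈 ⊠ H) ▷ (cz ▷ (𝐈 ⊠ H')) := by
  rw [cx, R21_eq_merge, one_tens_comp, one_tens_comp, ← comp_assoc, ← asc 𝐈 𝐈 H, one_tens_one, slide,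
    cz, link, comp_assoc, comp_assoc]

/-- ⟨+| sums over the target, and adding the control only permutes the summands. -/
theorem cx_plus_effect : cx ▷ (𝐈 ⊠ Z 1 0 0 0) = 𝐈 ⊠ Z 1 0 0 0 := by
  rw [cx, comp_assoc, ← one_tens_comp, R21_plus_effect, ← asc 𝐈 (Z 1 0 0 0) (Z 1 0 0 0),
    interchange, one_comp, C_effect_right, Z_one]

/-- A controlled sum gate with the target copied in advance. -/
def cxCopy : Mor 2 3 := (𝐂 ⊠ 𝐂) ▷ ((𝐈 ⊠ (sw ⊠ 𝐈)) ▷ (one 2 ⊠ R 2 1 0 0))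

theorem R21_C : R 2 1 0 0 ▷ 𝐂 = (𝐂 ⊠ 𝐂) ▷ ((𝐈 ⊠ (sw ⊠ 𝐈)) ▷ (R 2 1 0 0 ⊠ R 2 1 0 0)) :=
  (mk_eq Equal.B2).symm

/-- By the bialgebra law, copying x + y amounts to copying x and y and adding twice. One sum lands
on the extra wire of `cxCopy`; the other is the remaining `cx`. -/
theorem cx_C : cx ▷ (𝐈 ⊠ 𝐂) = cxCopy ▷ (cx ⊠ 𝐈) := by
  have e1 : (𝐂 ⊠ 𝐈) ▷ (𝐈 ⊠ (𝐂 ⊠ 𝐂)) = (𝐂 ⊠ 𝐂) ▷ (𝐂 ⊠ one 3) := by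
    rw [← asc 𝐈 𝐂 𝐂, interchange, one_comp, fuse_CR, ← fuse_CL, ← one_tens_one 1 2,
      ← asc 𝐂 𝐈 (one 2), interchange, comp_one]
  have e2 : (𝐂 ⊠ one 3) ▷ (𝐈 ⊠ (𝐈 ⊠ (sw ⊠ 𝐈))) = (𝐈 ⊠ (sw ⊠ 𝐈)) ▷ (𝐂 ⊠ one 3) := by
    rw [← asc 𝐈 𝐈 (sw ⊠ 𝐈), one_tens_one]
    exact slide 𝐂 (sw ⊠ 𝐈)
  have e3 : (one 2 ⊠ R 2 1 0 0) ▷ (cx ⊠ 𝐈) = (𝐂 ⊠ one 3) ▷ (𝐈 ⊠ (R 2 1 0 0 ⊠ R 2 1 0 0)) := by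
    have h1 : (𝐂 ⊠ one 3) = (𝐂 ⊠ 𝐈) ⊠ one 2 := by rw [← one_tens_one 1 2, asc 𝐂 𝐈 (one 2)]
    rw [cx, tens_comp_one, ← comp_assoc, ← slide, comp_assoc, asc 𝐈 (R 2 1 0 0) 𝐈, h1,
      tens_eq' (R 2 1 0 0) (R 2 1 0 0), one_tens_comp, ← asc 𝐈 (one 2) (R 2 1 0 0), one_tens_one]
  rw [cxCopy, comp_assoc, comp_assoc, e3, cx, comp_assoc, ← one_tens_comp, R21_C, one_tens_comp,
    one_tens_comp, ← comp_assoc, e1, comp_assoc, ← comp_assoc (𝐂 ⊠ one 3), e2, comp_assoc]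

/-- A phase on the target of a controlled sum becomes phases and a link in front of it. -/
theorem cxCopy_cap {B : Mor 1 1} {ζ : Mor 1 0}
    (h : R 2 1 0 0 ▷ ζ = (B ⊠ 𝐈) ▷ Z 2 0 0 0) : cxCopy ▷ (one 2 ⊠ ζ) = link B := by
  have e1 : (one 2 ⊠ R 2 1 0 0) ▷ (one 2 ⊠ ζ) = 𝐈 ⊠ (𝐈 ⊠ ((B ⊠ 𝐈) ▷ Z 2 0 0 0)) := by
    rw [← one_tens_comp, h, ← asc 𝐈 𝐈 ((B ⊠ 𝐈) ▷ Z 2 0 0 0), one_tens_one]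
  have e2 : 𝐂 ⊠ 𝐂 = (𝐂 ⊠ 𝐂) ▷ (𝐈 ⊠ (𝐈 ⊠ sw)) := by
    rw [← asc 𝐈 𝐈 sw, one_tens_one]
    refine Eq.trans ?_ (interchange 𝐂 (one 2) 𝐂 sw).symm
    rw [C_sw, comp_one]
  rw [cxCopy, comp_assoc, comp_assoc, e1, link_caps, e2, comp_assoc, ← e2, ← one_tens_comp,
    ← one_tens_comp, tens_cap, asc 𝐈 ((B ⊠ 𝐈) ▷ Z 2 0 0 0) 𝐈]

/-- A phase is a copy followed by an effect. Copying the target computes x + y on a third wire, and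
the effect there is a function of x + y, which `h` rewrites as a link between the two inputs. -/
theorem cx_phase {B : Mor 1 1} {a b : ZMod 3}
    (h : R 2 1 0 0 ▷ Z 1 0 (ang a) (ang b) = (B ⊠ 𝐈) ▷ Z 2 0 0 0) :
    cx ▷ (𝐈 ⊠ ph a b) = link B ▷ cx := by
  have h1 : ph a b = 𝐂 ▷ (𝐈 ⊠ Z 1 0 (ang a) (ang b)) := (C_effect_right _ _).symm
  have h2 : (cx ⊠ 𝐈) ▷ (one 2 ⊠ Z 1 0 (ang a) (ang b)) = (one 2 ⊠ Z 1 0 (ang a) (ang b)) ▷ cx := by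
    rw [slide, tens_one_zero]
  rw [h1, one_tens_comp, ← comp_assoc, cx_C, comp_assoc, ← asc 𝐈 𝐈 (Z 1 0 (ang a) (ang b)),
    one_tens_one, h2, ← comp_assoc, cxCopy_cap h]

theorem state_eq (a b : ZMod 3) : Z 0 1 (ang a) (ang b) = Z 0 1 0 0 ▷ ph a b := by
  have := Z_comp (n := 0) (m := 1) one_pos 0 0 (ang a) (ang b)
  rw [zero_add, zero_add] at this
  exact this.symm

theorem H_effect_one : H ▷ Z 1 0 (ang 1) (ang 1) = Z 1 0 (ang 2) (ang 2) := by
  rw [← state_H_cap, ← effect_eq_cap]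
  congr 2
  rw [state_eq, state_eq, gauss_one]

theorem H_effect_two : H ▷ Z 1 0 (ang 2) (ang 2) = Z 1 0 (ang 1) (ang 1) := by
  rw [← state_H_cap, ← effect_eq_cap]
  congr 2
  rw [state_eq, state_eq, gauss_two]

/-- After the colour change of the adder, the effect meets H† and is again a phase effect by `h`.
That one fuses into the green spider and leaves a cap with one gate on it. -/
theorem R21_effect {a b c d : ZMod 3}
    (h : H ▷ Z 1 0 (ang a) (ang b) = Z 1 0 (ang c) (ang d)) :
    R 2 1 0 0 ▷ Z 1 0 (ang b) (ang a) = ((H ▷ (ph c d ▷ H)) ⊠ 𝐈) ▷ Z 2 0 0 0 := by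
  have h1 : 𝐌 ▷ Z 1 0 (ang c) (ang d) = (ph c d ⊠ 𝐈) ▷ Z 2 0 0 0 := by
    rw [Z_comp one_pos]
    have := Z_one_tens_comp (n := 1) (k := 1) (m := 0) 1 one_pos 0 0 (ang c) (ang d)
    exact this.symm
  rw [R21', comp_assoc, comp_assoc, H'_effect, h, h1, tens_comp_one, comp_assoc, tens_comp_one,
    comp_assoc, cap_H, tens_eq H H, comp_assoc, ← comp_assoc (𝐈 ⊠ H), ← slide, comp_assoc]

theorem cx_one : cx ▷ (𝐈 ⊠ ph 1 1) = (ph 1 1 ⊠ ph 1 1) ▷ (link H' ▷ cx) := by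
  rw [cx_phase (R21_effect H_effect_one), H_ph_two_H, link_phase_comp, link_comp_phase,
    ← phase_right_link, ← comp_assoc, ← tens_eq, comp_assoc]

theorem cx_two : cx ▷ (𝐈 ⊠ ph 2 2) = (ph 2 2 ⊠ ph 2 2) ▷ (cz ▷ cx) := by
  rw [cx_phase (R21_effect H_effect_two), H_ph_H, link_phase_comp, link_comp_phase,
    ← phase_right_link, ← comp_assoc, ← tens_eq, comp_assoc]; rfl

/-! ### Powers of the controlled phase gate -/

/-- Since `cx` preserves ⟨+| on the target, so does `D`. Being diagonal on the second wire, `D` can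
act on one of two copies of it; discarding that copy with ⟨+| removes `D`. So `cx` can be cancelled
before its invertibility is known. -/
theorem eq_one_of_comp_cx {D : Mor 2 2} (hD : D ▷ (𝐈 ⊠ 𝐂) = (𝐈 ⊠ 𝐂) ▷ (D ⊠ 𝐈))
    (h : D ▷ cx = cx) : D = one 2 := by
  have h1 : D ▷ (𝐈 ⊠ Z 1 0 0 0) = 𝐈 ⊠ Z 1 0 0 0 := by
    rw [← cx_plus_effect, ← comp_assoc, h]
  have h2 : (𝐈 ⊠ 𝐂) ▷ (𝐈 ⊠ (Z 1 0 0 0 ⊠ 𝐈)) = one 2 := by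
    rw [← one_tens_comp, C_effect_left, Z_one, one_tens_one]
  have h3 : D = D ▷ ((𝐈 ⊠ 𝐂) ▷ (𝐈 ⊠ (Z 1 0 0 0 ⊠ 𝐈))) := by rw [h2, comp_one]
  rw [h3, ← comp_assoc, hD, comp_assoc, ← asc 𝐈 (Z 1 0 0 0) 𝐈, ← tens_comp_one, h1,
    asc 𝐈 (Z 1 0 0 0) 𝐈, h2]

theorem comp_C {D E : Mor 2 2} (hD : D ▷ (𝐈 ⊠ 𝐂) = (𝐈 ⊠ 𝐂) ▷ (D ⊠ 𝐈))
    (hE : E ▷ (𝐈 ⊠ 𝐂) = (𝐈 ⊠ 𝐂) ▷ (E ⊠ 𝐈)) :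
    (D ▷ E) ▷ (𝐈 ⊠ 𝐂) = (𝐈 ⊠ 𝐂) ▷ ((D ▷ E) ⊠ 𝐈) := by
  rw [comp_assoc, hE, ← comp_assoc, hD, comp_assoc, ← tens_comp_one]

theorem phases_link (A : Mor 1 1) (a b c d : ZMod 3) :
    (ph a b ⊠ ph c d) ▷ link A = link A ▷ (ph a b ⊠ ph c d) := by
  rw [tens_eq, comp_assoc, phase_right_link, ← comp_assoc, phase_left_link, comp_assoc]

/-- The phases (1,1) and (2,2) on the target cancel; moved in front of `cx` they also cancel,
leaving the product of their two links. -/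
theorem link_H'_cz : link H' ▷ cz = one 2 := by
  refine eq_one_of_comp_cx (comp_C (link_C _) (link_C _)) ?_
  have h := congrArg (fun f => f ▷ (𝐈 ⊠ ph 2 2)) cx_one
  simp only [comp_assoc, cx_two] at h
  rw [← one_tens_comp, ph_comp, show (1 + 2 : ZMod 3) = 0 from rfl, ph_zero, one_tens_one,
    comp_one, ← comp_assoc (link H'), ← phases_link, comp_assoc, ← comp_assoc (ph 1 1 ⊠ ph 1 1),
    interchange, ph_comp, show (1 + 2 : ZMod 3) = 0 from rfl, ph_zero, one_tens_one, one_comp] at h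
  rw [comp_assoc, ← h]

/-- The cube of a (2,2) phase is trivial. Conjugated by `cx`, its cube consists of trivial phases
and the cube of the link, which must therefore be trivial. -/
theorem cz_three : cz ^ 3 = 1 := by
  rw [pow_three]
  refine eq_one_of_comp_cx (comp_C (link_C _) (comp_C (link_C _) (link_C _))) ?_
  have h : SemiconjBy cx (𝐈 ⊠ ph 2 2) ((ph 2 2 ⊠ ph 2 2) * cz) := by
    rw [SemiconjBy, mul_def, mul_def, mul_def, cx_two, comp_assoc]
  have hc : Commute (ph 2 2 ⊠ ph 2 2) cz := phases_link _ _ _ _ _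
  have e1 : (𝐈 ⊠ ph 2 2) ^ 3 = 1 := by
    simp only [pow_three, mul_def, interchange, one_comp, ph_comp]
    exact (congrArg _ ph_zero).trans (one_tens_one 1 1)
  have e2 : (ph 2 2 ⊠ ph 2 2) ^ 3 = 1 := by
    simp only [pow_three, mul_def, interchange, ph_comp]
    exact (congrArg (fun f => f ⊠ f) ph_zero).trans (one_tens_one 1 1)
  have h3 := h.pow_right 3
  rw [hc.mul_pow, e1, e2, one_mul, SemiconjBy, mul_one, pow_three] at h3
  exact h3.symm

theorem link_H' : link H' = cz ^ 2 := by
  rw [← mul_one (link H'), ← cz_three, pow_succ' cz 2, ← mul_assoc, mul_def (link H') cz, link_H'_cz,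
    ← one_def, one_mul]

/-- Additivity of ω^(xz) in x: the adder becomes a multiplication of phases after H. -/
theorem R21_merge : (R 2 1 0 0 ⊠ 𝐈) ▷ merge H = (𝐈 ⊠ merge H) ▷ merge H := by
  have h : R 2 1 0 0 ▷ H = (H ⊠ H) ▷ 𝐌 := by rw [R21', comp_assoc, comp_assoc, H'_H, comp_one]
  have h2 : (𝐌 ⊠ 𝐈) ▷ 𝐌 = (𝐈 ⊠ 𝐌) ▷ 𝐌 := by rw [fuse_ML, fuse_MR]
  have h3 : (H ⊠ H) ⊠ 𝐈 = (𝐈 ⊠ (H ⊠ 𝐈)) ▷ (H ⊠ one 2) := by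
    rw [asc H H 𝐈]; exact tens_eq' H (H ⊠ 𝐈)
  rw [merge, ← comp_assoc, ← tens_comp_one, h, tens_comp_one, comp_assoc, h2, h3, comp_assoc,
    one_tens_comp, comp_assoc, ← comp_assoc (H ⊠ one 2), slide, comp_assoc]

/-- A controlled sum passes through a controlled phase. -/
theorem cx_cz : (cx ⊠ 𝐈) ▷ (𝐈 ⊠ cz) =
    (𝐈 ⊠ cz) ▷ ((sw ⊠ 𝐈) ▷ ((𝐈 ⊠ cz) ▷ ((sw ⊠ 𝐈) ▷ (cx ⊠ 𝐈)))) := by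
  have e0 : (𝐈 ⊠ cz) = (𝐈 ⊠ (𝐂 ⊠ 𝐈)) ▷ (one 2 ⊠ merge H) := by
    rw [cz, link, one_tens_comp, ← asc 𝐈 𝐈 (merge H), one_tens_one]
  have e1 : (cx ⊠ 𝐈) ▷ (𝐈 ⊠ cz) = (cxCopy ⊠ 𝐈) ▷ ((one 2 ⊠ merge H) ▷ (cx ⊠ 𝐈)) := by
    rw [e0, ← slide, ← comp_assoc, ← asc 𝐈 𝐂 𝐈, ← tens_comp_one, cx_C, tens_comp_one, comp_assoc,
      asc cx 𝐈 𝐈, one_tens_one]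
  have e2 : ((one 2 ⊠ R 2 1 0 0) ⊠ 𝐈) ▷ (one 2 ⊠ merge H) =
      (one 3 ⊠ merge H) ▷ (one 2 ⊠ merge H) := by
    rw [asc (one 2) (R 2 1 0 0) 𝐈, ← one_tens_comp, R21_merge, one_tens_comp,
      ← asc (one 2) 𝐈 (merge H), one_tens_one]
  have e3 : ((𝐈 ⊠ (sw ⊠ 𝐈)) ⊠ 𝐈) ▷ (one 3 ⊠ merge H) =
      (one 3 ⊠ merge H) ▷ ((𝐈 ⊠ sw) ⊠ 𝐈) := by
    rw [← asc 𝐈 sw 𝐈, asc (𝐈 ⊠ sw) 𝐈 𝐈, one_tens_one]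
    exact slide (𝐈 ⊠ sw) (merge H)
  have e4 : ((𝐂 ⊠ 𝐂) ⊠ 𝐈) ▷ (one 3 ⊠ merge H) = (𝐈 ⊠ cz) ▷ (𝐂 ⊠ one 2) := by
    rw [← tens_eq', asc 𝐂 𝐂 𝐈, ← one_tens_one 2 1, asc (one 2) 𝐈 (merge H)]
    refine (interchange 𝐂 (one 2) (𝐂 ⊠ 𝐈) (𝐈 ⊠ merge H)).trans ?_
    rw [comp_one]; rfl
  have e5 : (𝐂 ⊠ one 2) ▷ (((𝐈 ⊠ sw) ⊠ 𝐈) ▷ (one 2 ⊠ merge H)) =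
      (sw ⊠ 𝐈) ▷ ((𝐈 ⊠ cz) ▷ (sw ⊠ 𝐈)) := by
    have h1 : (one 2 ⊠ merge H) ▷ (sw ⊠ 𝐈) = ((sw ⊠ 𝐈) ⊠ 𝐈) ▷ (one 2 ⊠ merge H) := by
      rw [asc sw 𝐈 𝐈, one_tens_one, slide]
    have h2 : (sw ⊠ 𝐈) ▷ (sw ⊠ 𝐈) = one 3 := by rw [← tens_comp_one, sw_sw, one_tens_one]
    rw [e0, comp_assoc, h1, ← asc 𝐈 𝐂 𝐈, ← comp_assoc (sw ⊠ 𝐈),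
      ← tens_comp_one, sw_tens_C]
    simp only [tens_comp_one, comp_assoc]
    rw [← comp_assoc ((sw ⊠ 𝐈) ⊠ 𝐈) ((sw ⊠ 𝐈) ⊠ 𝐈), ← tens_comp_one, h2, one_tens_one, one_comp,
      asc 𝐂 𝐈 𝐈, one_tens_one]
  rw [e1, cxCopy, tens_comp_one, tens_comp_one, comp_assoc, comp_assoc,
    ← comp_assoc ((one 2 ⊠ R 2 1 0 0) ⊠ 𝐈), e2, comp_assoc, ← comp_assoc ((𝐈 ⊠ (sw ⊠ 𝐈)) ⊠ 𝐈), e3,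
    comp_assoc, ← comp_assoc ((𝐂 ⊠ 𝐂) ⊠ 𝐈), e4, comp_assoc, ← comp_assoc ((𝐈 ⊠ sw) ⊠ 𝐈),
    ← comp_assoc (𝐂 ⊠ one 2), e5, comp_assoc, comp_assoc]

theorem M_N : 𝐌 ▷ (H ▷ H) = ((H ▷ H) ⊠ (H ▷ H)) ▷ 𝐌 := by
  have h1 := congrArg (fun f => (H ⊠ H) ▷ (f ▷ H)) (R21'.symm.trans R21)
  simp only [comp_assoc, H'_H, comp_one] at h1
  rw [← comp_assoc (H ⊠ H) (H' ⊠ H'), interchange, H_H', one_tens_one, one_comp, ← comp_assoc,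
    interchange] at h1
  exact h1.symm

/-- HH negates the second coordinate, so ω^(xy) becomes ω^(-xy). -/
theorem cz_N : (𝐈 ⊠ (H ▷ H)) ▷ (cz ▷ (𝐈 ⊠ (H ▷ H))) = cz ^ 2 := by
  have h1 : merge H ▷ (H ▷ H) = (H' ⊠ (H ▷ H)) ▷ 𝐌 := by
    rw [merge, comp_assoc, M_N, ← comp_assoc, interchange, one_comp, H_H_H]
  have h2 : (𝐈 ⊠ (H ▷ H)) ▷ ((H' ⊠ (H ▷ H)) ▷ 𝐌) = merge H' := by
    rw [← comp_assoc, interchange, one_comp, merge, comp_assoc, H_H_H, H_H']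
  rw [← link_H', cz, link, comp_assoc, ← one_tens_comp, h1, ← comp_assoc, ← slide, comp_assoc,
    ← one_tens_one 1 1, asc 𝐈 𝐈 (H ▷ H), ← one_tens_comp, h2, link]

/-! ## Red phases -/

theorem rph_H (a b : ZMod 3) : rph a b ▷ H = H ▷ ph b a := by
  rw [rph_eq', comp_assoc, comp_assoc, H'_H, comp_one]

theorem H_rph (a b : ZMod 3) : H ▷ rph a b = ph a b ▷ H := by
  rw [rph_eq, H_H_comp]

/-- The copying rule sends the shift through the green node onto the link, where the H node turns it
into a green phase that fuses into the other wire. -/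
theorem rph_cz : (rph 1 2 ⊠ 𝐈) ▷ cz = cz ▷ (rph 1 2 ⊠ ph 2 1) := by
  have h : rph 1 2 ▷ 𝐂 = 𝐂 ▷ (rph 1 2 ⊠ rph 1 2) := by
    rw [rph, ← copies_two]; exact mk_eq (Equal.K1_12 2)
  have h2 : (rph 1 2 ⊠ (rph 1 2 ⊠ 𝐈)) ▷ (𝐈 ⊠ merge H) = (𝐈 ⊠ merge H) ▷ (rph 1 2 ⊠ ph 2 1) := by
    have : (rph 1 2 ⊠ 𝐈) ▷ merge H = merge H ▷ ph 2 1 := by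
      rw [merge, ← comp_assoc, ← tens_comp_one, rph_H]; exact merge_comp_phase _ _ _
    rw [interchange, interchange, comp_one, one_comp, this]
  rw [cz, link, ← comp_assoc, ← tens_comp_one, h, tens_comp_one, comp_assoc, asc (rph 1 2) (rph 1 2) 𝐈,
    h2, comp_assoc]

theorem rph_ph (a b : ZMod 3) : rph 1 2 ▷ ph a b = ph (-b) (a - b) ▷ rph 1 2 := by
  have h : ∀ c, ang (-c) = -ang c := fun c => by
    rw [eq_neg_iff_add_eq_zero, ang_add, neg_add_cancel, ang_zero]
  have h2 : ang a - ang b = ang (a - b) := by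
    rw [sub_eq_add_neg, sub_eq_add_neg, ← h, ang_add]
  have := mk_eq (Equal.K2_12 (ang a) (ang b))
  rw [← h, h2] at this
  exact this

/-! ## States and effects -/

/-- The states `|+⟩` and `|0⟩` and the effect `⟨+|`. -/
def plus1 : Mor 0 1 := Z 0 1 0 0

def zero1 : Mor 0 1 := plus1 ▷ H

def eff1 : Mor 1 0 := Z 1 0 0 0

theorem plus_H : plus1 ▷ H = zero1 := rfl

theorem zero_H' : zero1 ▷ H' = plus1 := by rw [zero1, comp_assoc, H_H', comp_one]

theorem plus_H_H : plus1 ▷ (H ▷ H) = plus1 := state_N _ _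

theorem zero_phase' (a b : ZMod 3) : zero1 ▷ ph a b = zero1 := by
  rw [zero1, plus1, ← R01]; exact zero_phase _ _

theorem plus_rph (a b : ZMod 3) : plus1 ▷ rph a b = plus1 := plus_R _ _

theorem H_H_effect : H ▷ (H ▷ eff1) = eff1 := by
  rw [eff1, ← H'_effect, H_H_comp]

theorem zero_cap : (𝐈 ⊠ zero1) ▷ Z 2 0 0 0 = H ▷ eff1 := by
  rw [zero1, plus1, ← R01, R10_eq_cap, R10']; rfl

theorem phase_zero_effect (a b : ZMod 3) : ph a b ▷ (H ▷ eff1) = H ▷ eff1 := by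
  have h : (ph a b ⊠ 𝐈) ▷ Z 2 0 0 0 = (𝐈 ⊠ ph a b) ▷ Z 2 0 0 0 := by
    have h1 := Z_one_tens_comp (n := 1) (k := 1) (m := 0) 1 one_pos 0 0 (ang a) (ang b)
    have h2 := Z_tens_one_comp (n := 1) (k := 1) (m' := 0) 1 one_pos 0 0 (ang a) (ang b)
    exact h1.trans h2.symm
  have h3 := slide (ph a b) zero1
  rw [tens_one_zero] at h3
  rw [← zero_cap, ← comp_assoc, h3, comp_assoc, h, ← comp_assoc, ← one_tens_comp, zero_phase']

theorem rph_effect (a b : ZMod 3) : rph a b ▷ eff1 = eff1 := by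
  rw [rph_eq, comp_assoc, comp_assoc, phase_zero_effect, H'_H_comp]

theorem state_link (s : Mor 0 1) (f : Mor 2 1) :
    (𝐈 ⊠ s) ▷ ((𝐂 ⊠ 𝐈) ▷ (𝐈 ⊠ f)) = 𝐂 ▷ (𝐈 ⊠ ((𝐈 ⊠ s) ▷ f)) := by
  have h2 : (𝐈 ⊠ s) ▷ (𝐂 ⊠ 𝐈) = 𝐂 ▷ (𝐈 ⊠ (𝐈 ⊠ s)) := by
    rw [← slide, tens_one_zero, ← asc 𝐈 𝐈 s, one_tens_one]
  rw [← comp_assoc, h2, comp_assoc, ← one_tens_comp]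

theorem state_tens (s : Mor 0 1) (f : Mor 1 1) : (𝐈 ⊠ s) ▷ (f ⊠ 𝐈) = f ▷ (𝐈 ⊠ s) := by
  rw [← slide, tens_one_zero]

theorem zero_M : (𝐈 ⊠ zero1) ▷ 𝐌 = (H ▷ eff1) ⊠ zero1 := by
  have h1 : zero1 ▷ 𝐂 = zero1 ⊠ zero1 := by
    rw [zero1, plus1, ← R01]; exact copy_zero
  rw [← M_eq_cap', ← comp_assoc, ← one_tens_comp, h1, ← asc 𝐈 zero1 zero1, interchange, zero_cap,
    comp_one]

theorem zero_merge : (𝐈 ⊠ zero1) ▷ merge H = eff1 ⊠ zero1 := by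
  have h := tens_comp_one 0 H (H ▷ eff1)
  rw [merge, ← comp_assoc, state_tens, comp_assoc, zero_M]
  have h2 := interchange H (H ▷ eff1) (one 0) zero1
  rw [tens_one_zero, one_comp, H_H_effect] at h2
  exact h2

theorem C_effect_tens (s : Mor 0 1) : 𝐂 ▷ (𝐈 ⊠ (eff1 ⊠ s)) = 𝐈 ⊠ s := by
  have h := interchange 𝐂 (𝐈 ⊠ eff1) (one 0) s
  rw [tens_one_zero, one_comp, eff1, C_effect_right, Z_one] at h
  rw [← asc 𝐈 eff1 s]
  exact h

theorem zero_cz : (𝐈 ⊠ zero1) ▷ cz = 𝐈 ⊠ zero1 := by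
  rw [cz, link, state_link, zero_merge, C_effect_tens]

theorem plus_cx : (𝐈 ⊠ plus1) ▷ cx = 𝐈 ⊠ plus1 := by
  have h := interchange eff1 (one 0) zero1 H'
  rw [zero_H', comp_one, eq_of_heq (one_zero_tens_heq H')] at h
  rw [cx, state_link, R21_eq_merge, ← comp_assoc, ← comp_assoc, ← one_tens_comp, plus_H, zero_merge,
    h, C_effect_tens]

theorem plus_cz : (𝐈 ⊠ plus1) ▷ cz = 𝐂 ▷ (𝐈 ⊠ H) := plus_link H

theorem plus_cz_sq : (𝐈 ⊠ plus1) ▷ cz ^ 2 = 𝐂 ▷ (𝐈 ⊠ H') := by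
  rw [← link_H']; exact plus_link H'

theorem zero_effect : zero1 ▷ eff1 = one 0 := by
  rw [zero1, plus1, ← R01]
  refine scalar_eq_one (seq (xsp 0 1 0 0) (zsp 1 0 0 0)) fun h => ?_
  have h1 := congrFun (congrFun h default) default
  rw [isGraph_xsp_zero.seq (isGraph_zsp 0 0 0), if_pos (Subsingleton.elim _ _)] at h1
  simp [weight] at h1

/-- Two wires in the state `|+⟩`. -/
def plus2 : Mor 0 2 := plus1 ⊠ plus1

theorem plus2_comp {m : ℕ} {f : Mor 2 m} {g : Mor 1 m} (h : (𝐈 ⊠ plus1) ▷ f = g) :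
    plus2 ▷ f = plus1 ▷ g := by
  have h1 := tens_eq plus1 plus1
  rw [tens_one_zero] at h1
  rw [plus2, h1, comp_assoc, h]

theorem plus_C : plus1 ▷ 𝐂 = Z 0 2 0 0 := by
  rw [plus1, Z_comp one_pos, add_zero]

theorem cup_H' : Z 0 2 0 0 ▷ (H' ⊠ 𝐈) = Z 0 2 0 0 ▷ (𝐈 ⊠ H') := by
  have h := congrArg (fun f => f ▷ (H' ⊠ H')) cup_H
  simp only [comp_assoc, interchange, H_H', one_comp] at h
  exact h.symm

/-- Linking two |+⟩ states gives a cup with an H on one leg. Since H slides around the cup, H† on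
either leg cancels it; pivoting rests on this. -/
theorem bell_H' : plus2 ▷ (cz ▷ (𝐈 ⊠ H')) = plus2 ▷ (cz ▷ (H' ⊠ 𝐈)) := by
  rw [← comp_assoc, ← comp_assoc, plus2_comp plus_cz, ← comp_assoc, plus_C, comp_assoc, ← one_tens_comp,
    ← cup_H, comp_assoc, ← tens_comp_one, H_H']

theorem bell_sq_H' : plus2 ▷ (cz ^ 2 ▷ (𝐈 ⊠ H')) = plus2 ▷ (cz ^ 2 ▷ (H' ⊠ 𝐈)) := by
  rw [← comp_assoc, ← comp_assoc, plus2_comp plus_cz_sq, ← comp_assoc, plus_C, ← cup_H', comp_assoc,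
    slide, ← comp_assoc, cup_H']

theorem plus2_cx : plus2 ▷ cx = plus2 := by
  have h1 := tens_eq plus1 plus1
  rw [tens_one_zero] at h1
  rw [plus2_comp plus_cx, plus2, h1]

theorem C_phase_effect (a b : ZMod 3) : 𝐂 ▷ ((ph a b ▷ eff1) ⊠ 𝐈) = ph a b := by
  rw [tens_comp_one, ← comp_assoc, phase_C', comp_assoc, eff1, C_effect_left, Z_one, comp_one]

theorem C_gate_effect (A : Mor 1 1) (a b : ZMod 3) :
    𝐂 ▷ ((𝐈 ⊠ A) ▷ ((ph a b ▷ eff1) ⊠ 𝐈)) = ph a b ▷ A := by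
  rw [← slide, eq_of_heq (one_zero_tens_heq A), ← comp_assoc, C_phase_effect]

theorem plus2_cz_effect (a b : ZMod 3) :
    plus2 ▷ (cz ▷ ((ph a b ▷ eff1) ⊠ 𝐈)) = plus1 ▷ (ph a b ▷ H) := by
  rw [← comp_assoc, plus2_comp plus_cz, comp_assoc, comp_assoc, C_gate_effect]

theorem plus2_cz_sq_effect (a b : ZMod 3) :
    plus2 ▷ (cz ^ 2 ▷ ((ph a b ▷ eff1) ⊠ 𝐈)) = plus1 ▷ (ph a b ▷ H') := by
  rw [← comp_assoc, plus2_comp plus_cz_sq, comp_assoc, comp_assoc, C_gate_effect]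

theorem plus_phase_H' (a b : ZMod 3) : plus1 ▷ (ph a b ▷ H') = plus1 ▷ (ph b a ▷ H) := by
  rw [← comp_assoc, ← comp_assoc, plus1, ← state_eq, ← state_eq, state_H']

/-! ## Spiders from gates -/

/-- Together with `M_eq_gates` and `H_eq_gates` this reduces the generators to |+⟩, `cz`, ⟨+| and
the identity; H itself is obtained by teleportation through a fresh wire. -/
theorem C_eq_gates : 𝐂 = (𝐈 ⊠ plus1) ▷ (cz ▷ (𝐈 ⊠ H')) := by
  rw [← comp_assoc, plus_cz, comp_assoc, ← one_tens_comp, H_H', one_tens_one]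
  exact (comp_one _).symm

theorem M_eq_gates : 𝐌 = (H' ⊠ 𝐈) ▷ (cz ▷ (eff1 ⊠ 𝐈)) := by
  have h := link_effect H 0 0
  rw [ph_zero, one_comp, ang_zero, merge] at h
  rw [eff1, cz, h, ← comp_assoc, ← tens_comp_one, H'_H, one_tens_one]
  exact (one_comp _).symm

theorem H_eq_gates : H = (𝐈 ⊠ plus1) ▷ (cz ▷ (eff1 ⊠ 𝐈)) := by
  rw [← comp_assoc, plus_cz, comp_assoc, ← slide, eq_of_heq (one_zero_tens_heq H), ← comp_assoc,
    eff1, C_effect_left, Z_one, one_comp]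

end Links
end Mor
end QutritZX
end

/-! ### The Clifford gates on n wires and their basic relations -/

noncomputable section
namespace QutritZX
open Diag
namespace Mor

section Gates

local notation "𝐈" => one 1

/-! ## Gates on `n` wires -/

variable {n : ℕ}

theorem pair_injective {i j : Fin n} (h : i ≠ j) : Function.Injective ![i, j] := by
  intro a b hab
  fin_cases a <;> fin_cases b <;> simp_all

theorem triple_injective {i j k : Fin n} (hij : i ≠ j) (hik : i ≠ k) (hjk : j ≠ k) :
    Function.Injective ![i, j, k] := by
  intro a b hab
  fin_cases a <;> fin_cases b <;> simp_all

theorem gate_left (A : Mor 1 1) {i j : Fin n} (h : i ≠ j) :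
    gate (A ⊠ 𝐈) ![i, j] = gate A ![i] := by
  rw [← gate_castAdd]
  refine (gate_gate A (Fin.castAdd 1) ![i, j] (pair_injective h)).trans ?_
  congr 1; ext a; fin_cases a; rfl

theorem gate_right (A : Mor 1 1) {i j : Fin n} (h : i ≠ j) :
    gate (𝐈 ⊠ A) ![i, j] = gate A ![j] := by
  rw [← gate_natAdd]
  refine (gate_gate A (Fin.natAdd 1) ![i, j] (pair_injective h)).trans ?_
  congr 1; ext a; fin_cases a; rfl

theorem gate_triple_left (A : Mor 2 2) {i j k : Fin n} (hij : i ≠ j) (hik : i ≠ k) (hjk : j ≠ k) :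
    gate (A ⊠ 𝐈) ![i, j, k] = gate A ![i, j] := by
  rw [← gate_castAdd]
  refine (gate_gate A (Fin.castAdd 1) ![i, j, k] (triple_injective hij hik hjk)).trans ?_
  congr 1; ext a; fin_cases a <;> rfl

theorem gate_triple_right (A : Mor 2 2) {i j k : Fin n} (hij : i ≠ j) (hik : i ≠ k) (hjk : j ≠ k) :
    gate (𝐈 ⊠ A) ![i, j, k] = gate A ![j, k] := by
  rw [← gate_natAdd]
  refine (gate_gate A (Fin.natAdd 1) ![i, j, k] (triple_injective hij hik hjk)).trans ?_
  congr 1; ext a; fin_cases a <;> rfl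

theorem gate_triple_outer (A : Mor 2 2) {i j k : Fin n} (hij : i ≠ j) (hik : i ≠ k) (hjk : j ≠ k) :
    gate ((sw ⊠ 𝐈) ▷ ((𝐈 ⊠ A) ▷ (sw ⊠ 𝐈))) ![i, j, k] = gate A ![i, k] := by
  have h1 : (sw ⊠ 𝐈) = perm (Equiv.swap (0 : Fin 3) 1) := by
    rw [← perm_refl, show sw = perm (Equiv.swap 0 1) from rfl, perm_tens]
    congr 1; ext i; fin_cases i <;> rfl
  have h2 : (𝐈 ⊠ A) ▷ (sw ⊠ 𝐈) = (sw ⊠ 𝐈) ▷ gate A ![(0 : Fin 3), 2] := by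
    rw [← gate_natAdd 1 A, h1]
    refine (gate_perm A (Fin.natAdd 1) (Equiv.swap (0 : Fin 3) 1)).trans ?_
    congr 2; ext a; fin_cases a <;> rfl
  have h3 : (sw ⊠ 𝐈) ▷ (sw ⊠ 𝐈) = one 3 := by rw [← tens_comp_one, sw_sw, one_tens_one]
  rw [h2, ← comp_assoc, h3, one_comp]
  refine (gate_gate A ![(0 : Fin 3), 2] ![i, j, k] (triple_injective hij hik hjk)).trans ?_
  congr 1; ext a; fin_cases a <;> rfl

/-- The gates used for stabilizer states. -/
def S (i : Fin n) : Mor n n := gate (ph 1 1) ![i]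
def Zp (i : Fin n) : Mor n n := gate (ph 1 2) ![i]
def X (i : Fin n) : Mor n n := gate (rph 1 2) ![i]
def Hd (i : Fin n) : Mor n n := gate H ![i]
def Hi (i : Fin n) : Mor n n := gate H' ![i]
def CZ (i j : Fin n) : Mor n n := gate cz ![i, j]
def CX (i j : Fin n) : Mor n n := gate cx ![i, j]

theorem gate_mul {a : ℕ} (A B : Mor a a) (p : Fin a → Fin n) :
    gate A p * gate B p = gate (A ▷ B) p := (gate_comp A B p).symm

theorem ph_pow_three (a b : ZMod 3) : ph a b ^ 3 = 1 := by
  rw [pow_three, mul_def, mul_def, ph_comp, ph_comp]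
  have : ∀ a : ZMod 3, a + (a + a) = 0 := by decide
  rw [this, this]; exact ph_zero

theorem rph_pow_three (a b : ZMod 3) : rph a b ^ 3 = 1 := by
  rw [pow_three, mul_def, mul_def, rph_comp, rph_comp]
  have : ∀ a : ZMod 3, a + (a + a) = 0 := by decide
  rw [this, this]; exact rph_zero

theorem S_three (i : Fin n) : S i ^ 3 = 1 := by
  have := congrArg (gateHom ![i]) (ph_pow_three 1 1)
  rwa [map_pow, map_one] at this

theorem Zp_three (i : Fin n) : Zp i ^ 3 = 1 := by
  have := congrArg (gateHom ![i]) (ph_pow_three 1 2)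
  rwa [map_pow, map_one] at this

theorem X_three (i : Fin n) : X i ^ 3 = 1 := by
  have := congrArg (gateHom ![i]) (rph_pow_three 1 2)
  rwa [map_pow, map_one] at this

theorem CZ_three (i j : Fin n) : CZ i j ^ 3 = 1 := by
  have := congrArg (gateHom ![i, j]) cz_three
  rwa [map_pow, map_one] at this

theorem Hd_Hi (i : Fin n) : Hd i * Hi i = 1 := by
  rw [Hd, Hi, gate_mul, H_H', gate_one]; rfl

theorem Hi_Hd (i : Fin n) : Hi i * Hd i = 1 := by
  rw [Hd, Hi, gate_mul, H'_H, gate_one]; rfl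

/-- The default value of `gate` on a repeated wire. It makes `CZ i i` and `CX i i` trivial, so many
later statements need no distinctness assumption. -/
theorem gate_self (A : Mor 2 2) (i : Fin n) : gate A ![i, i] = 1 := by
  rw [gate, dif_neg]; · rfl
  intro h
  have := @h 0 1 rfl
  simp at this

theorem CZ_self (i : Fin n) : CZ i i = 1 := gate_self _ _

theorem CX_self (i : Fin n) : CX i i = 1 := gate_self _ _

theorem CZ_symm (i j : Fin n) : CZ i j = CZ j i := by
  by_cases h : i = j
  · rw [h]
  have h1 : gate cz ![(1 : Fin 2), 0] = cz := by
    have h2 := gate_perm cz id (Equiv.swap (0 : Fin 2) 1)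
    rw [gate_id] at h2
    have h3 := congrArg (fun f => sw ▷ f) h2
    have h4 : sw ▷ (cz ▷ sw) = cz := by rw [← comp_assoc, sw_cz_sw]
    have h5 : sw ▷ (sw ▷ gate cz (Equiv.swap (0 : Fin 2) 1 ∘ id)) = cz := h3.symm.trans h4
    rw [← comp_assoc, sw_sw, one_comp] at h5
    rw [← h5]
    congr 1; ext a; fin_cases a <;> rfl
  rw [CZ, CZ]
  nth_rw 1 [← h1]
  refine (gate_gate cz ![(1 : Fin 2), 0] ![i, j] (pair_injective h)).trans ?_
  congr 1; ext a; fin_cases a <;> rfl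

/-! ### Commuting gates -/

theorem gate1_commute (A B : Mor 1 1) {i j : Fin n} (h : i ≠ j) :
    Commute (gate A ![i]) (gate B ![j]) :=
  gate_commute _ _ _ _ fun a b => by fin_cases a; fin_cases b; exact h

theorem gate12_commute (A : Mor 1 1) (B : Mor 2 2) {i j k : Fin n} (h : i ≠ j) (h' : i ≠ k) :
    Commute (gate A ![i]) (gate B ![j, k]) :=
  gate_commute _ _ _ _ fun a b => by
    fin_cases a; fin_cases b
    · exact h
    · exact h'

theorem gate2_commute (A B : Mor 2 2) {i j k l : Fin n} (h1 : i ≠ k) (h2 : i ≠ l) (h3 : j ≠ k)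
    (h4 : j ≠ l) : Commute (gate A ![i, j]) (gate B ![k, l]) :=
  gate_commute _ _ _ _ fun a b => by
    fin_cases a <;> fin_cases b
    exacts [h1, h2, h3, h4]

theorem ph_commute (a b c d : ZMod 3) (i j : Fin n) :
    Commute (gate (ph a b) ![i]) (gate (ph c d) ![j]) := by
  by_cases h : i = j
  · subst h
    rw [commute_iff_eq, gate_mul, gate_mul, ph_comp, ph_comp, add_comm a, add_comm b]
  · exact gate1_commute _ _ h

theorem ph_CZ_commute (a b : ZMod 3) (i j k : Fin n) :
    Commute (gate (ph a b) ![i]) (CZ j k) := by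
  by_cases hjk : j = k
  · rw [hjk, CZ_self]; exact Commute.one_right _
  by_cases hij : i = j
  · subst hij
    rw [← gate_left _ hjk, CZ, commute_iff_eq, gate_mul, gate_mul, cz, phase_left_link]
  by_cases hik : i = k
  · subst hik
    rw [← gate_right _ hjk, CZ, commute_iff_eq, gate_mul, gate_mul, cz, phase_right_link]
  · exact gate12_commute _ _ hij hik

theorem CZ_CZ_commute_path {i j k : Fin n} (hij : i ≠ j) (hik : i ≠ k) (hjk : j ≠ k) :
    Commute (CZ i j) (CZ j k) := by
  rw [CZ, CZ, ← gate_triple_left _ hij hik hjk, ← gate_triple_right _ hij hik hjk, commute_iff_eq,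
    gate_mul, gate_mul, cz]
  congr 1
  exact link_comm H H

theorem CZ_CZ_commute (i j k l : Fin n) : Commute (CZ i j) (CZ k l) := by
  -- By symmetry of `CZ`, any shared wire can be brought into the middle of a path.
  have key : ∀ i j k : Fin n, Commute (CZ i j) (CZ j k) := fun i j k => by
    by_cases hij : i = j
    · rw [hij, CZ_self]; exact Commute.one_left _
    by_cases hjk : j = k
    · rw [hjk, CZ_self]; exact Commute.one_right _
    by_cases hik : i = k
    · rw [hik, CZ_symm]
    exact CZ_CZ_commute_path hij hik hjk
  by_cases h1 : j = k
  · rw [h1]; exact key _ _ _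
  by_cases h2 : j = l
  · rw [h2, CZ_symm k]; exact key _ _ _
  by_cases h3 : i = k
  · rw [h3, CZ_symm k j]; exact key _ _ _
  by_cases h4 : i = l
  · rw [h4, CZ_symm l j, CZ_symm k]; exact key _ _ _
  exact gate2_commute _ _ h3 h4 h1 h2

/-! ### Relations between the gates -/

theorem CX_eq (i j : Fin n) : CX i j = Hd j * CZ i j * Hi j := by
  by_cases h : i = j
  · rw [h, CX_self, CZ_self, mul_one, Hd_Hi]
  · rw [CX, CZ, Hd, Hi, ← gate_right H h, ← gate_right H' h, gate_mul, gate_mul, cx_eq, comp_assoc]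

/-- The expansion (x + y)² = x² + y² + 2xy, with `S` standing for ω^(x²) and `CZ` for ω^(xy). -/
theorem CX_S {i j : Fin n} (h : i ≠ j) : CX i j * S j = S i * S j * CZ i j ^ 2 * CX i j := by
  have h1 : CZ i j ^ 2 = gate (link H') ![i, j] := by
    rw [link_H']; exact (map_pow (gateHom ![i, j]) cz 2).symm
  rw [h1, CX, S, S, ← gate_right _ h, ← gate_left _ h, gate_mul, gate_mul, gate_mul, gate_mul, cx_one,
    tens_eq, comp_assoc, comp_assoc, comp_assoc]

theorem CX_CZ_path {i j k : Fin n} (hij : i ≠ j) (hik : i ≠ k) (hjk : j ≠ k) :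
    CX i j * CZ j k = CZ j k * CZ i k * CX i j := by
  have h : (cx ⊠ 𝐈) ▷ (𝐈 ⊠ cz) =
      ((𝐈 ⊠ cz) ▷ ((sw ⊠ 𝐈) ▷ ((𝐈 ⊠ cz) ▷ (sw ⊠ 𝐈)))) ▷ (cx ⊠ 𝐈) := by
    rw [cx_cz]; simp only [comp_assoc]
  rw [CX, CZ, CZ, ← gate_triple_left _ hij hik hjk, ← gate_triple_right _ hij hik hjk,
    ← gate_triple_outer _ hij hik hjk, gate_mul, gate_mul, gate_mul, ← h]

theorem ph_two_one : ph 2 1 = ph 1 2 ▷ ph 1 2 := by rw [ph_comp]; rfl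

theorem X_CZ {i j : Fin n} (h : i ≠ j) : X i * CZ i j = CZ i j * Zp j ^ 2 * X i := by
  have h2 : rph 1 2 ⊠ ph 2 1 = (𝐈 ⊠ (ph 1 2 ▷ ph 1 2)) ▷ (rph 1 2 ⊠ 𝐈) := by
    rw [← ph_two_one]; exact tens_eq' _ _
  rw [pow_two, X, CZ, Zp, gate_mul, ← gate_left _ h, ← gate_right _ h, gate_mul, gate_mul, gate_mul,
    rph_cz, h2, comp_assoc]

theorem X_S (i : Fin n) : X i * S i = S i * Zp i * X i := by
  rw [X, S, Zp, gate_mul, gate_mul, gate_mul, rph_ph, ph_comp]; rfl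

theorem X_Zp (i : Fin n) : Commute (X i) (Zp i) := by
  rw [commute_iff_eq, X, Zp, gate_mul, gate_mul, rph_ph]; rfl

theorem X_Hd (i : Fin n) : X i * Hd i = Hd i * Zp i ^ 2 := by
  rw [pow_two, X, Zp, Hd, gate_mul, gate_mul, gate_mul, rph_H, ph_two_one]

theorem Hd_X (i : Fin n) : Hd i * X i = Zp i * Hd i := by
  rw [X, Zp, Hd, gate_mul, gate_mul, H_rph]

theorem N_CZ_N {i j : Fin n} (h : i ≠ j) :
    Hd j * Hd j * CZ i j * (Hd j * Hd j) = CZ i j ^ 2 := by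
  have h1 : CZ i j ^ 2 = gate (cz ^ 2) ![i, j] := (map_pow (gateHom ![i, j]) cz 2).symm
  rw [h1, ← cz_N, Hd, CZ, gate_mul, ← gate_right _ h, gate_mul, gate_mul, comp_assoc]

theorem N_N (i : Fin n) : Hd i * Hd i * (Hd i * Hd i) = 1 := by
  rw [Hd, gate_mul, gate_mul, ← comp_assoc, H_four, gate_one]; rfl

theorem N_S (i : Fin n) : Commute (Hd i * Hd i) (S i) := by
  rw [commute_iff_eq, Hd, S, gate_mul, gate_mul, gate_mul, ph_N]

theorem Hi_eq (i : Fin n) : Hi i = Hd i * (Hd i * Hd i) := by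
  rw [Hi, Hd, gate_mul, gate_mul, H_H_H]

end Gates
end Mor
end QutritZX
end

/-! ### Conjugation relations, and the product state |+⟩…|+⟩ -/

noncomputable section
namespace QutritZX
open Diag
namespace Mor

section Relations

variable {n : ℕ}

theorem semiconj_inv {M : Type*} [Monoid M] {a b x y : M} (hab : a * b = 1) (hba : b * a = 1)
    (h : SemiconjBy a x y) : SemiconjBy b y x := by
  rw [SemiconjBy]
  calc b * y = b * (y * a) * b := by rw [mul_assoc, mul_assoc, hab, mul_one]
    _ = x * b := by rw [← h.eq, ← mul_assoc, hba, one_mul]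

theorem Hd_Zp (i : Fin n) : SemiconjBy (Hd i) (Zp i) (X i ^ 2) := by
  have h : SemiconjBy (Hd i) (Zp i ^ 2) (X i) := (X_Hd i).symm
  have h2 := h.pow_right 2
  rwa [← pow_mul, show 2 * 2 = 3 + 1 from rfl, pow_succ, Zp_three, one_mul] at h2

theorem Hi_X (i : Fin n) : SemiconjBy (Hi i) (X i) (Zp i ^ 2) :=
  semiconj_inv (Hd_Hi i) (Hi_Hd i) (X_Hd i).symm

theorem Hi_Zp (i : Fin n) : SemiconjBy (Hi i) (Zp i) (X i) :=
  semiconj_inv (Hd_Hi i) (Hi_Hd i) (Hd_X i)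

theorem S_CZ (i j k : Fin n) : Commute (S i) (CZ j k) := ph_CZ_commute _ _ _ _ _
theorem Zp_CZ (i j k : Fin n) : Commute (Zp i) (CZ j k) := ph_CZ_commute _ _ _ _ _
theorem S_S (i j : Fin n) : Commute (S i) (S j) := ph_commute _ _ _ _ _ _
theorem S_Zp (i j : Fin n) : Commute (S i) (Zp j) := ph_commute _ _ _ _ _ _
theorem Zp_Zp (i j : Fin n) : Commute (Zp i) (Zp j) := ph_commute _ _ _ _ _ _

theorem CZ_X {i j : Fin n} (h : i ≠ j) : SemiconjBy (CZ i j) (X i) (Zp j * X i) := by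
  rw [SemiconjBy, mul_assoc, X_CZ h, ← mul_assoc, ← mul_assoc, (Zp_CZ j i j).eq, mul_assoc (CZ i j),
    ← pow_succ', Zp_three, mul_one]

theorem CZ_X' {i j : Fin n} (h : i ≠ j) : SemiconjBy (CZ i j) (X j) (Zp i * X j) := by
  rw [CZ_symm]; exact CZ_X h.symm

theorem Hd_CZ (i j : Fin n) : SemiconjBy (Hd j) (CZ i j) (CX i j) := by
  rw [SemiconjBy, CX_eq, mul_assoc _ (Hi j), Hi_Hd, mul_one]

theorem CX_three (i j : Fin n) : CX i j ^ 3 = 1 := by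
  have h := (Hd_CZ i j).pow_right 3
  rw [CZ_three, SemiconjBy, mul_one] at h
  rw [← mul_one (CX i j ^ 3), ← Hd_Hi j, ← mul_assoc, ← h]

theorem CX_Zp {i j : Fin n} (h : i ≠ j) : SemiconjBy (CX i j) (Zp j) (Zp i * Zp j) := by
  have h1 : SemiconjBy (Hd j) (Zp i * X j) (Zp i * Zp j) :=
    SemiconjBy.mul_right (gate1_commute _ _ h.symm) (Hd_X j)
  rw [CX_eq]
  exact (h1.mul_left (CZ_X' h)).mul_left (Hi_Zp j)

theorem CX_X_target (i j : Fin n) : Commute (CX i j) (X j) := by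
  have h1 : SemiconjBy (Hd j) (Zp j ^ 2) (X j) := (X_Hd j).symm
  rw [CX_eq]
  exact (h1.mul_left ((Zp_CZ j i j).symm.pow_right 2)).mul_left (Hi_X j)

theorem CX_X_control {i j : Fin n} (h : i ≠ j) : SemiconjBy (CX i j) (X i) (X j ^ 2 * X i) := by
  have h1 : SemiconjBy (Hi j) (X i) (X i) := gate1_commute _ _ h.symm
  have h2 : SemiconjBy (Hd j) (X i) (X i) := gate1_commute _ _ h.symm
  rw [CX_eq]
  exact (((Hd_Zp j).mul_right h2).mul_left (CZ_X h)).mul_left h1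

theorem CX_S_control {i j : Fin n} (h : i ≠ j) : Commute (CX i j) (S i) := by
  rw [CX_eq]
  exact (((gate1_commute _ _ h.symm).mul_left (S_CZ i i j).symm)).mul_left (gate1_commute _ _ h.symm)

theorem CX_Zp_control {i j : Fin n} (h : i ≠ j) : Commute (CX i j) (Zp i) := by
  rw [CX_eq]
  exact (((gate1_commute _ _ h.symm).mul_left (Zp_CZ i i j).symm)).mul_left (gate1_commute _ _ h.symm)

theorem CX_CZ_control {i j k : Fin n} (hij : i ≠ j) (hjk : j ≠ k) :
    Commute (CX i j) (CZ i k) := by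
  rw [CX_eq]
  exact (((gate12_commute _ _ hij.symm hjk).mul_left (CZ_CZ_commute _ _ _ _))).mul_left
    (gate12_commute _ _ hij.symm hjk)

theorem CX_CX_control {i j k : Fin n} (hij : i ≠ j) (hik : i ≠ k) (hjk : j ≠ k) :
    Commute (CX i j) (CX i k) := by
  rw [CX_eq i k]
  exact (((gate12_commute _ _ hik.symm hjk.symm).symm.mul_right (CX_CZ_control hij hjk))).mul_right
    (gate12_commute _ _ hik.symm hjk.symm).symm

/-- Conjugation by the Hadamard node on the target carries `CZ i j` to `CX i j` and `a` to `b`,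
hence preserves commutation. -/
theorem conj_Hd {i j : Fin n} {a : Mor n n} {b : Mor n n} (h : Commute (CZ i j) a)
    (ha : SemiconjBy (Hd j) a b) : Commute (CX i j) b := by
  rw [CX_eq]
  exact (ha.mul_left h).mul_left (semiconj_inv (Hd_Hi j) (Hi_Hd j) ha)

theorem CX_CX_target (i j k : Fin n) : Commute (CX i k) (CX j k) :=
  conj_Hd (CZ_CZ_commute _ _ _ _) (Hd_CZ j k)

theorem CX_CZ_next {i j k : Fin n} (hij : i ≠ j) (hik : i ≠ k) (hjk : j ≠ k) :
    SemiconjBy (CX i j) (CZ j k) (CZ j k * CZ i k) := CX_CZ_path hij hik hjk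

theorem CX_CX_next {i j k : Fin n} (hij : i ≠ j) (hik : i ≠ k) (hjk : j ≠ k) :
    SemiconjBy (CX i j) (CX j k) (CX j k * CX i k) := by
  have h1 : Commute (CX i j) (Hd k) := (gate12_commute _ _ hik.symm hjk.symm).symm
  have h2 : Commute (CX i j) (Hi k) := (gate12_commute _ _ hik.symm hjk.symm).symm
  have h3 : CX j k * CX i k = Hd k * (CZ j k * CZ i k) * Hi k := by
    rw [CX_eq, CX_eq, mul_assoc (Hd k * CZ j k), ← mul_assoc (Hi k), ← mul_assoc (Hi k), Hi_Hd, one_mul]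
    simp only [mul_assoc]
  rw [h3, CX_eq j k]
  exact (SemiconjBy.mul_right h1 (CX_CZ_next hij hik hjk)).mul_right h2

theorem N_CX_N {i j : Fin n} (h : i ≠ j) :
    Hd j * Hd j * CX i j * (Hd j * Hd j) = CX i j ^ 2 := by
  have h1 := (Hd_CZ i j).pow_right 2
  have h2 : Commute (Hi j) (Hd j * Hd j) := by
    rw [Hi_eq, commute_iff_eq]; simp only [mul_assoc]
  calc Hd j * Hd j * CX i j * (Hd j * Hd j)
      = Hd j * (Hd j * Hd j * CZ i j) * (Hi j * (Hd j * Hd j)) := by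
        rw [CX_eq]; simp only [mul_assoc]
    _ = Hd j * (Hd j * Hd j * CZ i j * (Hd j * Hd j)) * Hi j := by rw [h2.eq]; simp only [mul_assoc]
    _ = CX i j ^ 2 := by rw [N_CZ_N h, h1.eq, mul_assoc, Hd_Hi, mul_one]

/-- The cancellation behind `CX_CZ_same`, where s, t, z, c are `S i`, `S j`, `CZ i j`, `CX i j`;
elements of order dividing three are units. -/
theorem cancel_phases {M : Type*} [Monoid M] {s t z c : M} (hst : Commute s t) (hsz : Commute s z)
    (hs : s ^ 3 = 1) (ht : t ^ 3 = 1) (hz : z ^ 3 = 1) (hc : c ^ 3 = 1)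
    (h : s * t * z * c ^ 2 = s * (s * t * z ^ 2) * (c * z ^ 2 * c)) :
    SemiconjBy c (z ^ 2) (s ^ 2 * z ^ 2) := by
  have unit : ∀ {x : M}, x ^ 3 = 1 → IsUnit x := fun hx => IsUnit.of_pow_eq_one hx three_ne_zero
  have e1 : z ^ 2 * (s ^ 2 * z ^ 2) = s ^ 2 * z := by
    rw [← mul_assoc, (hsz.pow_pow 2 2).symm.eq, mul_assoc, ← pow_add, show 2 + 2 = 3 + 1 from rfl,
      pow_add, hz, one_mul, pow_one]
  have e2 : s * (s * t * z ^ 2) * (s ^ 2 * z ^ 2) = s * t * z := by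
    rw [mul_assoc, mul_assoc, e1, mul_assoc, ← mul_assoc t, ← (hst.pow_left 2).eq, mul_assoc,
      ← mul_assoc s, ← mul_assoc (s * s), ← pow_two, ← pow_add, show 2 + 2 = 1 + 3 from rfl,
      pow_add, hs, mul_one, pow_one, mul_assoc]
  rw [← e2, mul_assoc (s * _)] at h
  have h2 := ((unit hs).mul (((unit hs).mul (unit ht)).mul ((unit hz).pow 2))).mul_left_cancel h
  refine (unit hc).mul_right_cancel ?_
  rw [← h2, mul_assoc _ c c, ← pow_two]

/-- The identity x(x + y) = x² + xy. It comes from computing (2x + y)² in two ways: negating y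
conjugates `CX` to `CX²`, and applying `CX_S` twice leaves one `CX` to be moved past a link on the
same wires. -/
theorem CX_CZ_same {i j : Fin n} (h : i ≠ j) : SemiconjBy (CX i j) (CZ i j) (S i * CZ i j) := by
  have hN : Hd j * Hd j * (Hd j * Hd j) = 1 := N_N j
  have hNS : Commute (Hd j * Hd j) (S i) :=
    (gate1_commute _ _ h.symm).mul_left (gate1_commute _ _ h.symm)
  have h1 : SemiconjBy (Hd j * Hd j) (CZ i j ^ 2) (CZ i j) := by
    have : SemiconjBy (Hd j * Hd j) (CZ i j) (CZ i j ^ 2) := by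
      rw [SemiconjBy, ← N_CZ_N h, mul_assoc _ (Hd j * Hd j) (Hd j * Hd j), hN, mul_one]
    exact semiconj_inv hN hN this
  have h2 : SemiconjBy (CX i j ^ 2) (S j) (S i * S j * CZ i j) := by
    have e : SemiconjBy (Hd j * Hd j) (S i * S j * CZ i j ^ 2) (S i * S j * CZ i j) :=
      (SemiconjBy.mul_right hNS (N_S j)).mul_right h1
    rw [← N_CX_N h]
    exact (e.mul_left (CX_S h)).mul_left (N_S j)
  have h3 : S i * S j * CZ i j * CX i j ^ 2 =
      S i * (S i * S j * CZ i j ^ 2) * (CX i j * CZ i j ^ 2 * CX i j) := by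
    rw [← h2.eq, pow_two (CX i j), mul_assoc (CX i j), CX_S h]
    simp only [← mul_assoc]
    rw [(CX_S_control h).eq, mul_assoc (S i) (CX i j), CX_S h]
    simp only [← mul_assoc]
  -- The cancellation yields the relation for `CZ²`; squaring it and reducing exponents modulo 3
  -- gives the one for `CZ`.
  have h5 := (cancel_phases (S_S i j) (S_CZ i i j) (S_three i) (S_three j) (CZ_three i j)
    (CX_three i j) h3).pow_right 2
  rwa [(S_CZ i i j).pow_pow 2 2 |>.mul_pow, ← pow_mul, ← pow_mul, show 2 * 2 = 3 + 1 from rfl,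
    pow_add, pow_add, S_three, CZ_three, one_mul, one_mul, pow_one, pow_one] at h5

end Relations

/-! ## States -/

section States

local notation "𝐈" => one 1

/-- All wires in the state `|+⟩`. -/
def plus : (n : ℕ) → Mor 0 n
  | 0 => one 0
  | n + 1 => plus n ⊠ plus1

theorem plus_succ (n : ℕ) : plus (n + 1) = plus n ⊠ plus1 := rfl

theorem plus_one : plus 1 = plus1 := eq_of_heq (one_zero_tens_heq plus1)

theorem plus_two : plus 2 = plus2 := by
  rw [plus_succ, plus_one]; rfl

theorem plus_add (k a : ℕ) : plus (k + a) = plus k ⊠ plus a := by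
  induction a with
  | zero => exact (tens_one_zero _).symm
  | succ a ih =>
    have h := eq_of_heq (tens_assoc_heq (plus k) (plus a) plus1)
    rw [← ih] at h
    exact h

theorem plus2_sw : plus2 ▷ sw = plus2 := by
  have h := swap_natural plus1 plus1
  have h2 : (perm (finAddFlip : Fin (0 + 0) ≃ Fin (0 + 0)) : Mor 0 0) = one 0 := by
    rw [← perm_refl]; congr 1; ext i; exact i.elim0
  rw [sw_eq, plus2, h]
  exact (congrArg (fun f => f ▷ (plus1 ⊠ plus1)) h2).trans (one_comp _)

theorem perm_tens_of {k a : ℕ} (σ : Fin k ≃ Fin k) (ρ : Fin a ≃ Fin a)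
    (τ : Fin (k + a) ≃ Fin (k + a)) (h : ∀ i, τ (Fin.castAdd a i) = Fin.castAdd a (σ i))
    (h' : ∀ j, τ (Fin.natAdd k j) = Fin.natAdd k (ρ j)) : perm τ = perm σ ⊠ perm ρ := by
  rw [perm_tens]
  congr 1
  ext i
  refine Fin.addCases (fun i => ?_) (fun j => ?_) i
  · simp [h]
  · simp [h']

theorem plus_adjacent (n : ℕ) (i : Fin n) :
    plus (n + 1) ▷ perm (Equiv.swap i.castSucc i.succ) = plus (n + 1) := by
  induction n with
  | zero => exact i.elim0
  | succ n ih =>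
    refine Fin.lastCases ?_ (fun i => ?_) i
    · have h1 : (perm (Equiv.swap (Fin.last n).castSucc (Fin.last n).succ) : Mor (n + 2) (n + 2)) =
          one n ⊠ sw := by
        refine perm_tens_of (Equiv.refl (Fin n)) (Equiv.swap 0 1) _ (fun i => ?_) (fun j => ?_)
        · refine Equiv.swap_apply_of_ne_of_ne (fun h => ?_) (fun h => ?_) <;>
          · have := congrArg Fin.val h
            simp at this
            omega
        · have h0 : Fin.natAdd n (0 : Fin 2) = (Fin.last n).castSucc := by ext; simp
          have h1 : Fin.natAdd n (1 : Fin 2) = (Fin.last n).succ := by ext; simp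
          fin_cases j
          · simp [h0, h1]
          · simp [h0, h1]
      have h2 : plus (n + 2) = plus n ⊠ plus2 := by rw [plus_add, plus_two]
      rw [h1]
      refine (congrArg (fun f => f ▷ (one n ⊠ sw)) h2).trans ?_
      refine (interchange _ _ _ _).trans ?_
      rw [comp_one, plus2_sw, ← h2]
    · have h1 : (perm (Equiv.swap i.castSucc.castSucc i.castSucc.succ) : Mor (n + 2) (n + 2)) =
          perm (Equiv.swap i.castSucc i.succ) ⊠ 𝐈 := by
        refine perm_tens_of (Equiv.swap i.castSucc i.succ) (Equiv.refl (Fin 1)) _ (fun j => ?_)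
          (fun j => ?_)
        · have := (Fin.castSucc_injective (n + 1)).swap_apply i.castSucc i.succ j
          exact this
        · refine Equiv.swap_apply_of_ne_of_ne (fun h => ?_) (fun h => ?_) <;>
          · have := congrArg Fin.val h
            simp at this
            omega
      rw [h1, plus_succ]
      refine (interchange _ _ _ _).trans ?_
      rw [ih, comp_one]

theorem plus_perm {n m : ℕ} (σ : Fin n ≃ Fin m) : plus n ▷ perm σ = plus m := by
  obtain rfl : n = m := by simpa using Fintype.card_congr σ
  cases n with
  | zero =>
    have : σ = Equiv.refl _ := by ext i; exact i.elim0
    rw [this, perm_refl, comp_one]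
  | succ n =>
    -- Adjacent transpositions generate all permutations, and each of them only swaps two factors
    -- |+⟩.
    have h : σ ∈ Submonoid.closure (Set.range fun i : Fin n => Equiv.swap i.castSucc i.succ) := by
      rw [Equiv.Perm.mclosure_swap_castSucc_succ]; trivial
    induction h using Submonoid.closure_induction with
    | mem x hx => obtain ⟨i, rfl⟩ := hx; exact plus_adjacent n i
    | one => exact comp_one _
    | mul x y _ _ hx hy =>
      have : perm (x * y) = perm y ▷ perm x := (perm_comp _ _).symm
      rw [this, ← comp_assoc, hy, hx]

/-- Permutation invariance of |+⟩…|+⟩ allows the chosen wires to be moved to the end, so an identity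
on few wires can be used inside a larger state. -/
theorem plus_gate {n a : ℕ} {A B : Mor a a} (h : plus a ▷ A = plus a ▷ B) (p : Fin a → Fin n)
    (hp : Function.Injective p) : plus n ▷ gate A p = plus n ▷ gate B p := by
  obtain ⟨k, e, he⟩ := exists_frame p hp
  rw [gate_eq_lift A p e he, gate_eq_lift B p e he, lift, lift, ← comp_assoc, ← comp_assoc,
    ← comp_assoc, ← comp_assoc, plus_perm, plus_add, interchange, interchange, h]

end States
end Mor
end QutritZX
end

/-! ### Normal forms: base states, absorption, pivoting, commuting gates -/

noncomputable section
namespace QutritZX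
open Diag
namespace Mor

section NormalForm

local notation "𝐈" => one 1

variable {n : ℕ}

/-! ## Product states -/

theorem Hd_Hd (i j : Fin n) : Commute (Hd i) (Hd j) := by
  by_cases h : i = j
  · rw [h]
  · exact gate1_commute _ _ h

/-- Hadamard nodes on the wires in `D`. -/
def hads (D : Finset (Fin n)) : Mor n n := D.noncommProd Hd fun i _ j _ _ => Hd_Hd i j

/-- The wires in `D` in the state `|0⟩`, the others in the state `|+⟩`. -/
def base (D : Finset (Fin n)) : Mor 0 n := plus n ▷ hads D

theorem hads_insert {D : Finset (Fin n)} {v : Fin n} (h : v ∉ D) :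
    hads (insert v D) = Hd v * hads D := Finset.noncommProd_insert_of_notMem _ _ _ _ h

theorem commute_hads {D : Finset (Fin n)} {a : Mor n n} (h : ∀ v ∈ D, Commute a (Hd v)) :
    Commute a (hads D) := Finset.noncommProd_commute _ _ _ _ h

theorem gate_hads {a : ℕ} (A : Mor a a) (p : Fin a → Fin n) {D : Finset (Fin n)}
    (h : ∀ i, p i ∉ D) : Commute (gate A p) (hads D) :=
  commute_hads fun v hv => gate_commute _ _ _ _ fun i j e => by
    fin_cases j
    exact h i (e ▸ hv)

theorem base_insert {D : Finset (Fin n)} {v : Fin n} (h : v ∉ D) :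
    base (insert v D) = base D ▷ Hd v := by
  have h1 : Commute (Hd v) (hads D) := gate_hads _ _ fun i => by fin_cases i; exact h
  rw [base, hads_insert h, h1.eq, mul_def, ← comp_assoc, base]

open Classical in
/-- The node preparing the wire `u` in `base D`. -/
def prep (D : Finset (Fin n)) (u : Fin n) : Mor 1 1 := if u ∈ D then H else 𝐈

theorem prep_of_mem {D : Finset (Fin n)} {u : Fin n} (h : u ∈ D) : prep D u = H := if_pos h

theorem prep_of_notMem {D : Finset (Fin n)} {u : Fin n} (h : u ∉ D) : prep D u = 𝐈 := if_neg h

theorem hads_erase (D : Finset (Fin n)) (u : Fin n) :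
    hads D = gate (prep D u) ![u] * hads (D.erase u) := by
  by_cases h : u ∈ D
  · rw [prep_of_mem h]
    conv_lhs => rw [← Finset.insert_erase h]
    exact hads_insert (Finset.notMem_erase _ _)
  · rw [prep_of_notMem h, gate_one, Finset.erase_eq_of_notMem h]
    exact (one_comp _).symm

/-- The preparations of the other wires commute past a gate on `u`, so only the preparation of `u`
itself is involved. -/
theorem base_gate_one {D : Finset (Fin n)} {u : Fin n} {A B : Mor 1 1}
    (h : plus1 ▷ (prep D u ▷ A) = plus1 ▷ (prep D u ▷ B)) :
    base D ▷ gate A ![u] = base D ▷ gate B ![u] := by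
  have hc : ∀ A : Mor 1 1, Commute (gate A ![u]) (hads (D.erase u)) := fun A =>
    gate_hads _ _ fun i => by fin_cases i; exact Finset.notMem_erase _ _
  have h2 : ∀ A : Mor 1 1, base D ▷ gate A ![u] =
      plus n ▷ gate (prep D u ▷ A) ![u] ▷ hads (D.erase u) := fun A => by
    rw [base, hads_erase D u, gate_comp, comp_assoc, comp_assoc, ← mul_def, mul_assoc, ← (hc A).eq,
      ← mul_assoc]; rfl
  rw [h2, h2, plus_gate]
  · rwa [plus_one]
  · exact fun a b _ => Subsingleton.elim _ _

theorem base_pair (D : Finset (Fin n)) {u v : Fin n} (huv : u ≠ v) (A : Mor 2 2) :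
    base D ▷ gate A ![u, v] =
      plus n ▷ gate ((prep D u ⊠ prep D v) ▷ A) ![u, v] ▷ hads ((D.erase u).erase v) := by
  have hc : Commute (gate A ![u, v]) (hads ((D.erase u).erase v)) :=
    gate_hads _ _ fun i => by
      fin_cases i
      · exact fun h => Finset.notMem_erase _ _ (Finset.mem_of_mem_erase h)
      · exact Finset.notMem_erase _ _
  have h1 : prep (D.erase u) v = prep D v := by
    by_cases hv : v ∈ D
    · rw [prep_of_mem hv, prep_of_mem (Finset.mem_erase.2 ⟨huv.symm, hv⟩)]
    · rw [prep_of_notMem hv, prep_of_notMem fun h => hv (Finset.mem_of_mem_erase h)]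
  rw [base, hads_erase D u, hads_erase (D.erase u) v, h1, gate_comp, tens_eq, gate_comp,
    gate_left _ huv, gate_right _ huv, comp_assoc, comp_assoc, ← mul_def, ← mul_def, ← mul_def,
    ← mul_def]
  simp only [mul_assoc]
  rw [hc.eq]

theorem base_gate_two {D : Finset (Fin n)} {u v : Fin n} (huv : u ≠ v) {A B : Mor 2 2}
    (h : plus2 ▷ ((prep D u ⊠ prep D v) ▷ A) = plus2 ▷ ((prep D u ⊠ prep D v) ▷ B)) :
    base D ▷ gate A ![u, v] = base D ▷ gate B ![u, v] := by
  rw [base_pair D huv, base_pair D huv, plus_gate _ _ (pair_injective huv)]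
  rwa [plus_two]

/-! ### Absorption -/

theorem base_X {D : Finset (Fin n)} {u : Fin n} (h : u ∉ D) : base D ▷ X u = base D := by
  have := base_gate_one (D := D) (u := u) (A := rph 1 2) (B := 𝐈) (by
    rw [prep_of_notMem h, one_comp, one_comp, plus_rph, comp_one])
  rwa [gate_one, comp_one] at this

theorem base_ph {D : Finset (Fin n)} {u : Fin n} (h : u ∈ D) (a b : ZMod 3) :
    base D ▷ gate (ph a b) ![u] = base D := by
  have := base_gate_one (D := D) (u := u) (A := ph a b) (B := 𝐈) (by
    rw [prep_of_mem h, comp_one, ← comp_assoc, plus_H, zero_phase'])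
  rwa [gate_one, comp_one] at this

theorem plus2_tens (f g : Mor 1 1) : plus2 ▷ (f ⊠ g) = (plus1 ▷ f) ▷ (𝐈 ⊠ (plus1 ▷ g)) := by
  have h1 := tens_eq (plus1 ▷ f) (plus1 ▷ g)
  rw [tens_one_zero] at h1
  rw [plus2, interchange, h1]

theorem zero_cz_tens (f : Mor 1 1) : plus2 ▷ ((f ⊠ H) ▷ cz) = plus2 ▷ (f ⊠ H) := by
  rw [← comp_assoc, plus2_tens, plus_H, comp_assoc, zero_cz]

theorem zero_cz_tens' (f : Mor 1 1) : plus2 ▷ ((H ⊠ f) ▷ cz) = plus2 ▷ (H ⊠ f) := by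
  have e : (H ⊠ f) ▷ cz = sw ▷ (((f ⊠ H) ▷ cz) ▷ sw) := by
    rw [comp_assoc, ← comp_assoc sw, sw_tens, comp_assoc, ← comp_assoc sw cz, sw_cz_sw]
  rw [e, ← comp_assoc, plus2_sw, ← comp_assoc, zero_cz_tens, comp_assoc, ← sw_tens, ← comp_assoc,
    plus2_sw]

theorem zero_cx_tens (f : Mor 1 1) : plus2 ▷ ((H ⊠ f) ▷ cx) = plus2 ▷ (H ⊠ f) := by
  rw [cx_eq, ← comp_assoc (H ⊠ f), interchange, comp_one, ← comp_assoc, ← comp_assoc, comp_assoc plus2,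
    zero_cz_tens', comp_assoc, interchange, comp_one, comp_assoc, H_H', comp_one]

theorem base_CZ {D : Finset (Fin n)} {u v : Fin n} (h : u ∈ D ∨ v ∈ D) :
    base D ▷ CZ u v = base D := by
  by_cases huv : u = v
  · rw [huv, CZ_self]; exact comp_one _
  have := base_gate_two (D := D) huv (A := cz) (B := one 2) (by
    rcases h with h | h
    · rw [prep_of_mem h, comp_one, zero_cz_tens']
    · rw [prep_of_mem h, comp_one, zero_cz_tens])
  rwa [gate_one, comp_one] at this

theorem base_CX {D : Finset (Fin n)} {u v : Fin n} (h : u ∈ D ∨ u ∉ D ∧ v ∉ D) :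
    base D ▷ CX u v = base D := by
  by_cases huv : u = v
  · rw [huv, CX_self]; exact comp_one _
  have := base_gate_two (D := D) huv (A := cx) (B := one 2) (by
    rcases h with h | ⟨h, h'⟩
    · rw [prep_of_mem h, comp_one, zero_cx_tens]
    · rw [prep_of_notMem h, prep_of_notMem h', one_tens_one, one_comp, one_comp, plus2_cx]; exact (comp_one _).symm)
  rwa [gate_one, comp_one] at this

/-! ### Pivoting -/

theorem base_pivot_aux {D : Finset (Fin n)} {l v : Fin n} (hl : l ∉ D) (hv : v ∈ D) {A : Mor 2 2}
    (h : plus2 ▷ (A ▷ (𝐈 ⊠ H')) = plus2 ▷ (A ▷ (H' ⊠ 𝐈))) :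
    base D ▷ (Hd v * gate A ![l, v] * Hi v) =
      base (insert l (D.erase v)) ▷ (Hd l * gate A ![l, v] * Hi l) := by
  have hlv : l ≠ v := fun e => hl (e ▸ hv)
  have e1 : Hd v * gate A ![l, v] * Hi v = gate ((𝐈 ⊠ H) ▷ A ▷ (𝐈 ⊠ H')) ![l, v] := by
    rw [gate_comp, gate_comp, gate_right _ hlv, gate_right _ hlv]; rfl
  have e2 : Hd l * gate A ![l, v] * Hi l = gate ((H ⊠ 𝐈) ▷ A ▷ (H' ⊠ 𝐈)) ![l, v] := by
    rw [gate_comp, gate_comp, gate_left _ hlv, gate_left _ hlv]; rfl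
  have e3 : ((insert l (D.erase v)).erase l).erase v = (D.erase l).erase v := by
    ext x; simp; tauto
  have h1 : plus2 ▷ (𝐈 ⊠ (H ▷ H)) = plus2 := by
    rw [plus2, interchange, comp_one, plus_H_H]
  have h2 : plus2 ▷ ((H ▷ H) ⊠ 𝐈) = plus2 := by
    rw [plus2, interchange, comp_one, plus_H_H]
  rw [e1, e2, base_pair _ hlv, base_pair _ hlv, e3, prep_of_notMem hl, prep_of_mem hv,
    prep_of_mem (Finset.mem_insert_self _ _), prep_of_notMem (by simp [hlv.symm]),
    plus_gate (B := (H ⊠ 𝐈) ▷ ((H ⊠ 𝐈) ▷ A ▷ (H' ⊠ 𝐈))) _ _ (pair_injective hlv)]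
  rw [plus_two]
  simp only [← comp_assoc]
  rw [comp_assoc plus2 (𝐈 ⊠ H), ← one_tens_comp, h1, comp_assoc plus2 (H ⊠ 𝐈), ← tens_comp_one, h2,
    comp_assoc, h, comp_assoc]

/-- Both sides prepare the same symmetric entangled pair ∑|x, x⟩ on `l` and `v`, so either wire may
serve as the control. -/
theorem base_pivot {D : Finset (Fin n)} {l v : Fin n} (hl : l ∉ D) (hv : v ∈ D) :
    base D ▷ CX l v = base (insert l (D.erase v)) ▷ CX v l := by
  rw [CX_eq, CX_eq, CZ_symm v l]
  exact base_pivot_aux hl hv bell_H'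

theorem CX_sq (i j : Fin n) : CX i j ^ 2 = Hd j * CZ i j ^ 2 * Hi j := by
  rw [((Hd_CZ i j).pow_right 2).eq, mul_assoc, Hd_Hi, mul_one]

theorem base_pivot_sq {D : Finset (Fin n)} {l v : Fin n} (hl : l ∉ D) (hv : v ∈ D) :
    base D ▷ CX l v ^ 2 = base (insert l (D.erase v)) ▷ CX v l ^ 2 := by
  have h1 : CZ l v ^ 2 = gate (cz ^ 2) ![l, v] := (map_pow (gateHom ![l, v]) cz 2).symm
  rw [CX_sq, CX_sq, CZ_symm v l, h1]
  exact base_pivot_aux hl hv bell_sq_H'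

/-! ## Normal forms -/

/-- Diagonal gates away from `D`. -/
inductive IsDiagGate (D : Finset (Fin n)) : Mor n n → Prop
  | ofS (u : Fin n) (hu : u ∉ D) : IsDiagGate D (S u)
  | ofZp (u : Fin n) (hu : u ∉ D) : IsDiagGate D (Zp u)
  | ofCZ (u v : Fin n) (hu : u ∉ D) (hv : v ∉ D) : IsDiagGate D (CZ u v)

/-- The gates of normal forms over `base D`, apart from `X`. -/
inductive IsGate₀ (D : Finset (Fin n)) : Mor n n → Prop
  | ofS (u : Fin n) (hu : u ∉ D) : IsGate₀ D (S u)
  | ofZp (u : Fin n) (hu : u ∉ D) : IsGate₀ D (Zp u)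
  | ofCZ (u v : Fin n) (hu : u ∉ D) (hv : v ∉ D) : IsGate₀ D (CZ u v)
  | ofCX (u v : Fin n) (hu : u ∉ D) (hv : v ∈ D) : IsGate₀ D (CX u v)

/-- The gates of normal forms over `base D`. -/
inductive IsGate (D : Finset (Fin n)) : Mor n n → Prop
  | of₀ {a : Mor n n} (h : IsGate₀ D a) : IsGate D a
  | ofX (v : Fin n) (hv : v ∈ D) : IsGate D (X v)

/-- The circuits of normal forms over `base D`. -/
def circuits (D : Finset (Fin n)) : Submonoid (Mor n n) := Submonoid.closure {a | IsGate D a}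

/-- Diagonal circuits away from `D`. -/
def diagCircuits (D : Finset (Fin n)) : Submonoid (Mor n n) :=
  Submonoid.closure {a | IsDiagGate D a}

/-- Normal forms of stabilizer states. -/
def NF (D : Finset (Fin n)) (t : Mor 0 n) : Prop := ∃ g ∈ circuits D, t = base D ▷ g

theorem IsDiagGate.commute {D E : Finset (Fin n)} {a b : Mor n n} (ha : IsDiagGate D a)
    (hb : IsDiagGate E b) : Commute a b := by
  cases ha <;> cases hb
  exacts [S_S _ _, S_Zp _ _, S_CZ _ _ _, (S_Zp _ _).symm, Zp_Zp _ _, Zp_CZ _ _ _, (S_CZ _ _ _).symm,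
    (Zp_CZ _ _ _).symm, CZ_CZ_commute _ _ _ _]

/-- Controls lie outside D and targets inside, so no target is ever a control, and the diagonal
gates meet only controls. -/
theorem IsGate₀.commute {D : Finset (Fin n)} {a b : Mor n n} (ha : IsGate₀ D a)
    (hb : IsGate₀ D b) : Commute a b := by
  have ne : ∀ {u v : Fin n}, u ∉ D → v ∈ D → u ≠ v := fun hu hv e => hu (e ▸ hv)
  have h1 : ∀ (a b : ZMod 3) (u u' v : Fin n), u ∉ D → u' ∉ D → v ∈ D →
      Commute (gate (ph a b) ![u]) (CX u' v) := fun a b u u' v hu hu' hv => by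
    have hc : Commute (gate (ph a b) ![u]) (Hd v) := gate1_commute _ _ (ne hu hv)
    have hc' : Commute (gate (ph a b) ![u]) (Hi v) := gate1_commute _ _ (ne hu hv)
    rw [CX_eq]
    exact (hc.mul_right (ph_CZ_commute _ _ _ _ _)).mul_right hc'
  have h2 : ∀ (u u' w v : Fin n), u ∉ D → u' ∉ D → w ∉ D → v ∈ D →
      Commute (CZ u u') (CX w v) := fun u u' w v hu hu' hw hv => by
    have hc : ∀ A, Commute (CZ u u') (gate A ![v]) := fun A =>
      (gate12_commute _ _ (ne hu hv).symm (ne hu' hv).symm).symm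
    rw [CX_eq]
    exact ((hc H).mul_right (CZ_CZ_commute _ _ _ _)).mul_right (hc H')
  have h3 : ∀ (u u' v v' : Fin n), u ∉ D → u' ∉ D → v ∈ D → v' ∈ D →
      Commute (CX u v) (CX u' v') := fun u u' v v' hu hu' hv hv' => by
    by_cases e1 : v = v'
    · rw [e1]; exact CX_CX_target _ _ _
    by_cases e2 : u = u'
    · rw [e2]; exact CX_CX_control (ne hu' hv) (ne hu' hv') e1
    · exact gate2_commute _ _ e2 (ne hu hv') (ne hu' hv).symm e1
  cases ha with
  | ofS u hu => cases hb with
    | ofS u' hu' => exact S_S _ _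
    | ofZp u' hu' => exact S_Zp _ _
    | ofCZ u' v' hu' hv' => exact S_CZ _ _ _
    | ofCX u' v' hu' hv' => exact h1 _ _ _ _ _ hu hu' hv'
  | ofZp u hu => cases hb with
    | ofS u' hu' => exact (S_Zp _ _).symm
    | ofZp u' hu' => exact Zp_Zp _ _
    | ofCZ u' v' hu' hv' => exact Zp_CZ _ _ _
    | ofCX u' v' hu' hv' => exact h1 _ _ _ _ _ hu hu' hv'
  | ofCZ u v hu hv => cases hb with
    | ofS u' hu' => exact (S_CZ _ _ _).symm
    | ofZp u' hu' => exact (Zp_CZ _ _ _).symm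
    | ofCZ u' v' hu' hv' => exact CZ_CZ_commute _ _ _ _
    | ofCX u' v' hu' hv' => exact h2 _ _ _ _ hu hv hu' hv'
  | ofCX u v hu hv => cases hb with
    | ofS u' hu' => exact (h1 _ _ _ _ _ hu' hu hv).symm
    | ofZp u' hu' => exact (h1 _ _ _ _ _ hu' hu hv).symm
    | ofCZ u' v' hu' hv' => exact (h2 _ _ _ _ hu' hv' hu hv).symm
    | ofCX u' v' hu' hv' => exact h3 _ _ _ _ hu hu' hv hv'

theorem IsGate₀.commute_X {D : Finset (Fin n)} {a : Mor n n} (ha : IsGate₀ D a) {v : Fin n}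
    (hv : v ∈ D) : Commute a (X v) := by
  have ne : ∀ {u : Fin n}, u ∉ D → u ≠ v := fun hu e => hu (e ▸ hv)
  cases ha with
  | ofS u hu => exact gate1_commute _ _ (ne hu)
  | ofZp u hu => exact gate1_commute _ _ (ne hu)
  | ofCZ u u' hu hu' => exact (gate12_commute _ _ (ne hu).symm (ne hu').symm).symm
  | ofCX u v' hu hv' =>
    by_cases e : v' = v
    · rw [e]; exact CX_X_target _ _
    · exact (gate12_commute _ _ (ne hu).symm (Ne.symm e)).symm

theorem X_X (u v : Fin n) : Commute (X u) (X v) := by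
  by_cases h : u = v
  · rw [h]
  · exact gate1_commute _ _ h

theorem IsGate.commute {D : Finset (Fin n)} {a b : Mor n n} (ha : IsGate D a) (hb : IsGate D b) :
    Commute a b := by
  cases ha with
  | of₀ ha => cases hb with
    | of₀ hb => exact ha.commute hb
    | ofX v hv => exact ha.commute_X hv
  | ofX v hv => cases hb with
    | of₀ hb => exact (hb.commute_X hv).symm
    | ofX v' hv' => exact X_X _ _

theorem closure_commute {M : Type*} [Monoid M] {s t : Set M}
    (h : ∀ a ∈ s, ∀ b ∈ t, Commute a b) {a b : M} (ha : a ∈ Submonoid.closure s)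
    (hb : b ∈ Submonoid.closure t) : Commute a b := by
  induction ha using Submonoid.closure_induction with
  | mem a ha =>
    induction hb using Submonoid.closure_induction with
    | mem b hb => exact h a ha b hb
    | one => exact Commute.one_right _
    | mul x y _ _ hx hy => exact hx.mul_right hy
  | one => exact Commute.one_left _
  | mul x y _ _ hx hy => exact hx.mul_left hy

/-- Conjugation need only be checked on generators: elements of `s` carry products of `t` to
products of `t`. -/
theorem semiconj_closure {M : Type*} [Monoid M] {s t : Set M}
    (h : ∀ a ∈ s, ∀ b ∈ t, ∃ b' ∈ Submonoid.closure t, SemiconjBy a b b') {a b : M}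
    (ha : a ∈ Submonoid.closure s) (hb : b ∈ Submonoid.closure t) :
    ∃ b' ∈ Submonoid.closure t, SemiconjBy a b b' := by
  induction ha using Submonoid.closure_induction generalizing b with
  | mem a ha =>
    induction hb using Submonoid.closure_induction with
    | mem b hb => exact h a ha b hb
    | one => exact ⟨1, one_mem _, SemiconjBy.one_right _⟩
    | mul x y _ _ hx hy =>
      obtain ⟨x', hx', ex⟩ := hx
      obtain ⟨y', hy', ey⟩ := hy
      exact ⟨x' * y', mul_mem hx' hy', ex.mul_right ey⟩
  | one => exact ⟨b, hb, SemiconjBy.one_left _⟩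
  | mul x y _ _ hx hy =>
    obtain ⟨b', hb', e⟩ := hy hb
    obtain ⟨b'', hb'', e'⟩ := hx hb'
    exact ⟨b'', hb'', e'.mul_left e⟩

end NormalForm
end Mor
end QutritZX
end

/-! ### Stability of normal forms under diagonal gates, shifts and controlled sums -/

noncomputable section
namespace QutritZX
open Diag
namespace Mor

section Closure

local notation "𝐈" => one 1

variable {n : ℕ} {D : Finset (Fin n)}

/-! ## Closure properties of normal forms -/

theorem IsDiagGate.isGate₀ {a : Mor n n} (h : IsDiagGate D a) : IsGate₀ D a := by
  cases h with
  | ofS u hu => exact .ofS u hu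
  | ofZp u hu => exact .ofZp u hu
  | ofCZ u v hu hv => exact .ofCZ u v hu hv

theorem mem_circuits {a : Mor n n} (h : IsGate D a) : a ∈ circuits D := Submonoid.subset_closure h

theorem mem_diagCircuits {a : Mor n n} (h : IsDiagGate D a) : a ∈ diagCircuits D :=
  Submonoid.subset_closure h

theorem diagCircuits_le : diagCircuits D ≤ circuits D :=
  Submonoid.closure_mono fun _ h => .of₀ (IsDiagGate.isGate₀ h)

theorem circuits_commute {a b : Mor n n} (ha : a ∈ circuits D) (hb : b ∈ circuits D) :
    Commute a b := closure_commute (fun _ h _ h' => IsGate.commute h h') ha hb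

/-- Conjugating diagonal gates by a controlled sum. -/
theorem IsDiagGate.semiconj_CX {a : Mor n n} (h : IsDiagGate D a) {u v : Fin n} (huv : u ≠ v)
    (hu : u ∉ D) : ∃ b ∈ diagCircuits D, SemiconjBy (CX u v) a b := by
  have key : ∀ w : Fin n, w ∉ D → v ∉ D → ∃ b ∈ diagCircuits D, SemiconjBy (CX u v) (CZ v w) b := by
    intro w hw hv
    by_cases e : v = w
    · rw [← e, CZ_self]; exact ⟨1, one_mem _, SemiconjBy.one_right _⟩
    by_cases e' : u = w
    · rw [← e', CZ_symm]
      exact ⟨_, mul_mem (mem_diagCircuits (.ofS u hu)) (mem_diagCircuits (.ofCZ u v hu hv)),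
        CX_CZ_same huv⟩
    · exact ⟨_, mul_mem (mem_diagCircuits (.ofCZ v w hv hw)) (mem_diagCircuits (.ofCZ u w hu hw)),
        CX_CZ_next huv e' e⟩
  cases h with
  | ofS w hw =>
    by_cases e : w = v
    · subst e
      exact ⟨_, mul_mem (mul_mem (mem_diagCircuits (.ofS u hu)) (mem_diagCircuits (.ofS w hw)))
        (pow_mem (mem_diagCircuits (.ofCZ u w hu hw)) 2), CX_S huv⟩
    refine ⟨_, mem_diagCircuits (.ofS w hw), ?_⟩
    by_cases e' : w = u
    · subst e'; exact CX_S_control huv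
    · exact (gate12_commute _ _ e' e).symm
  | ofZp w hw =>
    by_cases e : w = v
    · subst e
      exact ⟨_, mul_mem (mem_diagCircuits (.ofZp u hu)) (mem_diagCircuits (.ofZp w hw)), CX_Zp huv⟩
    refine ⟨_, mem_diagCircuits (.ofZp w hw), ?_⟩
    by_cases e' : w = u
    · subst e'; exact CX_Zp_control huv
    · exact (gate12_commute _ _ e' e).symm
  | ofCZ w w' hw hw' =>
    by_cases e : w = v
    · rw [e] at hw ⊢; exact key w' hw' hw
    by_cases e' : w' = v
    · rw [e'] at hw' ⊢; rw [CZ_symm]; exact key w hw hw'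
    refine ⟨_, mem_diagCircuits (.ofCZ w w' hw hw'), ?_⟩
    have h1 : ∀ A, Commute (gate A ![v]) (CZ w w') := fun A => gate12_commute _ _ (Ne.symm e) (Ne.symm e')
    rw [CX_eq]
    exact ((h1 H).mul_left (CZ_CZ_commute _ _ _ _)).mul_left (h1 H')

/-- Conjugating diagonal gates by a red phase. -/
theorem IsDiagGate.semiconj_X {a : Mor n n} (h : IsDiagGate D a) (u : Fin n) :
    ∃ b ∈ diagCircuits D, SemiconjBy (X u) a b := by
  have key : ∀ w : Fin n, w ∉ D → u ∉ D → ∃ b ∈ diagCircuits D, SemiconjBy (X u) (CZ u w) b := by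
    intro w hw hu
    by_cases e : u = w
    · rw [← e, CZ_self]; exact ⟨1, one_mem _, SemiconjBy.one_right _⟩
    · exact ⟨_, mul_mem (mem_diagCircuits (.ofCZ u w hu hw))
        (pow_mem (mem_diagCircuits (.ofZp w hw)) 2), X_CZ e⟩
  cases h with
  | ofS w hw =>
    by_cases e : w = u
    · subst e
      exact ⟨_, mul_mem (mem_diagCircuits (.ofS w hw)) (mem_diagCircuits (.ofZp w hw)), X_S w⟩
    · exact ⟨_, mem_diagCircuits (.ofS w hw), gate1_commute _ _ (Ne.symm e)⟩
  | ofZp w hw =>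
    refine ⟨_, mem_diagCircuits (.ofZp w hw), ?_⟩
    by_cases e : w = u
    · subst e; exact X_Zp w
    · exact gate1_commute _ _ (Ne.symm e)
  | ofCZ w w' hw hw' =>
    by_cases e : w = u
    · rw [e] at hw ⊢; exact key w' hw' hw
    by_cases e' : w' = u
    · rw [e'] at hw' ⊢; rw [CZ_symm]; exact key w hw hw'
    exact ⟨_, mem_diagCircuits (.ofCZ w w' hw hw'), gate12_commute _ _ (Ne.symm e) (Ne.symm e')⟩

theorem IsGate.semiconj_diag {g a : Mor n n} (hg : IsGate D g) (ha : IsDiagGate ∅ a) :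
    ∃ b ∈ diagCircuits ∅, SemiconjBy g a b := by
  cases hg with
  | of₀ hg => cases hg with
    | ofS u hu => exact ⟨a, mem_diagCircuits ha, (IsDiagGate.ofS u hu).commute ha⟩
    | ofZp u hu => exact ⟨a, mem_diagCircuits ha, (IsDiagGate.ofZp u hu).commute ha⟩
    | ofCZ u v hu hv => exact ⟨a, mem_diagCircuits ha, (IsDiagGate.ofCZ u v hu hv).commute ha⟩
    | ofCX u v hu hv => exact ha.semiconj_CX (fun e => hu (e ▸ hv)) (Finset.notMem_empty _)
  | ofX v hv => exact ha.semiconj_X v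

/-- A diagonal gate touching a wire in state |0⟩ acts as a scalar there, and the remaining diagonal
gates all commute, so the absorbable ones can be removed. -/
theorem base_diag {a : Mor n n} (ha : a ∈ diagCircuits ∅) :
    ∃ g ∈ diagCircuits D, base D ▷ a = base D ▷ g := by
  have gen : ∀ {x : Mor n n}, IsDiagGate ∅ x → base D ▷ x = base D ∨ IsDiagGate D x := by
    intro x hx
    cases hx with
    | ofS u hu =>
      by_cases h : u ∈ D
      · exact .inl (base_ph h 1 1)
      · exact .inr (.ofS u h)
    | ofZp u hu =>
      by_cases h : u ∈ D
      · exact .inl (base_ph h 1 2)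
      · exact .inr (.ofZp u h)
    | ofCZ u v hu hv =>
      by_cases h : u ∈ D ∨ v ∈ D
      · exact .inl (base_CZ h)
      · rw [not_or] at h
        exact .inr (.ofCZ u v h.1 h.2)
  induction ha using Submonoid.closure_induction with
  | mem x hx =>
    rcases gen hx with h | h
    · exact ⟨1, one_mem _, h.trans (comp_one _).symm⟩
    · exact ⟨x, mem_diagCircuits h, rfl⟩
  | one => exact ⟨1, one_mem _, rfl⟩
  | mul x y _ hy' hx hy =>
    obtain ⟨x', hx', ex⟩ := hx
    obtain ⟨y', hy'', ey⟩ := hy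
    have hc : Commute x' y := closure_commute (fun _ h _ h' => IsDiagGate.commute h h') hx' hy'
    refine ⟨y' * x', mul_mem hy'' hx', ?_⟩
    rw [mul_def, ← comp_assoc, ex, comp_assoc, ← mul_def, hc.eq, mul_def, ← comp_assoc, ey, comp_assoc]
    rfl

theorem NF.circuit {t : Mor 0 n} (h : NF D t) {a : Mor n n} (ha : a ∈ circuits D) :
    NF D (t ▷ a) := by
  obtain ⟨g, hg, rfl⟩ := h
  exact ⟨g * a, mul_mem hg ha, comp_assoc _ _ _⟩

/-- A quadratic function of the outputs, pulled back along the affine map of the circuit, is a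
quadratic function of the inputs; on `base D` only the coordinates outside D survive. -/
theorem NF.diag {t : Mor 0 n} (h : NF D t) {a : Mor n n} (ha : a ∈ diagCircuits ∅) :
    NF D (t ▷ a) := by
  obtain ⟨g, hg, rfl⟩ := h
  obtain ⟨b, hb, e⟩ := semiconj_closure (fun _ h _ h' => IsGate.semiconj_diag h h') hg ha
  obtain ⟨g', hg', e'⟩ := base_diag (D := D) hb
  refine ⟨g' * g, mul_mem (diagCircuits_le hg') hg, ?_⟩
  rw [comp_assoc, ← mul_def, e.eq, mul_def, ← comp_assoc, e', comp_assoc]; rfl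

/-- Moving `a` from the end of the circuit to the base requires conjugation by the inverse of `a`.
As `a` has order dividing three this is `a ^ 2`, so conjugation by `a` itself suffices. -/
theorem NF.of_semiconj {t : Mor 0 n} (h : NF D t) {a : Mor n n} (ha : a ^ 3 = 1)
    (hb : base D ▷ a = base D)
    (hc : ∀ g, IsGate D g → ∃ g' ∈ circuits D, SemiconjBy a g g') : NF D (t ▷ a) := by
  obtain ⟨g, hg, rfl⟩ := h
  have hm : a ^ 2 ∈ Submonoid.closure {a} :=
    pow_mem (Submonoid.subset_closure (Set.mem_singleton a)) 2
  obtain ⟨g', hg', e⟩ := semiconj_closure (s := {a}) (t := {a | IsGate D a})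
    (fun x hx y hy => by rw [Set.mem_singleton_iff.1 hx]; exact hc y hy) hm hg
  have e' := semiconj_inv (b := a) (by rw [← pow_succ, ha]) (by rw [← pow_succ', ha]) e
  exact ⟨g', hg', by rw [comp_assoc, ← mul_def, ← e'.eq, mul_def, ← comp_assoc, hb]⟩

theorem NF.X {t : Mor 0 n} (h : NF D t) (u : Fin n) : NF D (t ▷ X u) := by
  by_cases hu : u ∈ D
  · exact h.circuit (mem_circuits (.ofX u hu))
  refine h.of_semiconj (X_three u) (base_X hu) fun g hg => ?_
  have hd : ∀ {g}, IsDiagGate D g → ∃ g' ∈ circuits D, SemiconjBy (Mor.X u) g g' := fun h =>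
    let ⟨b, hb, e⟩ := h.semiconj_X u
    ⟨b, diagCircuits_le hb, e⟩
  cases hg with
  | of₀ hg => cases hg with
    | ofS w hw => exact hd (.ofS w hw)
    | ofZp w hw => exact hd (.ofZp w hw)
    | ofCZ w w' hw hw' => exact hd (.ofCZ w w' hw hw')
    | ofCX w v hw hv =>
      have hwv : w ≠ v := fun e => hw (e ▸ hv)
      have huv : u ≠ v := fun e => hu (e ▸ hv)
      by_cases e : u = w
      · subst e
        -- Shifting the control also shifts the target; the compensating `X v` is admissible because
        -- v ∈ D.
        refine ⟨Mor.X v * CX u v, mul_mem (mem_circuits (.ofX v hv))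
          (mem_circuits (.of₀ (.ofCX u v hw hv))), ?_⟩
        rw [SemiconjBy, mul_assoc, (CX_X_control hwv).eq, ← mul_assoc, ← mul_assoc, ← pow_succ',
          X_three, one_mul]
      · exact ⟨_, mem_circuits (.of₀ (.ofCX w v hw hv)), gate12_commute _ _ e huv⟩
  | ofX v hv => exact ⟨_, mem_circuits (.ofX v hv), X_X _ _⟩

/-- The excluded case has its control in D and its target outside: there conjugating `CX w u` would
create a `CX w u'` whose target lies outside D. -/
theorem NF.CX {t : Mor 0 n} (h : NF D t) {u u' : Fin n} (huu : u ∈ D → u' ∈ D) :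
    NF D (t ▷ CX u u') := by
  by_cases hne : u = u'
  · rw [hne, CX_self]; exact h.circuit (one_mem _)
  by_cases hu : u ∈ D
  · have hu' := huu hu
    refine h.of_semiconj (CX_three u u') (base_CX (.inl hu)) fun g hg => ?_
    have ne : ∀ {w v}, w ∉ D → v ∈ D → w ≠ v := fun hw hv e => hw (e ▸ hv)
    cases hg with
    | of₀ hg => cases hg with
      | ofS w hw => exact ⟨_, mem_circuits (.of₀ (.ofS w hw)),
          (gate12_commute _ _ (ne hw hu) (ne hw hu')).symm⟩
      | ofZp w hw => exact ⟨_, mem_circuits (.of₀ (.ofZp w hw)),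
          (gate12_commute _ _ (ne hw hu) (ne hw hu')).symm⟩
      | ofCZ w w' hw hw' => exact ⟨_, mem_circuits (.of₀ (.ofCZ w w' hw hw')),
          (gate2_commute _ _ (ne hw hu) (ne hw hu') (ne hw' hu) (ne hw' hu')).symm⟩
      | ofCX w v hw hv =>
        have mem : ∀ {v}, v ∈ D → Mor.CX w v ∈ circuits D := fun hv =>
          mem_circuits (.of₀ (.ofCX w _ hw hv))
        by_cases e : v = u'
        · subst e; exact ⟨_, mem hv, CX_CX_target _ _ _⟩
        by_cases e' : v = u
        · subst e'
          -- `CX_CX_next` is read with the composite as source; the surplus `CX w u'` is then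
          -- removed by multiplying with its square.
          have h1 : SemiconjBy (Mor.CX v u') (Mor.CX w u' * Mor.CX w v) (Mor.CX w v) := by
            have h2 := (CX_CX_next (ne hw hv) (ne hw hu') hne).eq
            rw [SemiconjBy, h2, mul_assoc]
          have h2 : SemiconjBy (Mor.CX v u') (Mor.CX w u' ^ 2) (Mor.CX w u' ^ 2) :=
            (show Commute _ _ from CX_CX_target v w u').pow_right 2
          have h3 := h2.mul_right h1
          rw [← mul_assoc, ← pow_succ, CX_three, one_mul] at h3
          exact ⟨_, mul_mem (pow_mem (mem hu') 2) (mem hv), h3⟩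
        · exact ⟨_, mem hv, gate2_commute _ _ (ne hw hu).symm (Ne.symm e') (ne hw hu').symm
            (Ne.symm e)⟩
    | ofX v hv =>
      by_cases e : v = u
      · subst e
        exact ⟨_, mul_mem (pow_mem (mem_circuits (.ofX u' hu')) 2) (mem_circuits (.ofX v hv)),
          CX_X_control hne⟩
      refine ⟨_, mem_circuits (.ofX v hv), ?_⟩
      by_cases e' : v = u'
      · subst e'; exact CX_X_target _ _
      · exact (gate12_commute _ _ e e').symm
  · by_cases hu' : u' ∈ D
    · exact h.circuit (mem_circuits (.of₀ (.ofCX u u' hu hu')))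
    refine h.of_semiconj (CX_three u u') (base_CX (.inr ⟨hu, hu'⟩)) fun g hg => ?_
    have hd : ∀ {g}, IsDiagGate D g → ∃ g' ∈ circuits D, SemiconjBy (Mor.CX u u') g g' := fun h =>
      let ⟨b, hb, e⟩ := h.semiconj_CX hne hu
      ⟨b, diagCircuits_le hb, e⟩
    cases hg with
    | of₀ hg => cases hg with
      | ofS w hw => exact hd (.ofS w hw)
      | ofZp w hw => exact hd (.ofZp w hw)
      | ofCZ w w' hw hw' => exact hd (.ofCZ w w' hw hw')
      | ofCX w v hw hv =>
        have ne : ∀ {w}, w ∉ D → w ≠ v := fun hw e => hw (e ▸ hv)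
        have mem : ∀ {w}, w ∉ D → Mor.CX w v ∈ circuits D := fun hw =>
          mem_circuits (.of₀ (.ofCX _ v hw hv))
        by_cases e : w = u'
        · subst e
          exact ⟨_, mul_mem (mem hw) (mem hu), CX_CX_next hne (ne hu) (ne hw)⟩
        refine ⟨_, mem hw, ?_⟩
        by_cases e' : w = u
        · subst e'; exact CX_CX_control hne (ne hw) (ne hu')
        · exact gate2_commute _ _ (Ne.symm e') (ne hu) (Ne.symm e) (ne hu')
    | ofX v hv =>
      exact ⟨_, mem_circuits (.ofX v hv),
        (gate12_commute _ _ (show v ≠ u from fun e => hu (e ▸ hv))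
          (show v ≠ u' from fun e => hu' (e ▸ hv))).symm⟩

end Closure
end Mor
end QutritZX
end

/-! ### The effect ⟨+| on a wire prepared in |0⟩ -/

noncomputable section
namespace QutritZX
open Diag
namespace Mor

section Elimination

local notation "𝐈" => one 1

variable {n : ℕ}

/-! ## Plugging an effect into the last wire -/

/-- The effect `⟨+|` on the last wire. -/
def drop (n : ℕ) : Mor (n + 1) n := one n ⊠ eff1

theorem tens_drop (f : Mor n n) : (f ⊠ 𝐈) ▷ drop n = drop n ▷ f := by
  have h := slide f eff1
  rw [tens_one_zero] at h
  exact h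

/-- The wires of `D` other than the last one. -/
def low (D : Finset (Fin (n + 1))) : Finset (Fin n) :=
  Finset.univ.filter fun u => u.castSucc ∈ D

theorem mem_low {D : Finset (Fin (n + 1))} {u : Fin n} : u ∈ low D ↔ u.castSucc ∈ D := by
  simp [low]

theorem gate_low {a : ℕ} (A : Mor a a) (p : Fin a → Fin n) :
    gate A (fun i => (p i).castSucc) = gate A p ⊠ 𝐈 := by
  rw [← gate_castAdd]
  exact (gate_gate A p (Fin.castAdd 1) (Fin.castSucc_injective n)).symm

theorem gate_low_one (A : Mor 1 1) (u : Fin n) : gate A ![u.castSucc] = gate A ![u] ⊠ 𝐈 := by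
  rw [← gate_low]; congr 1; ext a; fin_cases a; rfl

theorem gate_low_two (A : Mor 2 2) (u v : Fin n) :
    gate A ![u.castSucc, v.castSucc] = gate A ![u, v] ⊠ 𝐈 := by
  rw [← gate_low]; congr 1; ext a; fin_cases a <;> rfl

theorem gate_last (A : Mor 1 1) : gate A ![Fin.last n] = one n ⊠ A := by
  rw [← gate_natAdd]; congr 1; ext a; fin_cases a; rfl

theorem hads_low (D : Finset (Fin (n + 1))) :
    hads (D.erase (Fin.last n)) = hads (low D) ⊠ 𝐈 := by
  have h : ∀ E : Finset (Fin n), hads (E.map Fin.castSuccEmb) = hads E ⊠ 𝐈 := by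
    intro E
    induction E using Finset.induction with
    | empty => exact (one_tens_one n 1).symm
    | insert u E hu ih =>
      have hu' : u.castSucc ∉ E.map Fin.castSuccEmb := by simpa using hu
      rw [Finset.map_insert, hads_insert hu, mul_def, tens_comp_one, ← ih]
      refine (hads_insert hu').trans ?_
      rw [Hd, gate_low_one]; rfl
  rw [← h]
  congr 1
  ext u
  refine Fin.lastCases ?_ (fun u => ?_) u
  · simp
  · simp [mem_low, Fin.castSucc_ne_last]

theorem base_low (D : Finset (Fin (n + 1))) :
    base D = base (low D) ⊠ (plus1 ▷ prep D (Fin.last n)) := by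
  have h := interchange (plus n) (one n) plus1 (prep D (Fin.last n))
  have h2 := interchange (plus n) (hads (low D)) (plus1 ▷ prep D (Fin.last n)) 𝐈
  rw [comp_one] at h h2
  rw [base, hads_erase D (Fin.last n), hads_low, gate_last, plus_succ, mul_def, ← comp_assoc]
  exact ((congrArg (fun f => f ▷ (hads (low D) ⊠ 𝐈)) h).trans h2)

/-- Circuits that avoid the last wire. -/
def lowCircuits (D : Finset (Fin (n + 1))) : Submonoid (Mor (n + 1) (n + 1)) where
  carrier := {a | a ∈ circuits D ∧ ∃ b ∈ circuits (low D), a = b ⊠ 𝐈}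
  one_mem' := ⟨one_mem _, 1, one_mem _, (one_tens_one n 1).symm⟩
  mul_mem' := by
    rintro _ _ ⟨hx, b, hb, rfl⟩ ⟨hy, b', hb', rfl⟩
    exact ⟨mul_mem hx hy, b * b', mul_mem hb hb', (tens_comp_one 1 b b').symm⟩

theorem IsDiagGate.low_or {D : Finset (Fin (n + 1))} {a : Mor (n + 1) (n + 1)}
    (h : IsDiagGate D a) : a ∈ lowCircuits D ∨ Fin.last n ∉ D ∧
      (a = S (Fin.last n) ∨ a = Zp (Fin.last n) ∨
        ∃ u ∉ D, u ≠ Fin.last n ∧ a = CZ (Fin.last n) u) := by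
  cases h with
  | ofS u hu =>
    revert hu
    refine Fin.lastCases (fun hu => ?_) (fun u hu => ?_) u
    · exact .inr ⟨hu, .inl rfl⟩
    · exact .inl ⟨mem_circuits (.of₀ (.ofS _ hu)), S u,
        mem_circuits (.of₀ (.ofS u (by rwa [mem_low]))), gate_low_one _ _⟩
  | ofZp u hu =>
    revert hu
    refine Fin.lastCases (fun hu => ?_) (fun u hu => ?_) u
    · exact .inr ⟨hu, .inr (.inl rfl)⟩
    · exact .inl ⟨mem_circuits (.of₀ (.ofZp _ hu)), Zp u,
        mem_circuits (.of₀ (.ofZp u (by rwa [mem_low]))), gate_low_one _ _⟩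
  | ofCZ u v hu hv =>
    revert hu hv
    refine Fin.lastCases (fun hu => ?_) (fun u hu => ?_) u <;>
      refine Fin.lastCases (fun hv => ?_) (fun v hv => ?_) v
    · rw [CZ_self]; exact .inl (one_mem _)
    · exact .inr ⟨hu, .inr (.inr ⟨_, hv, Fin.castSucc_ne_last v, rfl⟩)⟩
    · exact .inr ⟨hv, .inr (.inr ⟨_, hu, Fin.castSucc_ne_last u, CZ_symm _ _⟩)⟩
    · exact .inl ⟨mem_circuits (.of₀ (.ofCZ _ _ hu hv)), CZ u v,
        mem_circuits (.of₀ (.ofCZ u v (by rwa [mem_low]) (by rwa [mem_low]))), gate_low_two _ _ _⟩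

theorem CX_low {D : Finset (Fin (n + 1))} {u v : Fin (n + 1)} (hu : u ∉ D) (hv : v ∈ D)
    (hu' : u ≠ Fin.last n) (hv' : v ≠ Fin.last n) : CX u v ∈ lowCircuits D := by
  obtain ⟨u, rfl⟩ := Fin.exists_castSucc_eq.2 hu'
  obtain ⟨v, rfl⟩ := Fin.exists_castSucc_eq.2 hv'
  exact ⟨mem_circuits (.of₀ (.ofCX _ _ hu hv)), CX u v,
    mem_circuits (.of₀ (.ofCX u v (by rwa [mem_low]) (by rwa [mem_low]))), gate_low_two _ _ _⟩

theorem X_low {D : Finset (Fin (n + 1))} {v : Fin (n + 1)} (hv : v ∈ D) (hv' : v ≠ Fin.last n) :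
    X v ∈ lowCircuits D := by
  obtain ⟨v, rfl⟩ := Fin.exists_castSucc_eq.2 hv'
  exact ⟨mem_circuits (.ofX _ hv), X v, mem_circuits (.ofX v (by rwa [mem_low])), gate_low_one _ _⟩

/-- Separates the gates that touch a chosen wire from those that do not; used repeatedly to isolate
the wire being eliminated. -/
theorem closure_split {M : Type*} [Monoid M] {s t₁ t₂ : Set M} (hs : ∀ a ∈ s, a ∈ t₁ ∨ a ∈ t₂)
    (hc : ∀ a ∈ t₁, ∀ b ∈ t₂, Commute a b) {a : M} (ha : a ∈ Submonoid.closure s) :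
    ∃ x ∈ Submonoid.closure t₁, ∃ y ∈ Submonoid.closure t₂, a = x * y := by
  induction ha using Submonoid.closure_induction with
  | mem a ha =>
    rcases hs a ha with h | h
    · exact ⟨a, Submonoid.subset_closure h, 1, one_mem _, (mul_one a).symm⟩
    · exact ⟨1, one_mem _, a, Submonoid.subset_closure h, (one_mul a).symm⟩
  | one => exact ⟨1, one_mem _, 1, one_mem _, (mul_one 1).symm⟩
  | mul a b _ _ iha ihb =>
    obtain ⟨x, hx, y, hy, rfl⟩ := iha
    obtain ⟨x', hx', y', hy', rfl⟩ := ihb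
    refine ⟨x * x', mul_mem hx hx', y * y', mul_mem hy hy', ?_⟩
    rw [mul_assoc x, ← mul_assoc y, ← (closure_commute hc hx' hy).eq]
    simp only [mul_assoc]

/-- Either one of the generators `f i` of order three occurs, or none does. -/
theorem closure_extract {M ι : Type*} [Monoid M] [DecidableEq ι] {s : Set M} {f : ι → M}
    (h3 : ∀ i, f i ^ 3 = 1) (I : Finset ι) (hs : ∀ i ∈ I, ∀ a ∈ s, Commute (f i) a)
    (hf : ∀ i ∈ I, ∀ j ∈ I, Commute (f i) (f j)) {a : M}
    (ha : a ∈ Submonoid.closure (s ∪ f '' I)) :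
    a ∈ Submonoid.closure s ∨ ∃ i ∈ I, ∃ k : ℕ, (k = 1 ∨ k = 2) ∧
      ∃ b ∈ Submonoid.closure (s ∪ f '' (I.erase i)), a = f i ^ k * b := by
  induction I using Finset.induction generalizing a with
  | empty => left; simpa using ha
  | insert i I hi ih =>
    have hsub : ∀ j, I.erase j ⊆ (insert i I).erase j := fun j =>
      Finset.erase_subset_erase _ (Finset.subset_insert _ _)
    obtain ⟨x, hx, y, hy, rfl⟩ := closure_split (t₁ := {f i}) (t₂ := s ∪ f '' I)
      (fun a ha => by
        rcases ha with ha | ⟨j, hj, rfl⟩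
        · exact .inr (.inl ha)
        · rcases Finset.mem_insert.1 hj with rfl | hj
          · exact .inl rfl
          · exact .inr (.inr ⟨j, hj, rfl⟩))
      (fun a ha b hb => by
        rw [Set.mem_singleton_iff.1 ha]
        rcases hb with hb | ⟨j, hj, rfl⟩
        · exact hs i (Finset.mem_insert_self _ _) b hb
        · exact hf i (Finset.mem_insert_self _ _) j (Finset.mem_insert_of_mem hj)) ha
    obtain ⟨k, rfl⟩ := Submonoid.mem_closure_singleton.1 hx
    have hk : f i ^ k = f i ^ (k % 3) := by
      conv_lhs => rw [← Nat.div_add_mod k 3, pow_add, pow_mul, h3, one_pow, one_mul]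
    have hlt := Nat.mod_lt k three_pos
    by_cases hk0 : k % 3 = 0
    · rw [hk, hk0, pow_zero, one_mul]
      rcases ih (fun i hi => hs i (Finset.mem_insert_of_mem hi))
        (fun i hi j hj => hf i (Finset.mem_insert_of_mem hi) j (Finset.mem_insert_of_mem hj)) hy with
        h | ⟨j, hj, m, hm, b, hb, e⟩
      · exact .inl h
      · exact .inr ⟨j, Finset.mem_insert_of_mem hj, m, hm, b, Submonoid.closure_mono
          (Set.union_subset_union_right _ (Set.image_mono (by exact_mod_cast hsub j))) hb, e⟩
    · refine .inr ⟨i, Finset.mem_insert_self _ _, k % 3, by omega, y, ?_, by rw [hk]⟩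
      rwa [Finset.erase_insert hi]

/-! ### The last wire is prepared in `|0⟩` -/

/-- The frame is chosen to fix the last wire, so that `cx` sits directly before the effect and
`cx_plus_effect` applies. -/
theorem CX_drop (u : Fin n) : CX u.castSucc (Fin.last n) ▷ drop n = drop n := by
  obtain ⟨k, e, he⟩ := exists_frame ![u] (Function.injective_of_subsingleton _)
  let e' : Fin (n + 1) ≃ Fin (k + 2) :=
    finSumFinEquiv.symm.trans ((e.sumCongr (Equiv.refl (Fin 1))).trans finSumFinEquiv)
  have he' : (perm e' : Mor (n + 1) (k + 2)) = perm e ⊠ 𝐈 := (perm_tens _ _).symm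
  have hs : (perm e'.symm : Mor (k + 2) (n + 1)) = perm e.symm ⊠ 𝐈 :=
    (perm_tens e.symm (Equiv.refl (Fin 1))).symm
  have h1 : CX u.castSucc (Fin.last n) = lift e' cx := by
    refine gate_eq_lift _ _ _ fun j => ?_
    fin_cases j
    · have h2 := he 0
      have h3 : finSumFinEquiv.symm u.castSucc = Sum.inl u := by
        rw [Equiv.symm_apply_eq]; rfl
      simp only [Matrix.cons_val_fin_one] at h2
      simp only [e', Equiv.trans_apply, Fin.zero_eta, Matrix.cons_val_zero, h3, Equiv.sumCongr_apply,
        Sum.map_inl, h2]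
      rfl
    · have h3 : finSumFinEquiv.symm (Fin.last n) = Sum.inr (0 : Fin 1) := by
        rw [Equiv.symm_apply_eq]; rfl
      simp only [e', Equiv.trans_apply]
      simp only [Fin.mk_one, Matrix.cons_val_one, Matrix.cons_val_fin_one, h3,
        Equiv.sumCongr_apply, Sum.map_inr]
      rfl
  have h2 : (one k ⊠ cx) ▷ (one k ⊠ (𝐈 ⊠ eff1)) = one k ⊠ (𝐈 ⊠ eff1) := by
    rw [← one_tens_comp]
    congr 1
    exact cx_plus_effect
  have h3 : one k ⊠ (𝐈 ⊠ eff1) = drop (k + 1) := by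
    refine (eq_of_heq (tens_assoc_heq (one k) 𝐈 eff1)).symm.trans ?_
    rw [one_tens_one]; rfl
  have h4 : ∀ {m m' : ℕ} (f : Mor m m'), (f ⊠ 𝐈) ▷ drop m' = drop m ▷ f := fun f => by
    have h := slide f eff1
    rw [tens_one_zero] at h
    exact h
  rw [h1, lift, hs, comp_assoc, h4, ← comp_assoc, he']
  have h5 : (perm e ⊠ 𝐈) ▷ (one k ⊠ cx) ▷ drop (k + 1) = drop n ▷ perm e := by
    rw [comp_assoc, ← h3, h2, h3, h4]
  rw [h5, comp_assoc, perm_comp_symm, comp_one]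

theorem X_drop : X (Fin.last n) ▷ drop n = drop n := by
  rw [X, gate_last, drop, ← one_tens_comp, rph_effect]

/-- If the last wire lies in D, the gates touching it are sums into it and shifts of it. Both are
absorbed by ⟨+|, and what remains is the non-zero scalar ⟨+|0⟩. -/
theorem NF.drop_of_mem {D : Finset (Fin (n + 1))} {t : Mor 0 (n + 1)} (h : NF D t)
    (hl : Fin.last n ∈ D) : NF (low D) (t ▷ drop n) := by
  obtain ⟨g, hg, rfl⟩ := h
  obtain ⟨x, hx, y, hy, rfl⟩ := closure_split (t₁ := lowCircuits D)
    (t₂ := {a | IsGate D a ∧ a ▷ drop n = drop n})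
    (fun a ha => by
      have ha' : IsGate D a := ha
      cases ha' with
      | of₀ h => cases h with
        | ofS u hu => exact (IsDiagGate.ofS u hu).low_or.imp id fun h => absurd hl h.1
        | ofZp u hu => exact (IsDiagGate.ofZp u hu).low_or.imp id fun h => absurd hl h.1
        | ofCZ u v hu hv => exact (IsDiagGate.ofCZ u v hu hv).low_or.imp id fun h => absurd hl h.1
        | ofCX u v hu hv =>
          have hu' : u ≠ Fin.last n := fun e => hu (e ▸ hl)
          by_cases hv' : v = Fin.last n
          · obtain ⟨u, rfl⟩ := Fin.exists_castSucc_eq.2 hu'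
            exact .inr ⟨ha, by rw [hv', CX_drop]⟩
          · exact .inl (CX_low hu hv hu' hv')
      | ofX v hv =>
        by_cases hv' : v = Fin.last n
        · exact .inr ⟨ha, by rw [hv', X_drop]⟩
        · exact .inl (X_low hv hv'))
    (fun a ha b hb => circuits_commute ha.1 (mem_circuits hb.1)) hg
  rw [Submonoid.closure_eq] at hx
  obtain ⟨-, b, hb, rfl⟩ := hx
  have hy' : y ▷ drop n = drop n := by
    clear hg
    induction hy using Submonoid.closure_induction with
    | mem a ha => exact ha.2
    | one => exact one_comp _
    | mul x y _ _ hx hy => rw [mul_def, comp_assoc, hy, hx]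
  have h1 := interchange (base (low D)) b (plus1 ▷ H) 𝐈
  have h2 := interchange (base (low D) ▷ b) (one n) (plus1 ▷ H) eff1
  rw [comp_one] at h1 h2
  have h3 : (plus1 ▷ H) ▷ eff1 = one 0 := zero_effect
  rw [h3, tens_one_zero] at h2
  refine ⟨b, hb, ?_⟩
  rw [comp_assoc, mul_def, comp_assoc, hy', base_low, prep_of_mem hl, ← comp_assoc]
  exact (congrArg (fun f => f ▷ drop n) h1).trans h2

end Elimination
end Mor
end QutritZX
end

/-! ### Pivoting a wire into D, and summing out a single link -/

noncomputable section
namespace QutritZX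
open Diag
namespace Mor

section Elimination

local notation "𝐈" => one 1

variable {n : ℕ}

/-! ### Pivoting towards the previous case -/

/-- After the pivot the old gates need not be gates of the new normal form, so they are applied anew
through `NF.diag`, `NF.X` and `NF.CX`. A sum controlled by `l` now has its control in the new D,
hence the condition that its target is in D and differs from `v`. -/
theorem NF.pivot {D : Finset (Fin n)} {l v : Fin n} (hl : l ∉ D) (hv : v ∈ D) {k : ℕ}
    (hk : k = 1 ∨ k = 2) {g : Mor n n}
    (hg : g ∈ Submonoid.closure {a | IsDiagGate ∅ a ∨ (∃ u, a = Mor.X u) ∨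
      ∃ u w, u ∉ D ∧ (u = l → w ∈ D ∧ w ≠ v) ∧ a = Mor.CX u w}) :
    NF (insert l (D.erase v)) (base D ▷ Mor.CX l v ^ k ▷ g) := by
  have hlv : l ≠ v := fun e => hl (e ▸ hv)
  have hv' : v ∉ insert l (D.erase v) := by simp [hlv.symm]
  have hc : Mor.CX v l ∈ circuits (insert l (D.erase v)) :=
    mem_circuits (.of₀ (.ofCX v l hv' (Finset.mem_insert_self _ _)))
  have h0 : NF (insert l (D.erase v)) (base D ▷ Mor.CX l v ^ k) := by
    rcases hk with rfl | rfl
    · rw [pow_one, base_pivot hl hv]; exact ⟨_, hc, rfl⟩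
    · rw [base_pivot_sq hl hv]; exact ⟨_, pow_mem hc 2, rfl⟩
  generalize base D ▷ Mor.CX l v ^ k = t at h0
  induction hg using Submonoid.closure_induction generalizing t with
  | mem a ha =>
    rcases ha with ha | ⟨u, rfl⟩ | ⟨u, w, hu, hw, rfl⟩
    · exact h0.diag (mem_diagCircuits ha)
    · exact h0.X u
    · refine h0.CX fun h => ?_
      rcases Finset.mem_insert.1 h with h | h
      · exact Finset.mem_insert_of_mem (Finset.mem_erase.2 ⟨(hw h).2, (hw h).1⟩)
      · exact absurd (Finset.mem_of_mem_erase h) hu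
  | one => exact (comp_one t).symm ▸ h0
  | mul x y _ _ hx hy =>
    have := hy _ (hx _ h0)
    rwa [comp_assoc] at this

/-! ### Effects on phases -/

theorem ph_pow (a b : ZMod 3) (k : ℕ) : ph a b ^ k = ph (k * a) (k * b) := by
  induction k with
  | zero => simp only [pow_zero, Nat.cast_zero, zero_mul]; exact ph_zero.symm
  | succ k ih =>
    rw [pow_succ, ih, mul_def, ph_comp]
    congr 1 <;> push_cast <;> ring

/-- Solves s + z = a and s + 2z = b over ℤ₃; the exponents are those of the quadratic phase ω^(x²)
and the linear phase ω^x. -/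
theorem ph_eq (a b : ZMod 3) :
    ph a b = ph 1 1 ^ (2 * a - b).val * ph 1 2 ^ (b - a).val := by
  rw [ph_pow, ph_pow, mul_def, ph_comp]
  simp only [ZMod.natCast_val, ZMod.cast_id', id]
  congr 1
  · ring
  · ring

theorem plus_ph_rph (a b : ZMod 3) (k : ℕ) :
    ∃ c d, plus1 ▷ (ph a b ▷ rph 1 2 ^ k) = plus1 ▷ ph c d := by
  induction k generalizing a b with
  | zero => exact ⟨a, b, congrArg _ (comp_one _)⟩
  | succ k ih =>
    obtain ⟨c, d, h⟩ := ih (b - a) (-a)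
    refine ⟨c, d, ?_⟩
    have h1 : ph a b ▷ rph 1 2 = rph 1 2 ▷ ph (b - a) (-a) := by
      rw [rph_ph]; congr 2 <;> ring
    rw [pow_succ', mul_def, ← comp_assoc (ph a b), h1, comp_assoc, ← comp_assoc plus1, plus_rph, h]

/-- The Fourier transform of a quadratic phase. With non-zero quadratic part it is a Gauss sum,
again a quadratic phase; with zero quadratic part it is a shifted |0⟩. -/
theorem plus_ph_H (a b : ZMod 3) : ∃ r, plus1 ▷ (ph a b ▷ H) = plus1 ▷ r ∧
    ((∃ c d, r = ph c d) ∨ ∃ k : ℕ, r = H ▷ rph 1 2 ^ k) := by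
  have hH : ∀ k : ℕ, ph 1 2 ^ k ▷ H = H ▷ rph 1 2 ^ k := fun k =>
    ((show SemiconjBy H (rph 1 2) (ph 1 2) from H_rph 1 2).pow_right k).symm
  have key : ∀ i : ZMod 3, ∀ k : ℕ, ∃ r, plus1 ▷ ((ph 1 1 ^ i.val ▷ ph 1 2 ^ k) ▷ H) = plus1 ▷ r ∧
      ((∃ c d, r = ph c d) ∨ ∃ k : ℕ, r = H ▷ rph 1 2 ^ k) := by
    intro i k
    have hi : i = 0 ∨ i = 1 ∨ i = 2 := by revert i; decide
    rw [comp_assoc, hH]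
    rcases hi with rfl | rfl | rfl
    · exact ⟨_, congrArg _ (one_comp _), .inr ⟨k, rfl⟩⟩
    · obtain ⟨c, d, h⟩ := plus_ph_rph 2 2 k
      refine ⟨ph c d, ?_, .inl ⟨c, d, rfl⟩⟩
      rw [show (1 : ZMod 3).val = 1 from rfl, pow_one, ← h, ← comp_assoc, ← comp_assoc, ← comp_assoc]
      exact congrArg (fun f => f ▷ rph 1 2 ^ k) gauss_one
    · obtain ⟨c, d, h⟩ := plus_ph_rph 1 1 k
      refine ⟨ph c d, ?_, .inl ⟨c, d, rfl⟩⟩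
      have h2 : ph 1 1 ^ 2 = ph 2 2 := by rw [ph_pow]; rfl
      rw [show (2 : ZMod 3).val = 2 from rfl, h2, ← h, ← comp_assoc, ← comp_assoc, ← comp_assoc]
      exact congrArg (fun f => f ▷ rph 1 2 ^ k) gauss_two
  rw [ph_eq]
  exact key _ _

theorem plus_effect : plus1 ▷ eff1 = one 0 := by
  have h1 : plus1 ▷ eff1 = Z 0 0 0 0 := by rw [plus1, eff1, Z_comp one_pos, add_zero]
  rw [h1]
  refine scalar_eq_one (zsp 0 0 0 0) fun h => ?_
  have h2 := congrFun (congrFun h default) default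
  simp [interp, weight, Fin.sum_univ_three] at h2
  norm_num at h2

/-- The class contains a diagram whose interpretation vanishes. -/
def IsZero {n m : ℕ} (t : Mor n m) : Prop := ∃ A, mk A = t ∧ A.interp = 0

theorem IsZero.comp {n m k : ℕ} {t : Mor n m} (h : IsZero t) (f : Mor m k) : IsZero (t ▷ f) := by
  obtain ⟨A, rfl, h⟩ := h
  obtain ⟨B, rfl⟩ := exists_rep f
  exact ⟨seq A B, rfl, by rw [interp, h, Matrix.mul_zero]⟩

/-- Stabilizer states in normal form, or zero. -/
def IsNF (t : Mor 0 n) : Prop := IsZero t ∨ ∃ D, NF D t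

/-- The only source of the zero alternative in `IsNF`: a closed factor of value zero cannot be
dropped. -/
theorem tens_scalar_cases {n m : ℕ} (f : Mor n m) (s : Mor 0 0) : IsZero (f ⊠ s) ∨ f ⊠ s = f := by
  obtain ⟨A, rfl⟩ := exists_rep f
  obtain ⟨B, rfl⟩ := exists_rep s
  by_cases h : B.interp = 0
  · refine .inl ⟨par A B, rfl, ?_⟩
    ext y x
    simp [interp, h]
  · exact .inr (tens_scalar _ B h)

theorem mem_diagCircuits_ph {D : Finset (Fin n)} {u : Fin n} (hu : u ∉ D) (a b : ZMod 3) :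
    gate (ph a b) ![u] ∈ diagCircuits D := by
  rw [ph_eq, ← gateHom_apply, map_mul, map_pow, map_pow]
  exact mul_mem (pow_mem (mem_diagCircuits (.ofS u hu)) _) (pow_mem (mem_diagCircuits (.ofZp u hu)) _)

/-! ### The last wire is prepared in `|+⟩` and linked to another one -/

theorem CZ_sq (i j : Fin n) : CZ i j ^ 2 = gate (cz ^ 2) ![i, j] :=
  (map_pow (gateHom ![i, j]) cz 2).symm

/-- Summing out the last wire through one link is a Fourier transform (H or H† according to k) of
its phase, delivered to wire `u`. -/
theorem link_elim {D : Finset (Fin (n + 1))} (hl : Fin.last n ∉ D) {u : Fin n}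
    (hu : u.castSucc ∉ D) {k : ℕ} (hk : k = 1 ∨ k = 2) (a b : ZMod 3) :
    ∃ r, base D ▷ (CZ (Fin.last n) u.castSucc ^ k * gate (ph a b) ![Fin.last n]) ▷ drop n =
        base (low D) ▷ gate r ![u] ∧ ((∃ c d, r = ph c d) ∨ ∃ k : ℕ, r = H ▷ rph 1 2 ^ k) := by
  have hne : Fin.last n ≠ u.castSucc := (Fin.castSucc_ne_last u).symm
  obtain ⟨A, hA, r, hr, hr'⟩ : ∃ A, CZ (Fin.last n) u.castSucc ^ k = gate A ![Fin.last n, u.castSucc] ∧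
      ∃ r, plus2 ▷ (A ▷ ((ph a b ▷ eff1) ⊠ 𝐈)) = plus1 ▷ r ∧
        ((∃ c d, r = ph c d) ∨ ∃ k : ℕ, r = H ▷ rph 1 2 ^ k) := by
    rcases hk with rfl | rfl
    · obtain ⟨r, h, h'⟩ := plus_ph_H a b
      exact ⟨cz, pow_one _, r, by rw [plus2_cz_effect, h], h'⟩
    · obtain ⟨r, h, h'⟩ := plus_ph_H b a
      exact ⟨cz ^ 2, CZ_sq _ _, r, by rw [plus2_cz_sq_effect, plus_phase_H', h], h'⟩
  refine ⟨r, ?_, hr'⟩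
  -- Inserting |+⟩ after ⟨+|, harmless since ⟨+|+⟩ ≠ 0, makes the effect a gate with as many outputs
  -- as inputs, to which `base_gate_two` applies.
  have hpp : drop n = gate (eff1 ▷ plus1) ![Fin.last n] ▷ drop n := by
    rw [gate_last, drop, ← one_tens_comp, comp_assoc, plus_effect, comp_one]
  have h1 : base D ▷ gate (A ▷ ((ph a b ▷ (eff1 ▷ plus1)) ⊠ 𝐈)) ![Fin.last n, u.castSucc] =
      base D ▷ gate (𝐈 ⊠ r) ![Fin.last n, u.castSucc] := by
    refine base_gate_two hne ?_
    rw [prep_of_notMem hl, prep_of_notMem hu, one_tens_one]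
    have h2 : (ph a b ▷ (eff1 ▷ plus1)) ⊠ 𝐈 = ((ph a b ▷ eff1) ⊠ 𝐈) ▷ (plus1 ⊠ 𝐈) := by
      rw [← tens_comp_one, comp_assoc]
    have h3 : (plus1 ▷ r) ▷ (plus1 ⊠ 𝐈) = plus2 ▷ (𝐈 ⊠ r) := by
      have h4 := tens_eq' plus1 (plus1 ▷ r)
      rw [eq_of_heq (one_zero_tens_heq (plus1 ▷ r))] at h4
      rw [plus2, interchange, comp_one]
      exact h4.symm
    rw [h2, ← comp_assoc A, one_comp, ← comp_assoc plus2, hr, h3]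
    exact congrArg (plus2 ▷ ·) (one_comp _).symm
  rw [hA, hpp, comp_assoc, ← comp_assoc _ _ (drop n), mul_def, comp_assoc (gate A _), ← gate_comp,
    ← gate_left _ hne, ← gate_comp, ← comp_assoc, h1, gate_right _ hne, gate_low_one, comp_assoc, tens_drop,
    ← comp_assoc, base_low, prep_of_notMem hl, comp_one]
  have h5 := interchange (base (low D)) (one n) plus1 eff1
  rw [plus_effect, tens_one_zero, comp_one] at h5
  exact congrArg (fun f => f ▷ gate r ![u]) h5

/-- A phase leaves `u` outside the new set, while a shifted |0⟩ adds `u` to it. In both cases the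
pending sums into `u` and all old gates satisfy the hypothesis of `NF.CX`. -/
theorem NF.link_elim {D : Finset (Fin n)} {u : Fin n} (hu : u ∉ D) {r : Mor 1 1}
    (hr : (∃ c d, r = ph c d) ∨ ∃ k : ℕ, r = H ▷ rph 1 2 ^ k) {x y : Mor n n}
    (hx : x ∈ Submonoid.closure {a | ∃ w, w ∉ D ∧ a = Mor.CX w u}) (hy : y ∈ circuits D) :
    ∃ E, NF E (base D ▷ gate r ![u] ▷ (x * y)) := by
  obtain ⟨E, hE, hD, h0⟩ : ∃ E : Finset (Fin n), E ⊆ insert u D ∧ D ⊆ E ∧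
      NF E (base D ▷ gate r ![u]) := by
    rcases hr with ⟨c, d, rfl⟩ | ⟨k, rfl⟩
    · exact ⟨D, Finset.subset_insert _ _, subset_rfl, _,
        diagCircuits_le (mem_diagCircuits_ph hu c d), rfl⟩
    · refine ⟨insert u D, subset_rfl, Finset.subset_insert _ _,
        Mor.X u ^ k, pow_mem (mem_circuits (.ofX u (Finset.mem_insert_self _ _))) k, ?_⟩
      rw [gate_comp, base_insert hu, comp_assoc]
      congr 2
      exact map_pow (gateHom ![u]) (rph 1 2) k
  refine ⟨E, ?_⟩
  have hx' : ∀ t, NF E t → NF E (t ▷ x) := by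
    induction hx using Submonoid.closure_induction with
    | mem a ha =>
      obtain ⟨w, hw, rfl⟩ := ha
      intro t ht
      refine ht.CX fun h => ?_
      rcases Finset.mem_insert.1 (hE h) with rfl | h'
      · exact h
      · exact absurd h' hw
    | one => exact fun t ht => (comp_one t).symm ▸ ht
    | mul x y _ _ hx hy =>
      intro t ht
      have := hy _ (hx _ ht)
      rwa [comp_assoc] at this
  have hy' : ∀ t, NF E t → NF E (t ▷ y) := by
    induction hy using Submonoid.closure_induction with
    | mem a ha =>
      intro t ht
      have ha' : IsGate D a := ha
      cases ha' with
      | of₀ h => cases h with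
        | ofS w _ => exact ht.diag (mem_diagCircuits (.ofS w (Finset.notMem_empty _)))
        | ofZp w _ => exact ht.diag (mem_diagCircuits (.ofZp w (Finset.notMem_empty _)))
        | ofCZ w w' _ _ =>
          exact ht.diag (mem_diagCircuits (.ofCZ w w' (Finset.notMem_empty _)
            (Finset.notMem_empty _)))
        | ofCX w v _ hv => exact ht.CX fun _ => hD hv
      | ofX v _ => exact ht.X v
    | one => exact fun t ht => (comp_one t).symm ▸ ht
    | mul x y _ _ hx hy =>
      intro t ht
      have := hy _ (hx _ ht)
      rwa [comp_assoc] at this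
  have := hy' _ (hx' _ h0)
  rwa [comp_assoc] at this

end Elimination
end Mor
end QutritZX
end

/-! ### The effect ⟨+| on a wire prepared in |+⟩ -/

noncomputable section
namespace QutritZX
open Diag
namespace Mor

section Elimination

local notation "𝐈" => one 1

variable {n : ℕ}

/-! ### The last wire is prepared in `|+⟩` -/

theorem IsDiagGate.mono {D E : Finset (Fin n)} (hED : E ⊆ D) {a : Mor n n} (h : IsDiagGate D a) :
    IsDiagGate E a := by
  cases h with
  | ofS u hu => exact .ofS u fun h => hu (hED h)
  | ofZp u hu => exact .ofZp u fun h => hu (hED h)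
  | ofCZ u v hu hv => exact .ofCZ u v (fun h => hu (hED h)) fun h => hv (hED h)

theorem tens_wire_mul (a b : Mor n n) : (a * b) ⊠ 𝐈 = (a ⊠ 𝐈) * (b ⊠ 𝐈) := tens_comp_one 1 a b

theorem tens_wire_pow (a : Mor n n) (k : ℕ) : a ^ k ⊠ 𝐈 = (a ⊠ 𝐈) ^ k := by
  induction k with
  | zero => exact one_tens_one n 1
  | succ k ih => rw [pow_succ, tens_wire_mul, ih, pow_succ]

theorem tens_wire_commute (a : Mor n n) (b : Mor 1 1) :
    Commute (a ⊠ 𝐈) (gate b ![Fin.last n]) := by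
  rw [gate_last, commute_iff_eq, mul_def, mul_def, interchange, interchange, one_comp, comp_one,
    one_comp, comp_one]

/-- Links of the last wire are merged into one of them by controlled sums of the other wires. -/
theorem merge_links {D : Finset (Fin (n + 1))} {u : Fin n} (hu : u.castSucc ∉ D) {k : ℕ}
    (hk : k = 1 ∨ k = 2) {s : Set (Mor (n + 1) (n + 1))}
    (hs : s = {a | ∃ w : Fin n, w ≠ u ∧ w.castSucc ∉ D ∧ a = CZ (Fin.last n) w.castSucc})
    {o : Mor (n + 1) (n + 1)} (ho : o ∈ Submonoid.closure s) :
    ∃ c ∈ Submonoid.closure {a | ∃ w, w ∉ low D ∧ a = CX w u},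
      ∃ c' ∈ Submonoid.closure {a | ∃ w, w ∉ low D ∧ a = CX w u},
      c * c' = 1 ∧ base (low D) ▷ c = base (low D) ∧
      SemiconjBy (c ⊠ 𝐈) (CZ (Fin.last n) u.castSucc ^ k)
        (CZ (Fin.last n) u.castSucc ^ k * o) ∧
      ∀ a ∈ Submonoid.closure s, Commute (c ⊠ 𝐈) a := by
  have hul : ∀ w : Fin n, w.castSucc ≠ Fin.last n := Fin.castSucc_ne_last
  induction ho using Submonoid.closure_induction with
  | mem a ha =>
    subst hs
    obtain ⟨w, hwu, hw, rfl⟩ := ha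
    have hwu' : w.castSucc ≠ u.castSucc := fun e => hwu (Fin.castSucc_injective n e)
    have hw' : w ∉ low D := by rwa [mem_low]
    have hu' : u ∉ low D := by rwa [mem_low]
    have hmem : CX w u ∈ Submonoid.closure {a | ∃ w, w ∉ low D ∧ a = CX w u} :=
      Submonoid.subset_closure ⟨w, hw', rfl⟩
    have hb : base (low D) ▷ CX w u = base (low D) := base_CX (.inr ⟨hw', hu'⟩)
    have hA : CX w u ⊠ 𝐈 = CX w.castSucc u.castSucc := (gate_low_two cx w u).symm
    have h1 : SemiconjBy (CX w.castSucc u.castSucc) (CZ (Fin.last n) u.castSucc)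
        (CZ (Fin.last n) u.castSucc * CZ (Fin.last n) w.castSucc) := by
      have := CX_CZ_next hwu' (hul w) (hul u)
      rwa [CZ_symm u.castSucc, CZ_symm w.castSucc] at this
    have hc : ∀ w' : Fin n, w' ≠ u →
        Commute (CX w.castSucc u.castSucc) (CZ (Fin.last n) w'.castSucc) := by
      intro w' hw'
      rw [CZ_symm]
      by_cases e : w = w'
      · subst e; exact CX_CZ_control hwu' (hul u)
      · exact gate2_commute _ _ (fun h => e (Fin.castSucc_injective n h)) (hul w)
          (fun h => hw' (Fin.castSucc_injective n h).symm) (hul u)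
    -- Substituting y + kx in a link of weight k creates an extra link of weight k², which is 1
    -- modulo 3; the exponent 2k gives the inverse.
    refine ⟨CX w u ^ k, pow_mem hmem k, CX w u ^ (2 * k), pow_mem hmem _, ?_, ?_, ?_, ?_⟩
    · rw [← pow_add, show k + 2 * k = 3 * k by ring, pow_mul, CX_three, one_pow]
    · rcases hk with rfl | rfl
      · rw [pow_one, hb]
      · rw [pow_two, mul_def, ← comp_assoc, hb, hb]
    · rw [tens_wire_pow, hA]
      rcases hk with rfl | rfl
      · simpa only [pow_one] using h1
      · have hcc := CZ_CZ_commute (Fin.last n) u.castSucc (Fin.last n) w.castSucc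
        have h2 := h1.pow_right 2
        rw [hcc.mul_pow] at h2
        have h3 := h2.mul_right ((hc w hwu).pow_right 2)
        have h4 := h3.mul_left h2
        rw [mul_assoc, ← pow_add, show 2 + 2 = 3 + 1 from rfl, pow_succ (CZ _ _) 3, CZ_three,
          one_mul] at h4
        rwa [pow_two (CX _ _)]
    · intro a ha
      rw [tens_wire_pow, hA]
      refine Commute.pow_left ?_ k
      induction ha using Submonoid.closure_induction with
      | mem a ha =>
        obtain ⟨w', hw', -, rfl⟩ := ha
        exact hc w' hw'
      | one => exact Commute.one_right _
      | mul x y _ _ hx hy => exact hx.mul_right hy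
  | one =>
    refine ⟨1, one_mem _, 1, one_mem _, one_mul 1, comp_one _, ?_, fun a _ => ?_⟩
    · rw [mul_one, one_def, one_tens_one]; exact SemiconjBy.one_left _
    · rw [one_def, one_tens_one]; exact Commute.one_left _
  | mul x y hx hy ihx ihy =>
    obtain ⟨c, hc, c', hc', h1, h2, h3, h4⟩ := ihx
    obtain ⟨d, hd, d', hd', g1, g2, g3, g4⟩ := ihy
    refine ⟨c * d, mul_mem hc hd, d' * c', mul_mem hd' hc', ?_, ?_, ?_, fun a ha => ?_⟩
    · rw [mul_assoc, ← mul_assoc d, g1, one_mul, h1]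
    · rw [mul_def, ← comp_assoc, h2, g2]
    · rw [tens_wire_mul, ← mul_assoc]
      exact (h3.mul_right (h4 y hy)).mul_left g3
    · rw [tens_wire_mul]
      exact (h4 a ha).mul_left (g4 a ha)

theorem closure_phases {u : Fin n} {q : Mor n n} (hq : q ∈ Submonoid.closure {S u, Zp u}) :
    ∃ a b, q = gate (ph a b) ![u] := by
  induction hq using Submonoid.closure_induction with
  | mem a ha =>
    rcases ha with rfl | rfl
    · exact ⟨_, _, rfl⟩
    · exact ⟨_, _, rfl⟩
  | one => exact ⟨0, 0, by rw [ph_zero, gate_one]; rfl⟩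
  | mul x y _ _ hx hy =>
    obtain ⟨a, b, rfl⟩ := hx
    obtain ⟨c, d, rfl⟩ := hy
    exact ⟨a + c, b + d, by rw [mul_def, ← gate_comp, ph_comp]⟩

theorem base_low_drop {D : Finset (Fin (n + 1))} (hl : Fin.last n ∉ D) (a b : ZMod 3)
    (g : Mor n n) : base D ▷ ((g ⊠ 𝐈) * gate (ph a b) ![Fin.last n]) ▷ drop n =
      (base (low D) ▷ g) ⊠ (plus1 ▷ (ph a b ▷ eff1)) := by
  have h1 := interchange (base (low D)) g plus1 (ph a b)
  have h2 := interchange (base (low D) ▷ g) (one n) (plus1 ▷ ph a b) eff1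
  have h3 := interchange g (one n) 𝐈 (ph a b)
  rw [comp_one, one_comp] at h3
  rw [base_low, prep_of_notMem hl, comp_one, gate_last, mul_def, h3]
  refine (congrArg (fun f => f ▷ drop n) h1).trans ?_
  rw [comp_one, comp_assoc plus1] at h2
  exact h2

/-- The case split is on how the last coordinate enters: through the linear map (pivot), through no
other coordinate (a scalar), or through bilinear phase terms (merge them and sum out). -/
theorem NF.drop_of_notMem {D : Finset (Fin (n + 1))} {t : Mor 0 (n + 1)} (h : NF D t)
    (hl : Fin.last n ∉ D) : IsNF (t ▷ drop n) := by
  obtain ⟨g, hg, rfl⟩ := h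
  set s : Set (Mor (n + 1) (n + 1)) := {a | IsDiagGate D a ∨ (∃ v ∈ D, a = Mor.X v) ∨
    ∃ u ∉ D, ∃ v ∈ D, u ≠ Fin.last n ∧ a = Mor.CX u v} with hs
  have hsg : ∀ a ∈ s, IsGate D a := by
    rintro a (ha | ⟨v, hv, rfl⟩ | ⟨u, hu, v, hv, -, rfl⟩)
    · exact .of₀ ha.isGate₀
    · exact .ofX v hv
    · exact .of₀ (.ofCX u v hu hv)
  have hfg : ∀ v ∈ D, IsGate D (Mor.CX (Fin.last n) v) := fun v hv => .of₀ (.ofCX _ v hl hv)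
  have hg' : g ∈ Submonoid.closure (s ∪ Mor.CX (Fin.last n) '' D) := by
    refine Submonoid.closure_mono (fun a ha => ?_) hg
    have ha' : IsGate D a := ha
    cases ha' with
    | of₀ h => cases h with
      | ofS u hu => exact .inl (.inl (.ofS u hu))
      | ofZp u hu => exact .inl (.inl (.ofZp u hu))
      | ofCZ u v hu hv => exact .inl (.inl (.ofCZ u v hu hv))
      | ofCX u v hu hv =>
        by_cases e : u = Fin.last n
        · subst e; exact .inr ⟨v, hv, rfl⟩
        · exact .inl (.inr (.inr ⟨u, hu, v, hv, e, rfl⟩))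
    | ofX v hv => exact .inl (.inr (.inl ⟨v, hv, rfl⟩))
  -- If the last wire controls a sum into `v`, pivoting puts it in place of `v` in D, which reduces
  -- to `NF.drop_of_mem`.
  rcases closure_extract (CX_three (Fin.last n)) D (fun i hi a ha => (hfg i hi).commute (hsg a ha))
    (fun i hi j hj => (hfg i hi).commute (hfg j hj)) hg' with hg1 | ⟨v, hv, k, hk, b, hb, rfl⟩
  swap
  · have h1 := NF.pivot hl hv hk (g := b) (Submonoid.closure_mono (fun a ha => by
      rcases ha with (ha | ⟨w, -, rfl⟩ | ⟨u, hu, w, -, hul, rfl⟩) | ⟨w, hw, rfl⟩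
      · exact .inl (ha.mono (Finset.empty_subset _))
      · exact .inr (.inl ⟨w, rfl⟩)
      · exact .inr (.inr ⟨u, w, hu, fun e => absurd e hul, rfl⟩)
      · have hw' := Finset.mem_erase.1 (Finset.mem_coe.1 hw)
        exact .inr (.inr ⟨_, w, hl, fun _ => ⟨hw'.2, hw'.1⟩, rfl⟩)) hb)
    rw [comp_assoc] at h1
    exact .inr ⟨_, h1.drop_of_mem (Finset.mem_insert_self _ _)⟩
  set sP : Set (Mor (n + 1) (n + 1)) := {Mor.S (Fin.last n), Mor.Zp (Fin.last n)} with hsP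
  set sL : Set (Mor (n + 1) (n + 1)) :=
    {a | ∃ w : Fin n, w.castSucc ∉ D ∧ a = Mor.CZ (Fin.last n) w.castSucc} with hsL
  have hP : ∀ a ∈ sP, IsGate D a := by
    rintro a (rfl | rfl)
    · exact .of₀ (.ofS _ hl)
    · exact .of₀ (.ofZp _ hl)
  have hL : ∀ a ∈ sL, IsGate D a := by
    rintro a ⟨w, hw, rfl⟩
    exact .of₀ (.ofCZ _ _ hl hw)
  obtain ⟨x, hx, y, hy, rfl⟩ := closure_split (t₁ := lowCircuits D) (t₂ := sP ∪ sL)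
    (fun a ha => by
      rcases ha with ha | ⟨v, hv, rfl⟩ | ⟨u, hu, v, hv, hul, rfl⟩
      · refine ha.low_or.imp id ?_
        rintro ⟨-, rfl | rfl | ⟨w, hw, hwl, rfl⟩⟩
        · exact .inl (.inl rfl)
        · exact .inl (.inr rfl)
        · obtain ⟨w, rfl⟩ := Fin.exists_castSucc_eq.2 hwl
          exact .inr ⟨w, hw, rfl⟩
      · exact .inl (X_low hv fun e => hl (e ▸ hv))
      · exact .inl (CX_low hu hv hul fun e => hl (e ▸ hv)))
    (fun a ha b hb => circuits_commute ha.1 (mem_circuits (hb.elim (hP b) (hL b)))) hg1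
  rw [Submonoid.closure_eq] at hx
  obtain ⟨hxD, b, hb, rfl⟩ := hx
  obtain ⟨q, hq, o, ho, rfl⟩ := closure_split (t₁ := sP) (t₂ := sL) (fun a ha => ha)
    (fun a ha b hb => (hP a ha).commute (hL b hb)) hy
  have hqD : q ∈ circuits D := Submonoid.closure_mono hP hq
  have hoD : o ∈ circuits D := Submonoid.closure_mono hL ho
  obtain ⟨α, β, rfl⟩ := closure_phases hq
  have hL' : ∀ w ∈ Finset.univ.filter fun w : Fin n => w.castSucc ∉ D,
      IsGate D (Mor.CZ (Fin.last n) w.castSucc) := fun w hw =>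
    hL _ ⟨w, (Finset.mem_filter.1 hw).2, rfl⟩
  -- Without links, the last wire contributes only a scalar. Otherwise one non-trivial link power is
  -- singled out, into which the others are to be merged.
  rcases closure_extract (s := ∅) (f := fun w : Fin n => Mor.CZ (Fin.last n) w.castSucc)
    (fun w => CZ_three _ _) (Finset.univ.filter fun w => w.castSucc ∉ D)
    (fun _ _ a ha => ha.elim) (fun i hi j hj => (hL' i hi).commute (hL' j hj))
    (Submonoid.closure_mono (fun a ha => by
      obtain ⟨w, hw, rfl⟩ := ha
      exact .inr ⟨w, by simpa using hw, rfl⟩) ho) with ho1 | ⟨u, hu, k, hk, o', ho', rfl⟩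
  · rw [Submonoid.closure_empty, Submonoid.mem_bot] at ho1
    rw [ho1, mul_one, base_low_drop hl]
    rcases tens_scalar_cases (base (low D) ▷ b) (plus1 ▷ (ph α β ▷ eff1)) with h | h
    · exact .inl h
    · rw [h]; exact .inr ⟨low D, b, hb, rfl⟩
  have hu' : u.castSucc ∉ D := (Finset.mem_filter.1 hu).2
  obtain ⟨c, -, c', hc', h1, h2, h3, -⟩ := merge_links hu' hk (o := o') rfl
    (Submonoid.closure_mono (fun a ha => by
      rcases ha with ha | ⟨w, hw, rfl⟩
      · exact ha.elim
      · have hw' := Finset.mem_erase.1 (Finset.mem_coe.1 hw)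
        exact ⟨w, hw'.1, (Finset.mem_filter.1 hw'.2).2, rfl⟩) ho')
  obtain ⟨r, hr, hr'⟩ := Mor.link_elim hl hu' hk α β
  set P := Mor.CZ (Fin.last n) u.castSucc ^ k
  set q := gate (ph α β) ![Fin.last n]
  -- The change of variables `c` makes one link stand for all. It acts off the last wire; its left
  -- copy is absorbed by the base, and `c'` is applied after the elimination.
  have h4 : P * o' = (c ⊠ 𝐈) * P * (c' ⊠ 𝐈) := by
    rw [h3.eq, mul_assoc, ← tens_wire_mul, h1, one_def, one_tens_one]
    exact (mul_one _).symm
  have h5 : base D ▷ (c ⊠ 𝐈) = base D := by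
    have h := interchange (base (low D)) c (plus1 ▷ prep D (Fin.last n)) 𝐈
    rw [comp_one, h2] at h
    rw [base_low]
    exact h
  have h6 : (b ⊠ 𝐈) * (q * (P * o')) = (c ⊠ 𝐈) * ((P * q) * ((c' * b) ⊠ 𝐈)) := by
    rw [(circuits_commute hxD (mul_mem hqD hoD)).eq, (circuits_commute hqD hoD).eq, h4, tens_wire_mul]
    simp only [mul_assoc]
    rw [← mul_assoc (c' ⊠ 𝐈), (tens_wire_commute c' (ph α β)).eq, mul_assoc]
  have h7 : base D ▷ ((c ⊠ 𝐈) * ((P * q) * ((c' * b) ⊠ 𝐈))) ▷ drop n =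
      base (low D) ▷ gate r ![u] ▷ (c' * b) := by
    rw [← hr, mul_def, ← comp_assoc (base D), h5, mul_def (P * q), ← comp_assoc (base D), comp_assoc _ _ (drop n),
      tens_drop, comp_assoc _ (drop n)]
  rw [h6, h7]
  exact .inr (NF.link_elim (by rwa [mem_low]) hr' hc' hb)

theorem IsNF.drop {t : Mor 0 (n + 1)} (h : IsNF t) : IsNF (t ▷ drop n) := by
  rcases h with h | ⟨D, h⟩
  · exact .inl (h.comp _)
  · by_cases hl : Fin.last n ∈ D
    · exact .inr ⟨_, h.drop_of_mem hl⟩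
    · exact h.drop_of_notMem hl

end Elimination
end Mor
end QutritZX
end

/-! ### Every stabilizer state is in normal form or zero -/

noncomputable section
namespace QutritZX
open Diag
namespace Mor

section Stabilizer

local notation "𝐈" => one 1

variable {n m : ℕ}

/-! ## Normal forms and rearrangements of wires -/

theorem hads_perm (D : Finset (Fin n)) (σ : Fin n ≃ Fin m) :
    hads D ▷ perm σ = perm σ ▷ hads (D.map σ.toEmbedding) := by
  induction D using Finset.induction with
  | empty => exact (one_comp _).trans (comp_one _).symm
  | insert u D hu ih =>
    have hu' : σ.toEmbedding u ∉ D.map σ.toEmbedding := by simpa using hu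
    have h := gate_perm H ![u] σ
    rw [show σ ∘ ![u] = ![σ.toEmbedding u] from by ext i; fin_cases i; rfl] at h
    rw [hads_insert hu, mul_def, Finset.map_insert, hads_insert hu', mul_def, comp_assoc, ih,
      ← comp_assoc, Hd, h, comp_assoc]
    rfl

theorem base_perm (D : Finset (Fin n)) (σ : Fin n ≃ Fin m) :
    base D ▷ perm σ = base (D.map σ.toEmbedding) := by
  rw [base, comp_assoc, hads_perm, ← comp_assoc, plus_perm, base]

theorem IsGate.perm {D : Finset (Fin n)} {a : Mor n n} (h : IsGate D a) (σ : Fin n ≃ Fin m) :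
    ∃ b, IsGate (D.map σ.toEmbedding) b ∧ a ▷ perm σ = perm σ ▷ b := by
  have h1 : ∀ u, σ ∘ ![u] = ![σ u] := fun u => by ext i; fin_cases i; rfl
  have h2 : ∀ u v, σ ∘ ![u, v] = ![σ u, σ v] := fun u v => by ext i; fin_cases i <;> rfl
  have hn : ∀ u ∉ D, σ u ∉ D.map σ.toEmbedding := fun u hu => by simpa using hu
  have hm : ∀ u ∈ D, σ u ∈ D.map σ.toEmbedding := fun u hu => by simpa using hu
  cases h with
  | of₀ h => cases h with
    | ofS u hu => exact ⟨_, .of₀ (.ofS _ (hn u hu)), (gate_perm _ _ σ).trans (by rw [h1]; rfl)⟩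
    | ofZp u hu => exact ⟨_, .of₀ (.ofZp _ (hn u hu)), (gate_perm _ _ σ).trans (by rw [h1]; rfl)⟩
    | ofCZ u v hu hv =>
      exact ⟨_, .of₀ (.ofCZ _ _ (hn u hu) (hn v hv)), (gate_perm _ _ σ).trans (by rw [h2]; rfl)⟩
    | ofCX u v hu hv =>
      exact ⟨_, .of₀ (.ofCX _ _ (hn u hu) (hm v hv)), (gate_perm _ _ σ).trans (by rw [h2]; rfl)⟩
  | ofX v hv => exact ⟨_, .ofX _ (hm v hv), (gate_perm _ _ σ).trans (by rw [h1]; rfl)⟩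

theorem NF.perm {D : Finset (Fin n)} {t : Mor 0 n} (h : NF D t) (σ : Fin n ≃ Fin m) :
    NF (D.map σ.toEmbedding) (t ▷ perm σ) := by
  obtain ⟨g, hg, rfl⟩ := h
  have key : ∃ b ∈ circuits (D.map σ.toEmbedding), g ▷ Mor.perm σ = Mor.perm σ ▷ b := by
    induction hg using Submonoid.closure_induction with
    | mem a ha =>
      obtain ⟨b, hb, h⟩ := IsGate.perm ha σ
      exact ⟨b, mem_circuits hb, h⟩
    | one => exact ⟨1, one_mem _, (one_comp _).trans (comp_one _).symm⟩
    | mul x y _ _ hx hy =>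
      obtain ⟨b, hb, h⟩ := hx
      obtain ⟨c, hc, h'⟩ := hy
      exact ⟨b * c, mul_mem hb hc, by
        rw [mul_def, comp_assoc, h', ← comp_assoc, h, comp_assoc, mul_def]⟩
  obtain ⟨b, hb, h⟩ := key
  exact ⟨b, hb, by rw [comp_assoc, h, ← comp_assoc, base_perm]⟩

theorem IsNF.perm {t : Mor 0 n} (h : IsNF t) (σ : Fin n ≃ Fin m) : IsNF (t ▷ perm σ) := by
  rcases h with h | ⟨D, h⟩
  · exact .inl (h.comp _)
  · exact .inr ⟨_, h.perm σ⟩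

/-! ## Adding a wire -/

theorem IsZero.tens {a b : ℕ} {t : Mor n m} (h : IsZero t) (f : Mor a b) : IsZero (t ⊠ f) := by
  obtain ⟨A, rfl, h⟩ := h
  obtain ⟨B, rfl⟩ := exists_rep f
  refine ⟨par A B, rfl, ?_⟩
  ext y x
  simp [interp, h]

theorem NF.tens_plus {D : Finset (Fin n)} {t : Mor 0 n} (h : NF D t) :
    NF (D.map Fin.castSuccEmb) (t ⊠ plus1) := by
  obtain ⟨g, hg, rfl⟩ := h
  set E := D.map Fin.castSuccEmb
  have hE : low E = D := by
    ext u
    simp [E, mem_low]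
  have hl : Fin.last n ∉ E := by simp [E]
  have hn : ∀ u ∉ D, u.castSucc ∉ E := fun u hu => by simpa [E] using hu
  have hm : ∀ u ∈ D, u.castSucc ∈ E := fun u hu => by simpa [E] using hu
  refine ⟨g ⊠ 𝐈, ?_, ?_⟩
  · induction hg using Submonoid.closure_induction with
    | mem a ha =>
      have ha' : IsGate D a := ha
      cases ha' with
      | of₀ h => cases h with
        | ofS u hu => exact (gate_low_one _ u) ▸ mem_circuits (.of₀ (.ofS _ (hn u hu)))
        | ofZp u hu => exact (gate_low_one _ u) ▸ mem_circuits (.of₀ (.ofZp _ (hn u hu)))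
        | ofCZ u v hu hv =>
          exact (gate_low_two _ u v) ▸ mem_circuits (.of₀ (.ofCZ _ _ (hn u hu) (hn v hv)))
        | ofCX u v hu hv =>
          exact (gate_low_two _ u v) ▸ mem_circuits (.of₀ (.ofCX _ _ (hn u hu) (hm v hv)))
      | ofX v hv => exact (gate_low_one _ v) ▸ mem_circuits (.ofX _ (hm v hv))
    | one => rw [one_def, one_tens_one]; exact one_mem _
    | mul x y _ _ hx hy => rw [tens_wire_mul]; exact mul_mem hx hy
  · have h := interchange (base D) g plus1 𝐈
    rw [base_low, hE, prep_of_notMem hl]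
    rw [comp_one] at h ⊢
    exact h.symm

theorem IsNF.tens_plus {t : Mor 0 n} (h : IsNF t) : IsNF (t ⊠ plus1) := by
  rcases h with h | ⟨D, h⟩
  · exact .inl (h.tens _)
  · exact .inr ⟨_, h.tens_plus⟩

/-! ## Stabilizer diagrams preserve normal forms -/

/-- Applying `A` to the last wires of a state preserves the existence of normal forms. -/
def Good (A : Mor n m) : Prop := ∀ (k : ℕ) (t : Mor 0 (k + n)), IsNF t → IsNF (t ▷ (one k ⊠ A))

theorem good_comp {k : ℕ} {A : Mor n m} {B : Mor m k} (hA : Good A) (hB : Good B) :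
    Good (A ▷ B) := fun l t ht => by
  rw [one_tens_comp, ← comp_assoc]
  exact hB _ _ (hA _ _ ht)

theorem good_perm (σ : Fin n ≃ Fin m) : Good (perm σ) := fun k t ht => by
  rw [← perm_refl, perm_tens]
  exact ht.perm _

theorem good_one (n : ℕ) : Good (one n) := good_perm (Equiv.refl _)

theorem good_one_tens (l : ℕ) {A : Mor n m} (hA : Good A) : Good (one l ⊠ A) := fun k t ht => by
  have h := tens_assoc (one k) (one l) A
  have h1 : one k ⊠ (one l ⊠ A) = perm (finCongr (Nat.add_assoc k l n)).symm ▷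
      ((one (k + l) ⊠ A) ▷ perm (finCongr (Nat.add_assoc k l m))) := by
    rw [← one_tens_one, h, ← comp_assoc, perm_symm_comp, one_comp]
  rw [h1, ← comp_assoc, ← comp_assoc]
  exact (hA _ _ (ht.perm _)).perm _

theorem good_tens_one (l : ℕ) {A : Mor n m} (hA : Good A) : Good (A ⊠ one l) := by
  rw [tens_one_eq_flip]
  exact good_comp (good_comp (good_perm _) (good_one_tens l hA)) (good_perm _)

theorem good_tens {n' m' : ℕ} {A : Mor n m} {B : Mor n' m'} (hA : Good A) (hB : Good B) :
    Good (A ⊠ B) := by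
  rw [tens_eq]
  exact good_comp (good_tens_one _ hA) (good_one_tens _ hB)

theorem good_plus : Good plus1 := fun k t ht => by
  have h := interchange t (one k) (one 0) plus1
  rw [tens_one_zero] at h
  have h2 : t ▷ (one k ⊠ plus1) = t ⊠ plus1 :=
    h.trans (congrArg₂ (fun (a : Mor 0 k) b => a ⊠ b) (comp_one t) (one_comp plus1))
  rw [h2]
  exact ht.tens_plus

theorem good_effect : Good eff1 := fun _ _ ht => ht.drop

theorem IsNF.diag {t : Mor 0 n} (h : IsNF t) {a : Mor n n} (ha : a ∈ diagCircuits ∅) :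
    IsNF (t ▷ a) := by
  rcases h with h | ⟨D, h⟩
  · exact .inl (h.comp _)
  · exact .inr ⟨D, h.diag ha⟩

theorem good_ph (a b : ZMod 3) : Good (ph a b) := fun k t ht => by
  rw [← gate_last]
  exact ht.diag (mem_diagCircuits_ph (Finset.notMem_empty _) a b)

theorem good_cz : Good cz := fun k t ht => by
  rw [← gate_natAdd]
  have : (Fin.natAdd k : Fin 2 → Fin (k + 2)) = ![Fin.natAdd k 0, Fin.natAdd k 1] := by
    ext i; fin_cases i <;> rfl
  rw [this]
  exact ht.diag (mem_diagCircuits (.ofCZ _ _ (Finset.notMem_empty _) (Finset.notMem_empty _)))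

/-- The Hadamard node is not among the gates handled directly. Teleportation replaces it by a fresh
|+⟩, a link and the effect ⟨+|, all of which preserve normal forms. -/
theorem good_H : Good H := by
  rw [H_eq_gates]
  exact good_comp (good_one_tens 1 good_plus)
    (good_comp good_cz (good_tens_one 1 good_effect))

theorem good_H' : Good H' := by
  rw [← H_H_H]
  exact good_comp good_H (good_comp good_H good_H)

theorem good_C : Good (Z 1 2 0 0) := by
  rw [C_eq_gates]
  exact good_comp (good_one_tens 1 good_plus) (good_comp good_cz (good_one_tens 1 good_H'))

theorem good_M : Good (Z 2 1 0 0) := by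
  rw [M_eq_gates]
  exact good_comp (good_tens_one 1 good_H') (good_comp good_cz (good_tens_one 1 good_effect))

theorem good_Z_one (n : ℕ) : Good (Z n 1 0 0) := by
  induction n with
  | zero => exact good_plus
  | succ n ih =>
    have h := Z_one_tens_comp (n := n) (k := 1) (m := 1) 1 one_pos 0 0 0 0
    rw [add_zero] at h
    rw [← h]
    exact good_comp (good_tens_one 1 ih) good_M

theorem good_one_Z (m : ℕ) : Good (Z 1 m 0 0) := by
  induction m with
  | zero => exact good_effect
  | succ m ih =>
    have h := Z_comp_tens_one (n := 1) (k := 1) (m := m) 1 one_pos 0 0 0 0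
    rw [add_zero] at h
    rw [← h]
    exact good_comp good_C (good_tens_one 1 ih)

theorem IsThird.eq_ang {α : Real.Angle} (h : IsThird α) : ∃ a : ZMod 3, α = ang a := by
  obtain ⟨k, rfl⟩ := h
  refine ⟨(k : ZMod 3), ?_⟩
  obtain ⟨q, hq⟩ : ∃ q : ℤ, k = ((k : ZMod 3).val : ℤ) + 3 * q := by
    have : (((k : ZMod 3).val : ℤ) : ZMod 3) = (k : ZMod 3) := by simp
    obtain ⟨q, hq⟩ := (ZMod.intCast_eq_intCast_iff_dvd_sub _ _ 3).1 this
    exact ⟨q, by push_cast at hq; linarith⟩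
  rw [ang, Real.Angle.angle_eq_iff_two_pi_dvd_sub]
  refine ⟨q, ?_⟩
  have hq' : (k : ℝ) = ((k : ZMod 3).val : ℝ) + 3 * q := by exact_mod_cast hq
  rw [hq']
  ring

/-- A green spider factors through one wire: merge all inputs, apply the phase, copy to all outputs.
-/
theorem good_Z (n m : ℕ) {α β : Real.Angle} (hα : IsThird α) (hβ : IsThird β) :
    Good (Z n m α β) := by
  obtain ⟨a, rfl⟩ := IsThird.eq_ang hα
  obtain ⟨b, rfl⟩ := IsThird.eq_ang hβ
  have h1 := Z_comp (n := n) (m := 1) one_pos 0 0 (ang a) (ang b)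
  have h2 := Z_comp (n := n) (m := m) one_pos (0 + ang a) (0 + ang b) 0 0
  rw [← h1, zero_add, zero_add, add_zero, add_zero] at h2
  rw [← h2]
  exact good_comp (good_comp (good_Z_one n) (good_ph a b)) (good_one_Z m)

theorem good_copies (n : ℕ) {A : Diag 1 1} (hA : Good (mk A)) : Good (mk (copies n A)) := by
  induction n with
  | zero => exact good_one 0
  | succ n ih => exact good_tens ih hA

theorem good_of_isStabilizer {A : Diag n m} (hA : A.IsStabilizer) : Good (mk A) := by
  induction A with
  | zsp n m α β => exact good_Z n m hA.1 hA.2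
  | xsp n m α β =>
    change Good (R n m α β)
    rw [← R_eq]
    exact good_comp (good_copies n good_H')
      (good_comp (good_Z n m hA.1 hA.2) (good_copies m good_H))
  | had => exact good_H
  | hadDag => exact good_H'
  | wires e => exact good_perm e
  | seq A B ihA ihB => exact good_comp (ihA hA.1) (ihB hA.2)
  | par A B ihA ihB => exact good_tens (ihA hA.1) (ihB hA.2)

theorem isNF_of_isStabilizer {A : Diag 0 n} (hA : A.IsStabilizer) : IsNF (mk A) := by
  have h0 : IsNF (one 0) := .inr ⟨∅, 1, one_mem _, ((comp_one _).trans (comp_one _)).symm⟩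
  have h := good_of_isStabilizer hA 0 (one 0) h0
  rw [show (one 0 : Mor 0 (0 + 0)) ▷ (one 0 ⊠ mk A) = one 0 ⊠ mk A from one_comp _] at h
  have h1 := one_zero_tens (mk A)
  have h2 : perm (finCongr (Nat.zero_add 0)) = one 0 := by
    rw [← perm_refl]; congr 1
  rw [h2, one_comp] at h1
  rw [← h1]
  exact h.perm _

theorem exists_NF {A : Diag 0 n} (hA : A.IsStabilizer) (h0 : A.interp ≠ 0) : ∃ D, NF D (mk A) := by
  rcases isNF_of_isStabilizer hA with ⟨B, hB, hB0⟩ | h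
  -- Soundness enters here: a diagram equal to one of value zero has value zero, against the
  -- hypothesis.
  · obtain ⟨c, -, hc⟩ := Equal.sound (mk_eq_iff.1 hB.symm)
    refine absurd ?_ h0
    ext y x
    rw [hc, hB0]
    simp
  · exact h

end Stabilizer
end Mor
end QutritZX
end

/-! ### Local gates, and graph states as circuits of controlled phases -/

noncomputable section
namespace QutritZX
open Diag
namespace Mor

section GraphStates

local notation "𝐈" => one 1

variable {n : ℕ}

/-! ## One gate on each wire -/

/-- The gates `W i`, one on each wire. -/
def all : (n : ℕ) → (Fin n → Mor 1 1) → Mor n n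
  | 0, _ => one 0
  | n + 1, W => all n (fun i => W i.castSucc) ⊠ W (Fin.last n)

theorem mk_parAll (n : ℕ) (U : Fin n → Diag 1 1) : mk (parAll n U) = all n fun i => mk (U i) := by
  induction n with
  | zero => rfl
  | succ n ih =>
    rw [all, ← ih]
    rfl

theorem all_one (n : ℕ) : all n (fun _ => 1) = 1 := by
  induction n with
  | zero => rfl
  | succ n ih =>
    rw [all, ih]
    exact one_tens_one n 1

theorem all_mul (n : ℕ) (V W : Fin n → Mor 1 1) : all n V * all n W = all n fun i => V i * W i := by
  induction n with
  | zero => exact one_comp _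
  | succ n ih =>
    rw [all, all, all, mul_def, ← ih]
    exact interchange _ _ _ _

theorem all_update (A : Mor 1 1) (u : Fin n) :
    all n (fun i => if i = u then A else 1) = gate A ![u] := by
  induction n with
  | zero => exact u.elim0
  | succ n ih =>
    refine Fin.lastCases ?_ (fun u => ?_) u
    · rw [all, if_pos rfl, gate_last]
      simp only [Fin.castSucc_ne_last, if_false, all_one]
      rfl
    · rw [all, if_neg (Fin.castSucc_ne_last u).symm, gate_low_one]
      simp only [Fin.castSucc_inj, ih]
      rfl

theorem closure_all (M : Fin n → Submonoid (Mor 1 1)) {z : Mor n n}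
    (hz : z ∈ Submonoid.closure {a | ∃ u, ∃ A ∈ M u, a = gate A ![u]}) :
    ∃ W : Fin n → Mor 1 1, (∀ u, W u ∈ M u) ∧ z = all n W := by
  induction hz using Submonoid.closure_induction with
  | mem a ha =>
    obtain ⟨u, A, hA, rfl⟩ := ha
    refine ⟨fun i => if i = u then A else 1, fun i => ?_, (all_update A u).symm⟩
    beta_reduce
    by_cases h : i = u
    · subst h; rwa [if_pos rfl]
    · rw [if_neg h]; exact one_mem _
  | one => exact ⟨fun _ => 1, fun _ => one_mem _, (all_one n).symm⟩
  | mul x y _ _ hx hy =>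
    obtain ⟨V, hV, rfl⟩ := hx
    obtain ⟨W, hW, rfl⟩ := hy
    exact ⟨_, fun u => mul_mem (hV u) (hW u), all_mul n V W⟩

theorem hads_eq_all (D : Finset (Fin n)) : hads D = all n (prep D) := by
  induction D using Finset.induction with
  | empty =>
    have : prep (∅ : Finset (Fin n)) = fun _ => 1 := funext fun i => prep_of_notMem (Finset.notMem_empty i)
    rw [this, all_one]
    rfl
  | insert u D hu ih =>
    rw [hads_insert hu, ih, Hd, ← all_update, all_mul]
    congr 1
    ext i
    by_cases h : i = u
    · subst h
      rw [if_pos rfl, prep_of_notMem hu, prep_of_mem (Finset.mem_insert_self _ _)]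
      exact comp_one _
    · rw [if_neg h, one_mul]
      by_cases hi : i ∈ D
      · rw [prep_of_mem hi, prep_of_mem (Finset.mem_insert_of_mem hi)]
      · rw [prep_of_notMem hi, prep_of_notMem (by simp [h, hi])]

theorem plus_all {V W : Fin n → Mor 1 1} (h : ∀ i, plus1 ▷ V i = plus1 ▷ W i) :
    plus n ▷ all n V = plus n ▷ all n W := by
  induction n with
  | zero => rfl
  | succ n ih =>
    have e : ∀ V : Fin (n + 1) → Mor 1 1, plus (n + 1) ▷ all (n + 1) V =
        (plus n ▷ all n fun i => V i.castSucc) ⊠ (plus1 ▷ V (Fin.last n)) := fun V =>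
      interchange _ _ _ _
    rw [e, e, h, ih fun i => h i.castSucc]

/-! ## Graph states -/

/-- The class of a graph state. -/
def gs (Γ : Matrix (Fin n) (Fin n) (ZMod 3)) : Mor 0 n := mk (graphState n Γ)

/-- The class of the links between the last wire and the others. -/
def star (n : ℕ) (w : Fin n → ZMod 3) : Mor (n + 1) (n + 1) := mk (starEdges n w)

/-- The exchange of the last two wires. -/
def exch (n : ℕ) : Fin (n + 2) ≃ Fin (n + 2) := Equiv.swap (Fin.last n).castSucc (Fin.last (n + 1))

theorem mk_edge (w : ZMod 3) : mk (edge w) = cz ^ w.val := by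
  have h : w = 0 ∨ w = 1 ∨ w = 2 := by revert w; decide
  rcases h with rfl | rfl | rfl
  · rw [edge, if_pos rfl]; rfl
  · rw [show (1 : ZMod 3).val = 1 from rfl, pow_one, cz, link_eq]; rfl
  · rw [show (2 : ZMod 3).val = 2 from rfl, ← link_H', link_eq]; rfl

theorem mk_edge_succ (w : ZMod 3) : mk (edge (w + 1)) = mk (edge w) * cz := by
  rw [mk_edge, mk_edge, ← pow_succ]
  have h : w = 0 ∨ w = 1 ∨ w = 2 := by revert w; decide
  rcases h with rfl | rfl | rfl
  · rfl
  · rfl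
  · exact cz_three.symm

theorem one_tens_sw (n : ℕ) : one n ⊠ sw = perm (exch n) := by
  refine (perm_tens_of (Equiv.refl (Fin n)) (Equiv.swap (0 : Fin 2) 1) (exch n) ?_ ?_).symm
  · intro i
    refine Equiv.swap_apply_of_ne_of_ne ?_ ?_
    · simp [Fin.ext_iff]; omega
    · simp [Fin.ext_iff]; omega
  · intro j
    fin_cases j
    · exact Equiv.swap_apply_left _ _
    · exact Equiv.swap_apply_right _ _

theorem one_tens_two (n : ℕ) (A : Mor 2 2) :
    one n ⊠ A = gate A ![(Fin.last n).castSucc, Fin.last (n + 1)] := by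
  rw [← gate_natAdd]
  congr 1
  ext i
  fin_cases i <;> rfl

/-- The conjugate of a circuit by the exchange of the last two wires. -/
def conj (f : Mor (n + 1) (n + 1)) : Mor (n + 2) (n + 2) :=
  perm (exch n) * ((f ⊠ 𝐈) * perm (exch n))

theorem exch_exch (n : ℕ) : perm (exch n) * perm (exch n) = 1 := by
  rw [mul_def, perm_comp, one_def, ← perm_refl]
  congr 1
  exact Equiv.swap_swap (Fin.last n).castSucc (Fin.last (n + 1))

theorem conj_one : conj (1 : Mor (n + 1) (n + 1)) = 1 := by
  rw [conj, one_def, one_tens_one]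
  exact (congrArg _ (one_mul _)).trans (exch_exch n)

theorem conj_mul (f g : Mor (n + 1) (n + 1)) : conj (f * g) = conj f * conj g := by
  rw [conj, conj, conj, tens_wire_mul]
  simp only [mul_assoc]
  rw [← mul_assoc (perm _) (perm _), exch_exch, one_mul]

theorem conj_CZ (i : Fin n) : conj (CZ i.castSucc (Fin.last n)) =
    CZ i.castSucc.castSucc (Fin.last (n + 1)) := by
  have h := gate_perm cz ![i.castSucc.castSucc, (Fin.last n).castSucc] (exch n)
  have h2 : exch n ∘ ![i.castSucc.castSucc, (Fin.last n).castSucc] =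
      ![i.castSucc.castSucc, Fin.last (n + 1)] := by
    ext j
    fin_cases j
    · refine congrArg Fin.val (Equiv.swap_apply_of_ne_of_ne ?_ ?_)
      · simp [Fin.ext_iff]; omega
      · simp [Fin.ext_iff]; omega
    · exact congrArg Fin.val (Equiv.swap_apply_left _ _)
  rw [conj, CZ, ← gate_low_two, mul_def (gate _ _), h, h2, ← mul_def (perm _), ← mul_assoc, exch_exch,
    one_mul, CZ]

theorem star_succ (w : Fin (n + 1) → ZMod 3) : star (n + 1) w =
    gate (mk (edge (w (Fin.last n)))) ![(Fin.last n).castSucc, Fin.last (n + 1)] *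
      conj (star n fun i => w i.castSucc) := by
  rw [conj, ← one_tens_two, ← one_tens_sw]
  rfl

/-- The exchanges of wires only relabel the links. As a product of controlled phases, the star
commutes with every `CZ`, so edges can be added in any order. -/
theorem star_mem (w : Fin n → ZMod 3) :
    star n w ∈ Submonoid.closure {a | ∃ i : Fin n, a = CZ i.castSucc (Fin.last n)} := by
  induction n with
  | zero => exact one_mem _
  | succ n ih =>
    rw [star_succ]
    refine mul_mem ?_ ?_
    · rw [mk_edge, ← gateHom_apply, map_pow]
      refine pow_mem (Submonoid.subset_closure ?_) _
      exact ⟨Fin.last n, rfl⟩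
    · have h := ih fun i => w i.castSucc
      generalize star n (fun i => w i.castSucc) = f at h
      induction h using Submonoid.closure_induction with
      | mem a ha =>
        obtain ⟨i, rfl⟩ := ha
        rw [conj_CZ]
        exact Submonoid.subset_closure ⟨_, rfl⟩
      | one => rw [conj_one]; exact one_mem _
      | mul x y _ _ hx hy => rw [conj_mul]; exact mul_mem hx hy

theorem star_commute (w : Fin n → ZMod 3) (i j : Fin (n + 1)) : Commute (star n w) (CZ i j) :=
  closure_commute (s := {a | ∃ i : Fin n, a = CZ i.castSucc (Fin.last n)}) (t := {CZ i j})
    (by rintro _ ⟨k, rfl⟩ _ rfl; exact CZ_CZ_commute _ _ _ _) (star_mem w)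
    (Submonoid.subset_closure (Set.mem_singleton _))

theorem star_zero (n : ℕ) : star n (fun _ => 0) = 1 := by
  induction n with
  | zero => rfl
  | succ n ih =>
    rw [star_succ, ih, conj_one, mul_one, mk_edge, ZMod.val_zero, pow_zero, one_def, gate_one]
    rfl

theorem star_add (w : Fin n → ZMod 3) (i : Fin n) : star n w * CZ i.castSucc (Fin.last n) =
    star n fun j => w j + if j = i then 1 else 0 := by
  induction n with
  | zero => exact i.elim0
  | succ n ih =>
    refine Fin.lastCases ?_ (fun i => ?_) i
    · rw [(star_commute w _ _).eq, star_succ, star_succ, ← mul_assoc]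
      congr 1
      · rw [if_pos rfl, mk_edge_succ, mul_def (mk _), gate_comp, ← mul_def, mk_edge, ← gateHom_apply,
          map_pow]
        exact (pow_mul_comm' (gateHom _ cz) _).symm
      · simp only [Fin.castSucc_ne_last, if_false, add_zero]
    · rw [star_succ, star_succ, ← conj_CZ, mul_assoc, ← conj_mul, ih]
      simp only [(Fin.castSucc_ne_last i).symm, if_false, add_zero, Fin.castSucc_inj]

/-- The weighted graph with the weight of the edge between `u` and `v` increased by one. -/
def addEdge (Γ : Matrix (Fin n) (Fin n) (ZMod 3)) (u v : Fin n) : Matrix (Fin n) (Fin n) (ZMod 3) :=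
  Matrix.of fun i j => Γ i j + if i = u ∧ j = v ∨ i = v ∧ j = u then 1 else 0

theorem gs_succ (Γ : Matrix (Fin (n + 1)) (Fin (n + 1)) (ZMod 3)) :
    gs Γ = (gs (Γ.submatrix Fin.castSucc Fin.castSucc) ⊠ plus1) ▷
      star n fun i => Γ (Fin.last n) i.castSucc := rfl

theorem gs_zero (n : ℕ) : gs (0 : Matrix (Fin n) (Fin n) (ZMod 3)) = plus n := by
  induction n with
  | zero => rfl
  | succ n ih =>
    rw [gs_succ, plus_succ, ← ih]
    exact (congrArg _ (star_zero n)).trans (comp_one _)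

/-- An edge at the last vertex changes the star of that vertex; any other edge passes through the
star into the smaller graph, by induction. -/
theorem gs_CZ (Γ : Matrix (Fin n) (Fin n) (ZMod 3)) {u v : Fin n} (huv : u ≠ v) :
    gs Γ ▷ CZ u v = gs (addEdge Γ u v) := by
  induction n with
  | zero => exact u.elim0
  | succ n ih =>
    have hlast : ∀ (Γ : Matrix (Fin (n + 1)) (Fin (n + 1)) (ZMod 3)) (u : Fin n),
        gs Γ ▷ CZ u.castSucc (Fin.last n) = gs (addEdge Γ u.castSucc (Fin.last n)) := by
      intro Γ u
      rw [gs_succ, gs_succ, comp_assoc, ← mul_def, star_add]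
      congr 2
      · congr 1
        ext i j
        simp [addEdge, Fin.castSucc_ne_last]
      · ext j
        simp [addEdge, (Fin.castSucc_ne_last _).symm]
    have hsymm : ∀ u v : Fin (n + 1), addEdge Γ u v = addEdge Γ v u := by
      intro u v
      ext i j
      simp only [addEdge, Matrix.of_apply, or_comm]
    revert huv
    refine Fin.lastCases ?_ (fun u => ?_) u <;> refine Fin.lastCases ?_ (fun v => ?_) v
    · exact fun h => absurd rfl h
    · intro _
      rw [CZ_symm, hsymm]
      exact hlast Γ v
    · exact fun _ => hlast Γ u
    · intro huv
      have huv' : u ≠ v := fun e => huv (e ▸ rfl)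
      have h1 := interchange (gs (Γ.submatrix Fin.castSucc Fin.castSucc)) (CZ u v) plus1 𝐈
      have h2 : CZ u.castSucc v.castSucc = CZ u v ⊠ 𝐈 := gate_low_two cz u v
      rw [ih _ huv', comp_one, ← h2] at h1
      rw [gs_succ, gs_succ, comp_assoc, ← mul_def, (star_commute _ _ _).eq, mul_def, ← comp_assoc]
      refine (congrArg (fun f => f ▷ star n _) h1).trans ?_
      congr 2
      · congr 1
        ext i j
        simp [addEdge]
      · ext j
        simp [addEdge, (Fin.castSucc_ne_last _).symm]

/-- Adjacency matrices without edges inside `D`. -/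
def IsAdmissible (D : Finset (Fin n)) (Γ : Matrix (Fin n) (Fin n) (ZMod 3)) : Prop :=
  IsAdjacency Γ ∧ ∀ u ∈ D, ∀ v ∈ D, Γ u v = 0

theorem IsAdmissible.addEdge {D : Finset (Fin n)} {Γ : Matrix (Fin n) (Fin n) (ZMod 3)}
    (h : IsAdmissible D Γ) {u v : Fin n} (huv : u ≠ v) (hD : ¬ (u ∈ D ∧ v ∈ D)) :
    IsAdmissible D (addEdge Γ u v) := by
  obtain ⟨⟨h1, h2⟩, h3⟩ := h
  refine ⟨⟨?_, fun i => ?_⟩, fun i hi j hj => ?_⟩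
  · ext i j
    have := h1.apply j i
    simp only [Mor.addEdge, Matrix.transpose_apply, Matrix.of_apply, this]
    congr 1
    refine if_congr ?_ rfl rfl
    tauto
  · simp only [Mor.addEdge, Matrix.of_apply, h2]
    rw [if_neg, add_zero]
    rintro (⟨rfl, rfl⟩ | ⟨rfl, rfl⟩) <;> exact huv rfl
  · simp only [Mor.addEdge, Matrix.of_apply, h3 i hi j hj]
    rw [if_neg, add_zero]
    rintro (⟨rfl, rfl⟩ | ⟨rfl, rfl⟩)
    · exact hD ⟨hi, hj⟩
    · exact hD ⟨hj, hi⟩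

theorem exists_gs {D : Finset (Fin n)} {z : Mor n n}
    (hz : z ∈ Submonoid.closure {a | ∃ u v, ¬ (u ∈ D ∧ v ∈ D) ∧ a = CZ u v}) :
    ∃ Γ, IsAdmissible D Γ ∧ plus n ▷ z = gs Γ := by
  -- The starting graph is arbitrary so that a product of links can be processed factor by factor;
  -- the claim itself starts from the empty graph.
  suffices h : ∀ Γ, IsAdmissible D Γ → ∃ Γ', IsAdmissible D Γ' ∧ gs Γ ▷ z = gs Γ' by
    rw [← gs_zero]
    exact h 0 ⟨⟨Matrix.isSymm_zero, fun _ => rfl⟩, fun _ _ _ _ => rfl⟩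
  induction hz using Submonoid.closure_induction with
  | mem a ha =>
    obtain ⟨u, v, hD, rfl⟩ := ha
    intro Γ hΓ
    by_cases huv : u = v
    · exact ⟨Γ, hΓ, by rw [huv, CZ_self]; exact comp_one _⟩
    · exact ⟨_, hΓ.addEdge huv hD, gs_CZ Γ huv⟩
  | one => exact fun Γ hΓ => ⟨Γ, hΓ, comp_one _⟩
  | mul x y _ _ hx hy =>
    intro Γ hΓ
    obtain ⟨Γ', h', e⟩ := hx Γ hΓ
    obtain ⟨Γ'', h'', e'⟩ := hy Γ' h'
    exact ⟨Γ'', h'', by rw [mul_def, ← comp_assoc, e, e']⟩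

end GraphStates
end Mor
end QutritZX
end

/-! ### From normal forms to reduced GS-LC diagrams -/

noncomputable section
namespace QutritZX
open Diag
namespace Mor

section Reduced

local notation "𝐈" => one 1

variable {n : ℕ} {D : Finset (Fin n)}

/-! ## Normal forms are reduced GS-LC diagrams -/

/-- The green phase gates. -/
def phases : Submonoid (Mor 1 1) where
  carrier := {f | ∃ a b, f = ph a b}
  one_mem' := ⟨0, 0, ph_zero.symm⟩
  mul_mem' := by
    rintro _ _ ⟨a, b, rfl⟩ ⟨c, d, rfl⟩
    exact ⟨a + c, b + d, ph_comp a b c d⟩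

theorem rph_pow (a b : ZMod 3) (k : ℕ) : rph a b ^ k = rph (k * a) (k * b) := by
  induction k with
  | zero => simp only [pow_zero, Nat.cast_zero, zero_mul]; exact rph_zero.symm
  | succ k ih =>
    rw [pow_succ, ih, mul_def, rph_comp]
    congr 1 <;> push_cast <;> ring

/-- The Euler decomposition again: appending green (2,2) after H† brings the vertex operator into
the green-then-red shape of 𝓡. -/
theorem H'_ph : H' * ph 2 2 = ph 1 1 * rph 1 1 := by
  have h : H ▷ (ph 1 1 ▷ rph 1 1) = ph 2 2 := by
    rw [euler, comp_assoc, comp_assoc, ph_three', rph_comp]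
    exact (congrArg _ rph_zero).trans (comp_one _)
  rw [mul_def, mul_def, ← h, ← comp_assoc, H'_H, one_comp]

theorem all_pow (V : Fin n → Mor 1 1) (k : ℕ) : all n V ^ k = all n fun i => V i ^ k := by
  induction k with
  | zero => simp only [pow_zero, all_one]
  | succ k ih => simp only [pow_succ, ih, all_mul]

/-- HH fixes |+⟩, so H may be replaced by H³ = H†. This inverse is the one that turns `CX` into `CZ`
and fits `H'_ph`. -/
theorem base_eq_hads_cube (D : Finset (Fin n)) : base D = plus n ▷ hads D ^ 3 := by
  rw [base, hads_eq_all, all_pow]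
  refine plus_all fun i => ?_
  by_cases h : i ∈ D
  · rw [prep_of_mem h, pow_three', mul_def (H * H), ← comp_assoc, mul_def, plus_H_H]
  · rw [prep_of_notMem h]
    exact congrArg _ (one_pow 3).symm

/-- The gates of normal forms after passing through the Hadamard nodes. -/
def IsGraphGate (D : Finset (Fin n)) (a : Mor n n) : Prop :=
  (∃ u v, ¬ (u ∈ D ∧ v ∈ D) ∧ a = CZ u v) ∨
    ∃ u, ∃ A ∈ (if u ∈ D then ⊥ else phases : Submonoid (Mor 1 1)), a = gate A ![u]

theorem IsGate₀.semiconj_hads {a : Mor n n} (h : IsGate₀ D a) :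
    ∃ b ∈ Submonoid.closure {a | IsGraphGate D a}, SemiconjBy (hads D ^ 3) a b := by
  have h1 : ∀ {u}, u ∉ D → ∀ A, Commute (hads D ^ 3) (gate A ![u]) := fun hu A =>
    ((gate_hads A _ fun i => by fin_cases i; exact hu).pow_right 3).symm
  have h2 : ∀ {u}, u ∉ D → ∀ a b, IsGraphGate D (gate (ph a b) ![u]) := fun hu a b =>
    .inr ⟨_, ph a b, by rw [if_neg hu]; exact ⟨a, b, rfl⟩, rfl⟩
  have h3 : ∀ {a}, IsGraphGate D a → a ∈ Submonoid.closure {a | IsGraphGate D a} := fun h =>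
    Submonoid.subset_closure h
  cases h with
  | ofS u hu => exact ⟨_, h3 (h2 hu 1 1), h1 hu _⟩
  | ofZp u hu => exact ⟨_, h3 (h2 hu 1 2), h1 hu _⟩
  | ofCZ u v hu hv =>
    refine ⟨_, h3 (.inl ⟨u, v, fun h => hu h.1, rfl⟩), ?_⟩
    exact ((gate_hads cz _ fun i => by fin_cases i; exacts [hu, hv]).pow_right 3).symm
  | ofCX u v hu hv =>
    refine ⟨_, h3 (.inl ⟨u, v, fun h => hu h.1, rfl⟩), ?_⟩
    have hu' : u ∉ D.erase v := fun h => hu (Finset.mem_of_mem_erase h)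
    have h4 : hads D = Hd v * hads (D.erase v) := by
      rw [hads_erase D v, prep_of_mem hv]; rfl
    have h5 : Commute (Hd v) (hads (D.erase v)) :=
      gate_hads H _ fun i => by fin_cases i; exact Finset.notMem_erase v D
    -- H³ = H† cancels the H on the target of the sum, which leaves an edge between a vertex outside
    -- D and one in D.
    have h6 : SemiconjBy (Hd v ^ 3) (CX u v) (CZ u v) := by
      rw [pow_three, ← Hi_eq]
      exact semiconj_inv (Hd_Hi v) (Hi_Hd v) (Hd_CZ u v)
    rw [h4, h5.mul_pow]
    refine h6.mul_left ?_
    exact ((gate_hads cx _ fun i => by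
      fin_cases i; exacts [hu', Finset.notMem_erase v D]).pow_right 3).symm

theorem semiconj_hads {g : Mor n n} (hg : g ∈ Submonoid.closure {a | IsGate₀ D a}) :
    ∃ b ∈ Submonoid.closure {a | IsGraphGate D a}, SemiconjBy (hads D ^ 3) g b := by
  induction hg using Submonoid.closure_induction with
  | mem a ha => exact IsGate₀.semiconj_hads ha
  | one => exact ⟨1, one_mem _, SemiconjBy.one_right _⟩
  | mul x y _ _ hx hy =>
    obtain ⟨b, hb, e⟩ := hx
    obtain ⟨c, hc, e'⟩ := hy
    exact ⟨b * c, mul_mem hb hc, e.mul_right e'⟩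

/-- Green phases on the wires in `D` are absorbed by normal forms. -/
theorem absorb_phases {g : Mor n n} (hg : g ∈ Submonoid.closure {a | IsGate₀ D a})
    (E : Finset (Fin n)) : ∃ g' ∈ Submonoid.closure {a | IsGate₀ D a},
      base D ▷ g = base D ▷ (g' * all n fun i => if i ∈ E then ph 2 2 else 1) := by
  induction E using Finset.induction generalizing g with
  | empty => exact ⟨g, hg, by simp only [Finset.notMem_empty, if_false, all_one, mul_one]⟩
  | insert u E hu ih =>
    -- The wanted (2,2) phase is paid for by its inverse `S u`, which is pulled back through the
    -- circuit and absorbed by the base up to diagonal gates outside D.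
    have hS : S u ∈ Submonoid.closure {a : Mor n n | IsDiagGate ∅ a} :=
      mem_diagCircuits (.ofS u (Finset.notMem_empty u))
    obtain ⟨b, hb, e⟩ := semiconj_closure
      (fun _ h _ h' => IsGate.semiconj_diag (.of₀ h) h') hg hS
    obtain ⟨a, ha, e'⟩ := base_diag (D := D) hb
    have ha' : a ∈ Submonoid.closure {a | IsGate₀ D a} :=
      Submonoid.closure_mono (fun _ h => IsDiagGate.isGate₀ h) ha
    obtain ⟨g', hg', h⟩ := ih (mul_mem ha' hg)
    refine ⟨g', hg', ?_⟩
    have h1 : (all n fun i => if i ∈ insert u E then ph 2 2 else 1) =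
        (all n fun i => if i ∈ E then ph 2 2 else 1) * gate (ph 2 2) ![u] := by
      rw [← all_update, all_mul]
      congr 1
      ext i
      by_cases hi : i = u
      · subst hi; simp [hu]
      · simp [hi]
    have h2 : S u * gate (ph 2 2) ![u] = 1 := by
      rw [S, mul_def, ← gate_comp, ph_comp, show (1 + 2 : ZMod 3) = 0 from rfl, ph_zero, gate_one]
      rfl
    have h3 : base D ▷ (g * S u) = base D ▷ (a * g) := by
      rw [e.eq, mul_def, ← comp_assoc, e', comp_assoc]; rfl
    calc base D ▷ g = base D ▷ (g * S u * gate (ph 2 2) ![u]) := by rw [mul_assoc, h2, mul_one]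
      _ = base D ▷ (g' * all n fun i => if i ∈ insert u E then ph 2 2 else 1) := by
        rw [mul_def (g * S u), ← comp_assoc, h3, h, comp_assoc, ← mul_def, mul_assoc, h1]

/-- The red phase gates that are powers of `X`. -/
def redPhases : Submonoid (Mor 1 1) := Submonoid.closure {rph 1 2}

theorem mem_redPhases {A : Mor 1 1} (h : A ∈ redPhases) :
    ∃ κ : ZMod 3, (∃ k : ℕ, A = rph 1 2 ^ k) ∧ A = rph κ (2 * κ) := by
  obtain ⟨k, rfl⟩ := Submonoid.mem_closure_singleton.1 h
  exact ⟨k, ⟨k, rfl⟩, by rw [rph_pow, mul_one, mul_comm]⟩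

theorem circuits_split {g : Mor n n} (hg : g ∈ circuits D) :
    ∃ g₀ ∈ Submonoid.closure {a | IsGate₀ D a}, ∃ X : Fin n → Mor 1 1,
      (∀ u, X u ∈ (if u ∈ D then redPhases else ⊥ : Submonoid (Mor 1 1))) ∧ g = g₀ * all n X := by
  obtain ⟨g, hg', x, hx, rfl⟩ := closure_split (t₁ := {a | IsGate₀ D a})
    (t₂ := {a | ∃ v, ∃ A ∈ (if v ∈ D then redPhases else ⊥ : Submonoid (Mor 1 1)), a = gate A ![v]})
    (fun a ha => by
      have ha' : IsGate D a := ha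
      cases ha' with
      | of₀ h => exact .inl h
      | ofX v hv =>
        refine .inr ⟨v, rph 1 2, ?_, rfl⟩
        rw [if_pos hv]
        exact Submonoid.subset_closure (Set.mem_singleton _))
    (fun a ha b hb => by
      obtain ⟨v, A, hA, rfl⟩ := hb
      by_cases hv : v ∈ D
      · rw [if_pos hv] at hA
        obtain ⟨-, ⟨k, rfl⟩, -⟩ := mem_redPhases hA
        rw [← gateHom_apply, map_pow]
        exact (IsGate₀.commute_X ha hv).pow_right k
      · rw [if_neg hv, Submonoid.mem_bot] at hA
        rw [hA, one_def, gate_one]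
        exact Commute.one_right a) hg
  obtain ⟨X, hX, rfl⟩ := closure_all _ hx
  exact ⟨g, hg', X, hX, rfl⟩

theorem graphCircuits_split {g : Mor n n} (hg : g ∈ Submonoid.closure {a | IsGraphGate D a}) :
    ∃ z ∈ Submonoid.closure {a | ∃ u v, ¬ (u ∈ D ∧ v ∈ D) ∧ a = CZ u v}, ∃ Q : Fin n → Mor 1 1,
      (∀ u, Q u ∈ (if u ∈ D then ⊥ else phases : Submonoid (Mor 1 1))) ∧ g = z * all n Q := by
  obtain ⟨z, hz, q, hq, rfl⟩ := closure_split
    (t₁ := {a : Mor n n | ∃ u v, ¬ (u ∈ D ∧ v ∈ D) ∧ a = CZ u v})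
    (t₂ := {a | ∃ u, ∃ A ∈ (if u ∈ D then ⊥ else phases : Submonoid (Mor 1 1)), a = gate A ![u]})
    (fun a ha => ha)
    (fun a ha c hc => by
      obtain ⟨u, v, -, rfl⟩ := ha
      obtain ⟨w, A, hA, rfl⟩ := hc
      obtain ⟨α, β, rfl⟩ : ∃ a b, A = ph a b := by
        split_ifs at hA with hu
        · exact ⟨0, 0, (Submonoid.mem_bot.1 hA).trans ph_zero.symm⟩
        · exact hA
      exact (ph_CZ_commute _ _ _ _ _).symm) hg
  obtain ⟨Q, hQ, rfl⟩ := closure_all _ hq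
  exact ⟨z, hz, Q, hQ, rfl⟩

/-- The vertex operators of reduced diagrams. -/
def vertexOp (D : Finset (Fin n)) (a b k : Fin n → ZMod 3) (u : Fin n) : Mor 1 1 :=
  if u ∈ D then ph 1 1 * rph (1 + k u) (1 + 2 * k u) else ph (a u) (b u)

/-- On D the factors H†, green (2,2) and X^κ combine into green (1,1) followed by red (1,1) + (κ,
2κ), and the pairs (κ, 2κ) are exactly 𝓜. Off D only green phases remain. -/
theorem exists_vertexOp {Q X : Fin n → Mor 1 1}
    (hQ : ∀ u, Q u ∈ (if u ∈ D then ⊥ else phases : Submonoid (Mor 1 1)))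
    (hX : ∀ u, X u ∈ (if u ∈ D then redPhases else ⊥ : Submonoid (Mor 1 1))) :
    ∃ a b k : Fin n → ZMod 3, ∀ u,
      Q u * (prep D u ^ 3 * ((if u ∈ D then ph 2 2 else 1) * X u)) = vertexOp D a b k u := by
  have key : ∀ u, ∃ α β κ : ZMod 3, Q u * (prep D u ^ 3 * ((if u ∈ D then ph 2 2 else 1) * X u)) =
      if u ∈ D then ph 1 1 * rph (1 + κ) (1 + 2 * κ) else ph α β := by
    intro u
    have hQu := hQ u
    have hXu := hX u
    by_cases hu : u ∈ D
    · rw [if_pos hu] at hQu hXu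
      obtain ⟨κ, -, hκ⟩ := mem_redPhases hXu
      have hH : H ^ 3 = H' := by rw [pow_three]; exact H_H_H
      refine ⟨0, 0, κ, ?_⟩
      rw [if_pos hu, if_pos hu, Submonoid.mem_bot.1 hQu, one_mul, prep_of_mem hu, hH, hκ, ← mul_assoc,
        H'_ph, mul_assoc, mul_def (rph 1 1), rph_comp]
    · rw [if_neg hu] at hQu hXu
      obtain ⟨α, β, h⟩ := hQu
      refine ⟨α, β, 0, ?_⟩
      rw [if_neg hu, if_neg hu, prep_of_notMem hu, Submonoid.mem_bot.1 hXu, h, ← one_def, one_pow,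
        mul_one, mul_one, mul_one]
  choose α β κ hκ using key
  exact ⟨α, β, κ, hκ⟩

/-- The shifts split off at the end, the green phases are inserted before them, and the Hadamard
nodes are then moved behind the remaining gates. What stands in front is a product of links none of
which lies inside D, that is, a graph state. -/
theorem NF.exists_graph {t : Mor 0 n} (h : NF D t) :
    ∃ (Γ : Matrix (Fin n) (Fin n) (ZMod 3)) (a b k : Fin n → ZMod 3), IsAdmissible D Γ ∧
      t = gs Γ ▷ all n (vertexOp D a b k) := by
  obtain ⟨g, hg, rfl⟩ := h
  obtain ⟨g₀, hg₀, X, hX, rfl⟩ := circuits_split hg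
  obtain ⟨g', hg', e⟩ := absorb_phases hg₀ D
  obtain ⟨b, hb, e'⟩ := semiconj_hads hg'
  obtain ⟨z, hz, Q, hQ, rfl⟩ := graphCircuits_split hb
  obtain ⟨Γ, hΓ, hz'⟩ := exists_gs hz
  obtain ⟨α, β, κ, hκ⟩ := exists_vertexOp hQ hX
  refine ⟨Γ, α, β, κ, hΓ, ?_⟩
  have h1 : base D ▷ g' = gs Γ ▷ (all n Q * hads D ^ 3) := by
    rw [base_eq_hads_cube, comp_assoc, ← mul_def, e'.eq, mul_assoc, mul_def z, ← comp_assoc, hz']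
  have h2 : all n Q * hads D ^ 3 * ((all n fun i => if i ∈ D then ph 2 2 else 1) * all n X) =
      all n (vertexOp D α β κ) := by
    rw [hads_eq_all, all_pow, all_mul, all_mul, all_mul]
    congr 1
    funext u
    rw [← hκ, mul_assoc]
  rw [← h2, mul_def g₀, ← comp_assoc, e, mul_def g', ← comp_assoc, h1]
  simp only [mul_def, comp_assoc]

end Reduced
end Mor
end QutritZX
end

theorem mainTheorem5 (n : ℕ) (D : QutritZX.Diag 0 n) (hD : D.IsStabilizer)
    (hD0 : D.interp ≠ 0) :
    ∃ D' : QutritZX.Diag 0 n, D'.IsReducedGSLC ∧ QutritZX.Diag.Equal D D' := by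
  open QutritZX Diag Mor in
  obtain ⟨E, hE⟩ := exists_NF hD hD0
  obtain ⟨Γ, a, b, k, ⟨hΓ, hΓE⟩, h⟩ := hE.exists_graph
  -- Only p = (1,1) from 𝓟 is needed, with m = (k u, 2 k u).
  let U : Fin n → Diag 1 1 := fun u =>
    if u ∈ E then seq (zph 1 1) (xph (1 + k u) (1 + 2 * k u)) else zph (a u) (b u)
  have hU : ∀ u, mk (U u) = vertexOp E a b k u := fun u => by
    by_cases hu : u ∈ E
    · simp only [U, vertexOp, if_pos hu]; rfl
    · simp only [U, vertexOp, if_neg hu]; rfl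
  -- Red nodes occur only on `E`, and admissibility of the graph says that `E` spans no edges.
  have hred : ∀ u, HasRed (U u) → u ∈ E := fun u hu => by
    by_contra hu'
    simp only [U, if_neg hu'] at hu
    exact hu
  refine ⟨gslc Γ U, ⟨Γ, U, hΓ, fun u => ?_, rfl, fun u => ?_, fun u v huv huv' =>
    huv (hΓE u (hred u huv'.1) v (hred v huv'.2))⟩, mk_eq_iff.1 ?_⟩
  · by_cases hu : u ∈ E
    · simp only [U, if_pos hu]; exact .seq (.zph _ _) (.xph _ _)
    · simp only [U, if_neg hu]; exact .zph _ _
  · by_cases hu : u ∈ E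
    · simp only [U, if_pos hu]
      refine .inr ⟨(1, 1), .inl rfl, (k u, 2 * k u), ?_, rfl⟩
      have : ∀ i : ZMod 3, i = 0 ∨ i = 1 ∨ i = 2 := by decide
      rcases this (k u) with e | e | e <;> rw [e]
      · exact .inl rfl
      · exact .inr (.inl rfl)
      · exact .inr (.inr rfl)
    · simp only [U, if_neg hu]; exact .inl ⟨_, _, rfl⟩
  · rw [h, ← funext hU, ← mk_parAll]
    rfl
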